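/- **Setting.** Let $U$ be an open subset of a finite-dimensional real normed space with a smooth Poisson structure $J$ (bracket $\{F,G\}=dF(J\,dG)$, Hamiltonian vector field $X_H=J\,dH$, Lie operator $\mathcal L_HF=dF(X_H)$ on $C^\infty(U)$). Let $H=H_1+H_2+H_3+H_4$ with $H_3=\varepsilon K_3$, $H_4=\varepsilon K_4$, where $H_1,H_2,K_3,K_4$ are smooth on $U$ and $\varepsilon\ge 0$ is a scale parameter ($\varepsilon=1$ is allowed), and let $\varphi^{[i]}_t$ be the (local) flow of $X_{H_i}$. A *composition method* $\mathcal C$ with real coefficients $(a_j,b_j)_{j\le n}$ is $\mathcal C(\varphi^A_h,\varphi^B_h)=\varphi^A_{a_1h}\circ\varphi^B_{b_1h}\circ\cdots\circ\varphi^A_{a_nh}\circ\varphi^B_{b_nh}$. A formal series in $h,\varepsilon$ has *order* $o=(o_0,o_1,\dots)$ if it is $O\big(\sum_{l:\,o_l\neq0}\varepsilon^lh^{o_l+1}\big)$, i.e. each monomial occurring in it is divisible (in $h$ and $\varepsilon$) by one of the $\varepsilon^lh^{o_l+1}$ with $o_l\ne0$ (an entry $0$ means that no such term occurs). $\mathcal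 C$ has order $o$ (where $o_0\neq0$ or $o_1\ne0$) if, in noncommuting variables $A,B$, the series $\prod_j e^{a_jhA}e^{b_jh\varepsilon B}-e^{h(A+\varepsilon B)}$ has order $o$; order $p$ means order $(p)$. Put $e_o(h,\varepsilon)=\sum_{l:\,o_l\ne0}\varepsilon^lh^{o_l}$. A one-step method $\varphi_h$ for $X_H$ has *global error* $O(e(h,\varepsilon))$ if for all compact $K\subset U$, $T$ and $\varepsilon_0$ there are $c,h_0>0$ with $\|\varphi_h^{\,n}(\gamma(0))-\gamma(nh)\|\le c\,e(h,\varepsilon)$ for all $0\le\varepsilon\le\varepsilon_0$, $0<h\le h_0$, all solutions $\gamma:[0,T]\to K$ of $\dot\gamma=X_H(\gamma)$, and all $n\in\mathbb N$ with $nh\le T$. **Theorem.** Let $\mathcal C_1,\mathcal C_2$ have orders $p_1,p_2$ and let $\mathcal C_3$ have order $o$. Let $\varphi_h=\mathcal C_3\big(\mathcal C_1(\varphi^{[1]}_h,\varphi^{[2]}_h),\,\mathcal C_2(\varphi^{[3]}_h,\varphi^{[4]}_h)\big)$. 1. The global error of $\varphi_h$ is the sum of the errors of the three methods: it is $O\big(h^{p_1}+\varepsilon^{p_2+1}h^{p_2}+e_o(h,\varepsilon)\big)$.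 2. As formal series in $h,\varepsilon$ with coefficients operators on $C^\infty(U)$, there are $A_1,A_2,A_3,E_1,E_2,E_3$, where all coefficients of $A_1,A_2,A_3$ are derivations of $C^\infty(U)$ and these series have no constant term in $h$, such that, with $(a^{[i]}_j,b^{[i]}_j)$ the coefficients of $\mathcal C_i$, $$\prod_je^{a^{[1]}_jh\mathcal L_{H_1}}e^{b^{[1]}_jh\mathcal L_{H_2}}=e^{A_1},\qquad \prod_je^{a^{[2]}_jh\mathcal L_{H_3}}e^{b^{[2]}_jh\mathcal L_{H_4}}=e^{A_2},\qquad \prod_je^{a^{[3]}_jA_1}e^{b^{[3]}_jA_2}=e^{A_3},$$ $$A_1=h(\mathcal L_{H_1}+\mathcal L_{H_2})+E_1,\qquad A_2=h(\mathcal L_{H_3}+\mathcal L_{H_4})+E_2,$$ $$A_3=A_1+A_2+E_3=h(\mathcal L_{H_1}+\mathcal L_{H_2}+\mathcal L_{H_3}+\mathcal L_{H_4})+E_1+E_2+E_3,$$ with $E_1=O(h^{p_1+1})$, $E_2=O(\varepsilon^{p_2+1}h^{p_2+1})$, and $E_3$ of order $o$. 3. The product of exponentials of the whole integrator, $\prod_j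 P_1(a^{[3]}_jh)\,P_2(b^{[3]}_jh)$ with $P_1(h)=e^{A_1}$, $P_2(h)=e^{A_2}$ (the inner methods being run with the steps $a_j^{[3]}h$, $b_j^{[3]}h$), also equals $e^{A_3'}$ with $A_3'=h(\mathcal L_{H_1}+\dots+\mathcal L_{H_4})+E_1'+E_2'+E_3'$, where $A_3'$ has derivations as coefficients and no constant term in $h$, and $E_1',E_2',E_3'$ are of the same orders as $E_1,E_2,E_3$ in 2. Write $\mathcal C_{\rm Euler}=\varphi^A_h\circ\varphi^B_h$; $\mathcal C_{\rm Verlet}=\mathcal C_{ABA22}=\varphi^A_{h/2}\circ\varphi^B_h\circ\varphi^A_{h/2}$; $\mathcal C_{\rm TriJump}=V_{\gamma_1h}\circ V_{\gamma_2h}\circ V_{\gamma_1h}$ with $V=\mathcal C_{\rm Verlet}$, $\gamma_1=1/(2-2^{1/3})$, $\gamma_2=1-2\gamma_1$; $\mathcal C_{S6}=V_{a_1h}\circ V_{a_2h}\circ V_{a_3h}\circ V_{a_4h}\circ V_{a_5h}\circ V_{a_4h}\circ V_{a_3h}\circ V_{a_2h}\circ V_{a_1h}$ with $a_5=1-2(a_1+a_2+a_3+a_4)$;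 and $\mathcal C_{ABA42}=\varphi^A_{ch}\circ\varphi^B_{h/2}\circ\varphi^A_{h/\sqrt3}\circ\varphi^B_{h/2}\circ\varphi^A_{ch}$ with $c=(3-\sqrt3)/6$. 4. $\mathcal M_{642}$, i.e. $(\mathcal C_1,\mathcal C_2,\mathcal C_3)=(\mathcal C_{S6},\mathcal C_{\rm Verlet},\mathcal C_{ABA42})$, has global error $O(h^6+\varepsilon h^4+\varepsilon^2h^2)$ for all real $a_1,\dots,a_4$ for which $\mathcal C_{S6}$ has order $6$. 5. $\mathcal M_{42}$, i.e. $(\mathcal C_1,\mathcal C_2,\mathcal C_3)=(\mathcal C_{\rm TriJump},\mathcal C_{\rm Euler},\mathcal C_{ABA22})$, has global error $O(h^4+\varepsilon h^2+\varepsilon^2h)$; in particular, for each constant $\kappa$, it is $O(h^4+\varepsilon h^2)$ in the regime $\varepsilon\le\kappa h$. -/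

import Mathlib

open scoped ContDiff

noncomputable section

/-! ### Composition methods and their orders -/

/-- A composition method `𝒞`, given by its coefficients `(a₁, b₁), …, (aₙ, bₙ)`. -/
abbrev CompMethod := List (ℝ × ℝ)

/-- The integrator `𝒞(φ^A, φ^B)` with step `h`, that is
`φ^A_{a₁ h} ∘ φ^B_{b₁ h} ∘ ⋯ ∘ φ^A_{aₙ h} ∘ φ^B_{bₙ h}`. The arguments need not be exact flows, so
that methods can be nested. -/
def CompMethod.compose {E : Type*} (C : CompMethod) (Φ Ψ : ℝ → E → E) (h : ℝ) : E → E :=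
  C.foldr (fun ab f => Φ (ab.1 * h) ∘ Ψ (ab.2 * h) ∘ f) id

/-- The method obtained from `C` by replacing the step `h` by `c h`. -/
def CompMethod.scale (C : CompMethod) (c : ℝ) : CompMethod :=
  C.map fun ab => (c * ab.1, c * ab.2)

/-- Formal power series in the step size `h`, whose coefficients are polynomials in the
(central) scale parameter `ε` over the (noncommutative) algebra `𝒜`. -/
abbrev FormalSeries (𝒜 : Type*) [Semiring 𝒜] := PowerSeries (Polynomial 𝒜)

namespace FormalSeries

variable {𝒜 : Type*} [Semiring 𝒜] [Algebra ℝ 𝒜]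

/-- The coefficient of `h ^ i * ε ^ k`. -/
def coeff₂ (f : FormalSeries 𝒜) (i k : ℕ) : 𝒜 := (PowerSeries.coeff i f).coeff k

/-- The monomial `X * h ^ i * ε ^ k`. -/
def monomial₂ (i k : ℕ) (X : 𝒜) : FormalSeries 𝒜 :=
  PowerSeries.monomial i (Polynomial.monomial k X)

/-- The exponential `∑ₘ f ^ m / m!` of a formal series without constant term in `h`
(for such `f`, only the terms with `m ≤ n` contribute to the coefficient of `h ^ n`). -/
def exp (f : FormalSeries 𝒜) : FormalSeries 𝒜 :=
  PowerSeries.mk fun n =>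
    ∑ m ∈ Finset.range (n + 1), ((Nat.factorial m : ℝ)⁻¹) • PowerSeries.coeff n (f ^ m)

/-- The product `e^{a₁ f} e^{b₁ g} ⋯ e^{aₙ f} e^{bₙ g}`. -/
def compProd (C : CompMethod) (f g : FormalSeries 𝒜) : FormalSeries 𝒜 :=
  (C.map fun ab => exp (ab.1 • f) * exp (ab.2 • g)).prod

/-- The product of exponentials of the hierarchical composition `𝒞₃(𝒞₁(·, ·), 𝒞₂(·, ·))`, in which
the inner method `𝒞₁` is run with the steps `a_j h` and `𝒞₂` with the steps `b_j h`
of the outer method `𝒞₃`. -/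
def hierProd (C₁ C₂ C₃ : CompMethod) (f₁ f₂ f₃ f₄ : FormalSeries 𝒜) : FormalSeries 𝒜 :=
  (C₃.map fun ab =>
    compProd C₁ (ab.1 • f₁) (ab.1 • f₂) * compProd C₂ (ab.2 • f₃) (ab.2 • f₄)).prod

/-- An order is a tuple `o = (o₀, o₁, …)`, where `o_l` is the power of `h` in front of `ε ^ l` in the
global error and an entry `0` means that there is no such term; thus `(p)` is the ordinary order
`p`. A local error (or an error in the exponent) `f` has order `o` if it is
`O(∑_l ε ^ l h ^ (o_l + 1))`: each nonzero coefficient of `f` belongs to a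
multiple of one of the monomials `ε ^ l h ^ (o_l + 1)` with `o_l ≠ 0`. -/
def IsOfOrder (o : List ℕ) (f : FormalSeries 𝒜) : Prop :=
  ∀ i k : ℕ, f.coeff₂ i k ≠ 0 → ∃ l ≤ k, o.getD l 0 ≠ 0 ∧ o.getD l 0 + 1 ≤ i

end FormalSeries

/-- The global error `∑_l ε ^ l h ^ o_l` that belongs to the order `o = (o₀, o₁, …)`
(entries `0` are skipped). -/
def orderFn (o : List ℕ) (ε h : ℝ) : ℝ :=
  ∑ l ∈ Finset.range o.length, if o.getD l 0 = 0 then 0 else ε ^ l * h ^ (o.getD l 0)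

/-- The composition method `C` has order `o` for systems `H = A + ε B`: in noncommuting variables
`A`, `B`, the difference of `e^{a₁ h A} e^{b₁ h ε B} ⋯ e^{aₙ h A} e^{bₙ h ε B}` and
`e^{h (A + ε B)}` is of order `o`. (The tuple must have an entry for `ε ^ 0` or
for `ε ^ 1`; the error of a composition of flows is never `O(ε ^ 2)`.) For `o = (p)` this is the
ordinary order `p`, i.e. agreement up to and including the terms `h ^ p`. -/
def CompMethod.HasOrder (C : CompMethod) (o : List ℕ) : Prop :=
  (∃ l ≤ 1, o.getD l 0 ≠ 0) ∧
  let A : FormalSeries (FreeAlgebra ℝ (Fin 2)) :=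
    FormalSeries.monomial₂ 1 0 (FreeAlgebra.ι ℝ (0 : Fin 2))
  let εB : FormalSeries (FreeAlgebra ℝ (Fin 2)) :=
    FormalSeries.monomial₂ 1 1 (FreeAlgebra.ι ℝ (1 : Fin 2))
  FormalSeries.IsOfOrder o (FormalSeries.compProd C A εB - FormalSeries.exp (A + εB))

/-- The order of an ordinary method of order `p` when both flows are those of Hamiltonians of size
`ε`: the global error is `ε ^ (p + 1) * h ^ p`. -/
def slowOrder (p : ℕ) : List ℕ := List.replicate (p + 1) 0 ++ [p]

/-! ### The methods used -/

/-- `φ^A_h ∘ φ^B_h` -/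
def methodEuler : CompMethod := [(1, 1)]

/-- `φ^A_{h/2} ∘ φ^B_h ∘ φ^A_{h/2}` -/
def methodVerlet : CompMethod := [(1 / 2, 1), (1 / 2, 0)]

/-- `V_{γ₁ h} ∘ V_{γ₂ h} ∘ V_{γ₁ h}` with `V` the Verlet method, `γ₁ = 1 / (2 - 2^{1/3})` and
`γ₂ = 1 - 2 γ₁`. -/
def methodTriJump : CompMethod :=
  let γ₁ : ℝ := 1 / (2 - (2 : ℝ) ^ (1 / 3 : ℝ))
  let γ₂ : ℝ := 1 - 2 * γ₁
  [γ₁, γ₂, γ₁].flatMap methodVerlet.scale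

/-- The nine-fold symmetric composition of the Verlet method with the coefficients
`a₁, a₂, a₃, a₄, a₅, a₄, a₃, a₂, a₁`, where `a₅ = 1 - 2 (a₁ + a₂ + a₃ + a₄)`. -/
def methodS6 (a₁ a₂ a₃ a₄ : ℝ) : CompMethod :=
  [a₁, a₂, a₃, a₄, 1 - 2 * (a₁ + a₂ + a₃ + a₄), a₄, a₃, a₂, a₁].flatMap methodVerlet.scale

/-- `φ^A_{h/2} ∘ φ^B_h ∘ φ^A_{h/2}`, used for `H = A + ε B` -/
def methodABA22 : CompMethod := [(1 / 2, 1), (1 / 2, 0)]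

/-- `φ^A_{c h} ∘ φ^B_{h/2} ∘ φ^A_{h/√3} ∘ φ^B_{h/2} ∘ φ^A_{c h}` with `c = (3 - √3) / 6` -/
def methodABA42 : CompMethod :=
  [((3 - √3) / 6, 1 / 2), (1 / √3, 1 / 2), ((3 - √3) / 6, 0)]

/-! ### Hamiltonian systems, flows, global error -/

section Hamiltonian

variable {E : Type*} [NormedAddCommGroup E] [NormedSpace ℝ E]

/-- A smooth Poisson structure on the open set `U`, given by its Poisson tensor `J`; the
bracket is `{F, G} = dF (J dG)`. (The canonical structure on position-momentum space has a constant
`J`; rigid bodies, in the variables `(q, p, R, Π)` with `R` a `3 × 3` matrix, have an `x`-dependent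
one.) The Jacobi identity is stated for linear functions, which implies the general one. -/
structure PoissonStructure (U : TopologicalSpace.Opens E) where
  J : E → (E →L[ℝ] ℝ) →L[ℝ] E
  smooth : ContDiffOn ℝ ∞ J U
  skew : ∀ x ∈ U, ∀ α β : E →L[ℝ] ℝ, α (J x β) = -β (J x α)
  jacobi : ∀ x ∈ U, ∀ α β γ : E →L[ℝ] ℝ,
    α (J x (fderiv ℝ (fun y => β (J y γ)) x)) + β (J x (fderiv ℝ (fun y => γ (J y α)) x)) +
      γ (J x (fderiv ℝ (fun y => α (J y β)) x)) = 0

/-- The Hamiltonian vector field `X_H = J dH`. -/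
def PoissonStructure.vectorField {U : TopologicalSpace.Opens E} (P : PoissonStructure U)
    (H : E → ℝ) (x : E) : E :=
  P.J x (fderiv ℝ H x)

/-- `γ` solves `γ' = X(γ)` on the time set `s` and stays in `U`. -/
def IsSolution (U : TopologicalSpace.Opens E) (X : E → E) (γ : ℝ → E) (s : Set ℝ) : Prop :=
  ∀ t ∈ s, γ t ∈ U ∧ HasDerivWithinAt γ (X (γ t)) s t

/-- `Φ` is the (local) flow of the vector field `X` on `U`: whenever a solution in `U` exists from
time `0` to time `t` (of either sign), `Φ t` maps its initial value to its value at time `t`.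
Nothing is required of `Φ t x` if the solution through `x` leaves `U` before time `t`. -/
def IsFlow (U : TopologicalSpace.Opens E) (X : E → E) (Φ : ℝ → E → E) : Prop :=
  ∀ (γ : ℝ → E) (t : ℝ), IsSolution U X γ (Set.uIcc 0 t) → Φ t (γ 0) = γ t

/-- The family `φ ε h` of one-step maps (`h` the step size) has global error `O(e ε h)` as an
integrator of `x' = X ε x`, for the parameters `(ε, h)` in `R`: on each bounded time interval
`[0, T]`, along all exact solutions in a given compact set `K`, uniformly in `0 ≤ ε ≤ ε₀`. -/
def HasGlobalError (U : TopologicalSpace.Opens E) (X : ℝ → E → E) (φ : ℝ → ℝ → E → E)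
    (R : Set (ℝ × ℝ)) (e : ℝ → ℝ → ℝ) : Prop :=
  ∀ K : Set E, IsCompact K → K ⊆ U → ∀ T ε₀ : ℝ, ∃ c > 0, ∃ h₀ > 0,
    ∀ ε h : ℝ, (ε, h) ∈ R → 0 ≤ ε → ε ≤ ε₀ → 0 < h → h ≤ h₀ →
    ∀ γ : ℝ → E, IsSolution U (X ε) γ (Set.Icc 0 T) → (∀ t ∈ Set.Icc 0 T, γ t ∈ K) →
    ∀ n : ℕ, n * h ≤ T → ‖(φ ε h)^[n] (γ 0) - γ (n * h)‖ ≤ c * e ε h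

/-! ### Lie operators -/

/-- The algebra of smooth functions on `U`. -/
def smoothFun (U : TopologicalSpace.Opens E) : Subalgebra ℝ (U → ℝ) where
  carrier := {f | ContDiffOn ℝ ∞ (Function.extend Subtype.val f 0) U}
  mul_mem' := by
    intro f g hf hg
    refine (ContDiffOn.mul hf hg).congr fun x hx => ?_
    have h := Subtype.val_injective.extend_apply (f * g) 0 (⟨x, hx⟩ : U)
    have h₁ := Subtype.val_injective.extend_apply f 0 (⟨x, hx⟩ : U)
    have h₂ := Subtype.val_injective.extend_apply g 0 (⟨x, hx⟩ : U)
    simp only at h h₁ h₂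
    simp [h, h₁, h₂]
  add_mem' := by
    intro f g hf hg
    refine (ContDiffOn.add hf hg).congr fun x hx => ?_
    have h := Subtype.val_injective.extend_apply (f + g) 0 (⟨x, hx⟩ : U)
    have h₁ := Subtype.val_injective.extend_apply f 0 (⟨x, hx⟩ : U)
    have h₂ := Subtype.val_injective.extend_apply g 0 (⟨x, hx⟩ : U)
    simp only at h h₁ h₂
    simp [h, h₁, h₂]
  algebraMap_mem' := by
    intro r
    refine (contDiffOn_const (c := r)).congr fun x hx => ?_
    exact Subtype.val_injective.extend_apply _ (0 : E → ℝ) (⟨x, hx⟩ : U)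

/-- The extension by zero of a smooth function on `U`. -/
def extendZero {U : TopologicalSpace.Opens E} (f : smoothFun U) : E → ℝ :=
  Function.extend Subtype.val (f : U → ℝ) 0

theorem extendZero_apply {U : TopologicalSpace.Opens E} (f : smoothFun U) (x : U) :
    (extendZero f) x = (f : U → ℝ) x :=
  Subtype.val_injective.extend_apply _ _ x

theorem contDiffOn_extendZero {U : TopologicalSpace.Opens E} (f : smoothFun U) :
    ContDiffOn ℝ ∞ (extendZero f) U :=
  f.2

theorem differentiableAt_extendZero {U : TopologicalSpace.Opens E} (f : smoothFun U) (x : U) :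
    DifferentiableAt ℝ (extendZero f) x :=
  ((contDiffOn_extendZero f).contDiffAt (U.isOpen.mem_nhds x.2)).differentiableAt (by simp)

theorem mem_smoothFun {U : TopologicalSpace.Opens E} {F : E → ℝ} (hF : ContDiffOn ℝ ∞ F U) :
    (fun x : U => F x) ∈ smoothFun U :=
  hF.congr fun x hx => Subtype.val_injective.extend_apply _ (0 : E → ℝ) (⟨x, hx⟩ : U)

theorem fderiv_extendZero {U : TopologicalSpace.Opens E} (f : smoothFun U) {G : E → ℝ}
    (hG : ∀ y : U, G y = (f : U → ℝ) y) (x : U) : fderiv ℝ (extendZero f) x = fderiv ℝ G x := by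
  apply Filter.EventuallyEq.fderiv_eq
  filter_upwards [U.isOpen.mem_nhds x.2] with y hy
  exact (extendZero_apply f ⟨y, hy⟩).trans (hG ⟨y, hy⟩).symm

theorem PoissonStructure.contDiffOn_vectorField {U : TopologicalSpace.Opens E}
    (P : PoissonStructure U) {H : E → ℝ} (hH : ContDiffOn ℝ ∞ H U) :
    ContDiffOn ℝ ∞ (P.vectorField H) U :=
  P.smooth.clm_apply (hH.fderiv_of_isOpen U.isOpen (by simp))

/-- The Lie operator `ℒ_H F = dF (X_H) = {F, H}` on the smooth functions on `U`. -/
def PoissonStructure.lieOp {U : TopologicalSpace.Opens E} (P : PoissonStructure U) {H : E → ℝ}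
    (hH : ContDiffOn ℝ ∞ H U) : Derivation ℝ (smoothFun U) (smoothFun U) :=
  Derivation.mk'
    { toFun := fun f => ⟨fun x : U => fderiv ℝ (extendZero f) x (P.vectorField H x),
        mem_smoothFun (((contDiffOn_extendZero f).fderiv_of_isOpen U.isOpen (by simp)).clm_apply
          (P.contDiffOn_vectorField hH))⟩
      map_add' := by
        intro f g
        ext x
        have h := fderiv_extendZero (f + g) (G := (extendZero f) + (extendZero g))
          (fun y => by simp [extendZero_apply]) x
        rw [fderiv_add (differentiableAt_extendZero f x) (differentiableAt_extendZero g x)] at h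
        simp [h]
      map_smul' := by
        intro c f
        ext x
        have h := fderiv_extendZero (c • f) (G := c • (extendZero f))
          (fun y => by simp [extendZero_apply]) x
        rw [fderiv_const_smul (differentiableAt_extendZero f x)] at h
        simp [h] }
    (by
      intro f g
      ext x
      have h := fderiv_extendZero (f * g) (G := (extendZero f) * (extendZero g))
        (fun y => by simp [extendZero_apply]) x
      rw [fderiv_mul (differentiableAt_extendZero f x) (differentiableAt_extendZero g x)] at h
      simp [h, extendZero_apply])

/-- The formal series `ε ^ k h ℒ_H` of operators: the exponent of the flow, with step `h`, of the
Hamiltonian `ε ^ k H`. -/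
def PoissonStructure.lieSeries {U : TopologicalSpace.Opens E} (P : PoissonStructure U) {H : E → ℝ}
    (hH : ContDiffOn ℝ ∞ H U) (k : ℕ) : FormalSeries (Module.End ℝ (smoothFun U)) :=
  FormalSeries.monomial₂ 1 k (P.lieOp hH : smoothFun U →ₗ[ℝ] smoothFun U)

/-- The formal series of operators `A` is a (formal) Lie operator: all its coefficients are
derivations of the algebra of smooth functions, i.e. the operators `F ↦ dF (X)` of vector fields
`X`; moreover it has no constant term in `h`, so that its exponential makes sense. -/
def IsLieOperator {U : TopologicalSpace.Opens E}
    (A : FormalSeries (Module.End ℝ (smoothFun U))) : Prop :=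
  PowerSeries.coeff 0 A = 0 ∧
  ∀ i k : ℕ, ∃ D : Derivation ℝ (smoothFun U) (smoothFun U),
    A.coeff₂ i k = (D : smoothFun U →ₗ[ℝ] smoothFun U)

end Hamiltonian

end

set_option linter.unusedSectionVars false

/-! The order of a method is a statement about formal series over a free algebra, so it can be
substituted into. Sending the two variables to arbitrary series, `h` to `h ε ^ j` and `ε` to `ε ^ q`
(`substHom`) gives three facts: the fast method errs by `h ^ (p₁ + 1)`; the slow one by `ε ^ (p₂ +
1) h ^ (p₂ + 1)`, since each `h` carries an `ε`; the outer one keeps its order when its variables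
become whole series divisible by `h` and `h ε`. Errors are compared modulo upward closed sets of
monomials (`SupportedIn`): series supported there form a two-sided ideal, and both `exp` and its
inverse respect congruence modulo it. Hence errors add up (`supportedIn_hierProd_sub_exp`) and pass
from products to exponents.

The exponents consist of derivations because exponentials of derivations are automorphisms, products
of automorphisms are automorphisms, and the logarithm of an automorphism is a derivation
(`IsDerivationSeries.of_isGroupLike_exp`). Multiplicativity is expressed on `V ⊗ V`; its
linearization in the lowest unknown degree is the Leibniz rule.

For the global error, a smooth function along a solution has a Lie series whose remainder is uniform
on compact sets and for bounded `ε`. So flows and their compositions are given by operator series up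
to `O(h ^ (N + 1))` (`represents_flow`, `Represents.comp`), and the formal error bounds the local
error by `h * e`. A discrete Gronwall argument in a tube around the solution sums the local errors
(`hasGlobalError_of_represents`). The orders of the concrete methods come from expanding their
products up to degree four. -/

noncomputable section

/-! ### Locally finite sums of power series -/

namespace PowerSeries

variable {R : Type*} [Semiring R]

/-- The sum of a sequence of power series whose `i`-th member is divisible by `X ^ i`. -/
def lsum (s : ℕ → PowerSeries R) : PowerSeries R :=
  mk fun n => ∑ i ∈ Finset.range (n + 1), coeff n (s i)

theorem coeff_lsum {s : ℕ → PowerSeries R} (hs : ∀ i n, n < i → coeff n (s i) = 0) {n N : ℕ}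
    (hN : n < N) : coeff n (lsum s) = coeff n (∑ i ∈ Finset.range N, s i) := by
  rw [lsum, coeff_mk, map_sum]
  refine Finset.sum_subset (Finset.range_subset_range.2 hN) fun i _ hi => hs i n ?_
  simpa using hi

theorem coeff_mul_congr {f f' g g' : PowerSeries R} {n : ℕ}
    (hf : ∀ i ≤ n, coeff i f = coeff i f') (hg : ∀ i ≤ n, coeff i g = coeff i g') :
    coeff n (f * g) = coeff n (f' * g') := by
  rw [coeff_mul, coeff_mul]
  refine Finset.sum_congr rfl fun p hp => ?_
  have := Finset.HasAntidiagonal.mem_antidiagonal.1 hp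
  rw [hf _ (by omega), hg _ (by omega)]

theorem coeff_mul_eq_zero {f g : PowerSeries R} {i j n : ℕ} (hf : ∀ m < i, coeff m f = 0)
    (hg : ∀ m < j, coeff m g = 0) (hn : n < i + j) : coeff n (f * g) = 0 := by
  rw [coeff_mul]
  refine Finset.sum_eq_zero fun p hp => ?_
  have := Finset.HasAntidiagonal.mem_antidiagonal.1 hp
  by_cases h : p.1 < i
  · rw [hf _ h, zero_mul]
  · rw [hg _ (by omega), mul_zero]

theorem coeff_pow_eq_zero {f : PowerSeries R} (hf : coeff 0 f = 0) {n m : ℕ} (h : n < m) :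
    coeff n (f ^ m) = 0 := by
  induction m generalizing n with
  | zero => omega
  | succ m ih =>
    rw [pow_succ]
    exact coeff_mul_eq_zero (i := m) (j := 1) (fun k hk => ih hk)
      (fun k hk => by rw [Nat.lt_one_iff.1 hk, hf]) h

/-- In degree `n` both sums may be cut off after the index `n`; pairs of indices with sum above `n`
contribute nothing, and the others are regrouped by their sum. -/
theorem lsum_mul {s t : ℕ → PowerSeries R} (hs : ∀ i n, n < i → coeff n (s i) = 0)
    (ht : ∀ i n, n < i → coeff n (t i) = 0) :
    lsum s * lsum t = lsum fun n => ∑ p ∈ Finset.HasAntidiagonal.antidiagonal n, s p.1 * t p.2 := by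
  ext n
  have h₁ : coeff n (lsum s * lsum t) =
      coeff n ((∑ i ∈ Finset.range (n + 1), s i) * ∑ i ∈ Finset.range (n + 1), t i) :=
    coeff_mul_congr (fun i hi => coeff_lsum hs (by omega)) fun i hi => coeff_lsum ht (by omega)
  rw [h₁, Finset.sum_mul_sum, ← Finset.sum_product', map_sum, lsum, coeff_mk]
  rw [← Finset.sum_filter_of_ne (p := fun p => p.1 + p.2 ∈ Finset.range (n + 1))]
  · rw [← Finset.sum_fiberwise_of_maps_to (t := Finset.range (n + 1)) (g := fun p => p.1 + p.2)
      (by intro p hp; exact (Finset.mem_filter.1 hp).2)]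
    refine Finset.sum_congr rfl fun m hm => ?_
    rw [map_sum]
    refine Finset.sum_congr ?_ fun _ _ => rfl
    ext p
    simp only [Finset.mem_filter, Finset.mem_product, Finset.mem_range,
      Finset.HasAntidiagonal.mem_antidiagonal] at *
    omega
  · intro p _ h
    by_contra hp
    exact h (coeff_mul_eq_zero (hs p.1) (ht p.2) (by simpa using hp))

end PowerSeries

/-! ### Exponentials of formal series -/

namespace FormalSeries

open PowerSeries
open scoped Pointwise

variable {𝒜 : Type*} [Ring 𝒜] [Algebra ℝ 𝒜]

theorem exp_eq_lsum (f : FormalSeries 𝒜) :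
    exp f = lsum fun m => ((Nat.factorial m : ℝ)⁻¹) • f ^ m := by
  ext1 n
  simp [exp, lsum]

theorem coeff_smul_pow_eq_zero {f : FormalSeries 𝒜} (hf : coeff 0 f = 0) (c : ℕ → ℝ) (i n : ℕ)
    (h : n < i) : coeff n (c i • f ^ i) = 0 := by
  rw [coeff_smul, coeff_pow_eq_zero hf h, smul_zero]

theorem coeff_exp {f : FormalSeries 𝒜} (hf : coeff 0 f = 0) {n N : ℕ} (hN : n < N) :
    coeff n (exp f) =
      coeff n (∑ m ∈ Finset.range N, ((Nat.factorial m : ℝ)⁻¹) • f ^ m) := by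
  rw [exp_eq_lsum, coeff_lsum (coeff_smul_pow_eq_zero hf fun m => (Nat.factorial m : ℝ)⁻¹) hN]

theorem coeff_zero_exp (f : FormalSeries 𝒜) : coeff 0 (exp f) = 1 := by
  simp [exp]

theorem exp_zero : exp (0 : FormalSeries 𝒜) = 1 := by
  ext1 n
  rw [coeff_exp (by simp) (Nat.lt_succ_self n), Finset.sum_range_succ']
  simp

theorem exp_add_of_commute {f g : FormalSeries 𝒜} (hf : coeff 0 f = 0) (hg : coeff 0 g = 0)
    (h : Commute f g) : exp (f + g) = exp f * exp g := by
  rw [exp_eq_lsum, exp_eq_lsum, exp_eq_lsum,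
    lsum_mul (coeff_smul_pow_eq_zero hf fun m => (Nat.factorial m : ℝ)⁻¹)
      (coeff_smul_pow_eq_zero hg fun m => (Nat.factorial m : ℝ)⁻¹)]
  congr 1
  funext n
  rw [h.add_pow', Finset.smul_sum]
  refine Finset.sum_congr rfl fun p hp => ?_
  have hp := Finset.HasAntidiagonal.mem_antidiagonal.1 hp
  rw [smul_mul_smul_comm, ← Nat.cast_smul_eq_nsmul ℝ, smul_smul]
  congr 1
  have h₁ := Nat.choose_mul_factorial_mul_factorial (Nat.le_add_right p.1 p.2)
  rw [Nat.add_sub_cancel_left] at h₁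
  rw [← hp, ← h₁]
  have := (Nat.choose_pos (Nat.le_add_right p.1 p.2)).ne'
  push_cast
  field_simp

/-! ### Series supported on a set of monomials -/

/-- All monomials `h ^ i * ε ^ k` occurring in `f` belong to `M`. -/
def SupportedIn (M : Set (ℕ × ℕ)) (f : FormalSeries 𝒜) : Prop :=
  ∀ i k : ℕ, f.coeff₂ i k ≠ 0 → (i, k) ∈ M

/-- The monomials of order `o`. -/
def orderSet (o : List ℕ) : Set (ℕ × ℕ) :=
  {p | ∃ l ≤ p.2, o.getD l 0 ≠ 0 ∧ o.getD l 0 + 1 ≤ p.1}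

theorem isOfOrder_iff {o : List ℕ} {f : FormalSeries 𝒜} :
    IsOfOrder o f ↔ SupportedIn (orderSet o) f := Iff.rfl

/-- Order is defined by divisibility by certain monomials; closure under multiplication by `h` and
`ε` makes these errors an ideal. -/
theorem isUpperSet_orderSet (o : List ℕ) : IsUpperSet (orderSet o) := by
  rintro ⟨i, k⟩ ⟨i', k'⟩ h ⟨l, hl, h₀, h₁⟩
  exact ⟨l, hl.trans h.2, h₀, h₁.trans h.1⟩

theorem coeff₂_add (f g : FormalSeries 𝒜) (i k : ℕ) :
    (f + g).coeff₂ i k = f.coeff₂ i k + g.coeff₂ i k := by simp [coeff₂]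

theorem coeff₂_sub (f g : FormalSeries 𝒜) (i k : ℕ) :
    (f - g).coeff₂ i k = f.coeff₂ i k - g.coeff₂ i k := by simp [coeff₂]

theorem coeff₂_smul (c : ℝ) (f : FormalSeries 𝒜) (i k : ℕ) :
    (c • f).coeff₂ i k = c • f.coeff₂ i k := by simp [coeff₂]

theorem coeff₂_mul (f g : FormalSeries 𝒜) (i k : ℕ) :
    (f * g).coeff₂ i k = ∑ p ∈ Finset.HasAntidiagonal.antidiagonal i, ∑ q ∈ Finset.HasAntidiagonal.antidiagonal k,
      f.coeff₂ p.1 q.1 * g.coeff₂ p.2 q.2 := by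
  simp [coeff₂, PowerSeries.coeff_mul, Polynomial.coeff_mul, Polynomial.finsetSum_coeff]

theorem coeff₂_exp {f : FormalSeries 𝒜} (hf : coeff 0 f = 0) {i N : ℕ} (hN : i < N) (k : ℕ) :
    (exp f).coeff₂ i k =
      ∑ m ∈ Finset.range N, ((Nat.factorial m : ℝ)⁻¹) • (f ^ m).coeff₂ i k := by
  rw [coeff₂, coeff_exp hf hN]
  simp [coeff₂, Polynomial.finsetSum_coeff]

theorem coeff₂_monomial₂ (i k j l : ℕ) (x : 𝒜) :
    (monomial₂ i k x).coeff₂ j l = if i = j ∧ k = l then x else 0 := by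
  rw [coeff₂, monomial₂, PowerSeries.coeff_monomial]
  by_cases h : j = i
  · subst h
    simp [Polynomial.coeff_monomial]
  · rw [if_neg h, if_neg (fun h' => h h'.1.symm), Polynomial.coeff_zero]

theorem coeff₂_zero (i k : ℕ) : (0 : FormalSeries 𝒜).coeff₂ i k = 0 := by simp [coeff₂]

namespace SupportedIn

variable {M M' : Set (ℕ × ℕ)} {f g f' g' : FormalSeries 𝒜}

theorem iff_of_notMem : SupportedIn M f ↔ ∀ i k : ℕ, (i, k) ∉ M → f.coeff₂ i k = 0 :=
  forall₂_congr fun _ _ => not_imp_comm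

theorem mono (h : M ⊆ M') (hf : SupportedIn M f) : SupportedIn M' f :=
  fun i k hik => h (hf i k hik)

theorem zero : SupportedIn M (0 : FormalSeries 𝒜) := fun i k h => (h (coeff₂_zero i k)).elim

theorem add (hf : SupportedIn M f) (hg : SupportedIn M g) : SupportedIn M (f + g) := by
  rw [iff_of_notMem] at *
  intro i k h
  rw [coeff₂_add, hf i k h, hg i k h, add_zero]

theorem sub (hf : SupportedIn M f) (hg : SupportedIn M g) : SupportedIn M (f - g) := by
  rw [iff_of_notMem] at *
  intro i k h
  rw [coeff₂_sub, hf i k h, hg i k h, sub_zero]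

theorem smul (c : ℝ) (hf : SupportedIn M f) : SupportedIn M (c • f) := by
  rw [iff_of_notMem] at *
  intro i k h
  rw [coeff₂_smul, hf i k h, smul_zero]

theorem sum {ι : Type*} {s : Finset ι} {F : ι → FormalSeries 𝒜}
    (h : ∀ i ∈ s, SupportedIn M (F i)) : SupportedIn M (∑ i ∈ s, F i) :=
  Finset.sum_induction _ _ (fun _ _ => add) zero h

theorem mul (hf : SupportedIn M f) (hg : SupportedIn M' g) :
    SupportedIn (M + M') (f * g) := by
  rw [iff_of_notMem]
  intro i k h
  rw [coeff₂_mul]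
  refine Finset.sum_eq_zero fun p hp => Finset.sum_eq_zero fun q hq => ?_
  by_contra h₀
  refine h ⟨_, hf _ _ (left_ne_zero_of_mul h₀), _, hg _ _ (right_ne_zero_of_mul h₀), ?_⟩
  rw [← Finset.HasAntidiagonal.mem_antidiagonal.1 hp, ← Finset.HasAntidiagonal.mem_antidiagonal.1 hq]
  rfl

theorem univ : SupportedIn Set.univ f := fun _ _ _ => Set.mem_univ _

theorem of_coeff_zero (hf : coeff 0 f = 0) : SupportedIn {p | 1 ≤ p.1} f := by
  intro i k h
  by_contra hi
  have : i = 0 := by simpa using hi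
  rw [this, coeff₂, hf, Polynomial.coeff_zero] at h
  exact h rfl

theorem add_subset_left (hM : IsUpperSet M) (S : Set (ℕ × ℕ)) : M + S ⊆ M := by
  rintro _ ⟨p, hp, q, _, rfl⟩
  exact hM (le_self_add) hp

theorem add_subset_right (hM : IsUpperSet M) (S : Set (ℕ × ℕ)) : S + M ⊆ M := by
  rintro _ ⟨p, _, q, hq, rfl⟩
  exact hM (le_add_self) hq

/-- As `M` absorbs multiplication by monomials, the series supported in `M` form a two-sided ideal,
and products respect congruence modulo it. -/
theorem mul_sub_mul (hM : IsUpperSet M) (hf : SupportedIn M (f - f'))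
    (hg : SupportedIn M (g - g')) : SupportedIn M (f * g - f' * g') := by
  have : f * g - f' * g' = (f - f') * g + f' * (g - g') := by noncomm_ring
  rw [this]
  exact ((hf.mul univ).mono (add_subset_left hM Set.univ)).add
    ((univ.mul hg).mono (add_subset_right hM Set.univ))

theorem pow_sub_pow (hM : IsUpperSet M) (h : SupportedIn M (f - f')) (m : ℕ) :
    SupportedIn M (f ^ m - f' ^ m) := by
  induction m with
  | zero => simpa using zero
  | succ m ih => simpa only [pow_succ] using mul_sub_mul hM ih h

theorem list_prod_sub (hM : IsUpperSet M) {ι : Type*} (l : List ι) (F F' : ι → FormalSeries 𝒜)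
    (h : ∀ i ∈ l, SupportedIn M (F i - F' i)) :
    SupportedIn M ((l.map F).prod - (l.map F').prod) := by
  induction l with
  | nil => simpa using zero
  | cons a l ih =>
    simp only [List.map_cons, List.prod_cons]
    exact mul_sub_mul hM (h a (by simp)) (ih fun i hi => h i (by simp [hi]))

theorem trans_sub {a b c : FormalSeries 𝒜} (h₁ : SupportedIn M (a - b))
    (h₂ : SupportedIn M (b - c)) : SupportedIn M (a - c) := by
  simpa using h₁.add h₂

end SupportedIn

/-! ### Exponentials and logarithms modulo a set of monomials -/

/-- In degree `n`, and modulo `M`, the exponential is the identity plus terms of lower degree. -/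
theorem coeff₂_exp_sub {M : Set (ℕ × ℕ)} (hM : IsUpperSet M) {f g : FormalSeries 𝒜}
    (hf : coeff 0 f = 0) (hg : coeff 0 g = 0) {n : ℕ}
    (h : ∀ i < n, ∀ k, (i, k) ∉ M → (f - g).coeff₂ i k = 0) {k : ℕ} (hk : (n, k) ∉ M) :
    (exp f - exp g).coeff₂ n k = (f - g).coeff₂ n k := by
  -- Adding all monomials of degree at least `n` in `h` turns the hypothesis into a congruence of
  -- `f` and `g`, which powers preserve.
  set M' : Set (ℕ × ℕ) := M ∪ {p | n ≤ p.1} with hM'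
  have hup : IsUpperSet M' := hM.union fun p q hpq (hp : n ≤ p.1) => hp.trans hpq.1
  have hfg : SupportedIn M' (f - g) := by
    rw [SupportedIn.iff_of_notMem]
    intro i k hik
    simp only [hM', Set.mem_union, Set.mem_ofPred_eq, not_or, not_le] at hik
    exact h i hik.2 k hik.1
  -- From the second power on, each summand of the difference pairs a factor supported in `M'` with
  -- a factor divisible by `h`; outside `M` this starts in degree `n + 1`.
  have key : ∀ m, (f ^ (m + 2) - g ^ (m + 2)).coeff₂ n k = 0 := by
    intro m
    have h₁ : f ^ (m + 2) - g ^ (m + 2) =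
        f ^ (m + 1) * (f - g) + (f ^ (m + 1) - g ^ (m + 1)) * g := by
      rw [pow_succ f (m + 1), pow_succ g (m + 1)]; noncomm_ring
    have h₂ := (SupportedIn.of_coeff_zero (f := f ^ (m + 1))
      (coeff_pow_eq_zero hf (by omega))).mul hfg
    have h₃ := (SupportedIn.pow_sub_pow hup hfg (m + 1)).mul (SupportedIn.of_coeff_zero hg)
    rw [add_comm] at h₃
    refine (SupportedIn.iff_of_notMem.1 (h₁ ▸ h₂.add h₃)) n k ?_
    rintro ⟨⟨a, b⟩, ha, ⟨c, d⟩, hc, heq⟩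
    simp only [Prod.mk_add_mk, Prod.mk.injEq] at heq
    simp only [Set.mem_ofPred_eq] at ha
    rcases hc with hc | hc
    · exact hk (hM (show ((c, d) : ℕ × ℕ) ≤ (n, k) from ⟨by simp; omega, by simp; omega⟩) hc)
    · simp only [Set.mem_ofPred_eq] at hc
      omega
  rw [coeff₂_sub, coeff₂_exp hf (N := n + 2) (by omega), coeff₂_exp hg (N := n + 2) (by omega),
    ← Finset.sum_sub_distrib, Finset.sum_range_succ', Finset.sum_range_succ']
  rw [Finset.sum_eq_zero fun m _ => by rw [← smul_sub, ← coeff₂_sub, key, smul_zero]]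
  simp [coeff₂_sub]

theorem SupportedIn.exp_sub {M : Set (ℕ × ℕ)} (hM : IsUpperSet M) {f g : FormalSeries 𝒜}
    (hf : coeff 0 f = 0) (hg : coeff 0 g = 0) (h : SupportedIn M (f - g)) :
    SupportedIn M (exp f - exp g) := by
  rw [iff_of_notMem] at *
  intro n k hk
  rw [coeff₂_exp_sub hM hf hg (fun i _ k hk => h i k hk) hk, h n k hk]

/-- Induction on the degree in `h`: once the lower coefficients of `f - g` vanish outside `M`, those
of degree `n` coincide there with the coefficients of `exp f - exp g`. This is how errors of
products become errors of exponents. -/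
theorem SupportedIn.of_exp_sub {M : Set (ℕ × ℕ)} (hM : IsUpperSet M) {f g : FormalSeries 𝒜}
    (hf : coeff 0 f = 0) (hg : coeff 0 g = 0) (h : SupportedIn M (exp f - exp g)) :
    SupportedIn M (f - g) := by
  rw [iff_of_notMem] at *
  intro n
  induction n using Nat.strong_induction_on with
  | _ n ih =>
    intro k hk
    rw [← coeff₂_exp_sub hM hf hg ih hk, h n k hk]

theorem ext₂ {f g : FormalSeries 𝒜} (h : ∀ i k, f.coeff₂ i k = g.coeff₂ i k) : f = g := by
  ext i k
  exact h i k

/-- Every series with constant term `1` has a logarithm. -/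
theorem exists_exp_eq {G : FormalSeries 𝒜} (hG : coeff 0 G = 1) :
    ∃ A : FormalSeries 𝒜, coeff 0 A = 0 ∧ exp A = G := by
  -- `B n` is the logarithm in the degrees below `n`; each stage adds the defect of its exponential
  -- in degree `n`, which by `coeff₂_exp_sub` repairs exactly that degree.
  let B : ℕ → FormalSeries 𝒜 := fun n =>
    Nat.rec 0 (fun n b => b + PowerSeries.monomial n (coeff n (G - exp b))) n
  have hB : ∀ n, B (n + 1) = B n + PowerSeries.monomial n (coeff n (G - exp (B n))) :=
    fun n => rfl
  have hstab : ∀ n m, m < n → coeff m (B n) = coeff m (B (m + 1)) := by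
    intro n
    induction n with
    | zero => intro m h; omega
    | succ n ih =>
      intro m h
      rcases Nat.lt_succ_iff_lt_or_eq.1 h with h | rfl
      · rw [hB, map_add, PowerSeries.coeff_monomial, if_neg (by omega), add_zero, ih m h]
      · rfl
  have hzero : ∀ n m, n ≤ m → coeff m (B n) = 0 := by
    intro n
    induction n with
    | zero => intro m _; exact map_zero _
    | succ n ih =>
      intro m h
      rw [hB, map_add, PowerSeries.coeff_monomial, if_neg (by omega), add_zero, ih m (by omega)]
  have h0 : coeff 0 (B (0 + 1)) = 0 := by
    rw [hB, map_add, PowerSeries.coeff_monomial, if_pos rfl, hzero 0 0 le_rfl, map_sub, hG,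
      coeff_zero_exp, sub_self, add_zero]
  have hB0 : ∀ n, coeff 0 (B n) = 0 := by
    intro n
    rcases Nat.eq_zero_or_pos n with rfl | hn
    · exact hzero 0 0 le_rfl
    · rw [hstab n 0 hn, h0]
  refine ⟨PowerSeries.mk fun n => coeff n (B (n + 1)), by rw [coeff_mk, h0], ext₂ fun n k => ?_⟩
  set A : FormalSeries 𝒜 := PowerSeries.mk fun n => coeff n (B (n + 1)) with hA
  have hA0 : coeff 0 A = 0 := by rw [hA, coeff_mk, h0]
  have h := coeff₂_exp_sub (M := ∅) isUpperSet_empty hA0 (hB0 n) (n := n) (k := k)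
    (fun i hi k _ => by
      rw [coeff₂, map_sub, hA, coeff_mk, hstab n i hi, sub_self, Polynomial.coeff_zero]) (by simp)
  have h' : (A - B n).coeff₂ n k = (G - exp (B n)).coeff₂ n k := by
    rw [coeff₂, map_sub, hA, coeff_mk, hB, map_add, PowerSeries.coeff_monomial, if_pos rfl,
      add_sub_cancel_left, coeff₂]
  rw [h', coeff₂_sub, coeff₂_sub] at h
  exact sub_left_injective h

end FormalSeries

end

noncomputable section

namespace FormalSeries

open PowerSeries
open scoped TensorProduct

/-! ### Maps between algebras of formal series -/

section Map

variable {𝒜 ℬ : Type*} [Ring 𝒜] [Algebra ℝ 𝒜] [Ring ℬ] [Algebra ℝ ℬ]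

/-- The coefficientwise application of a homomorphism of algebras. -/
def mapHom (φ : 𝒜 →ₐ[ℝ] ℬ) : FormalSeries 𝒜 →+* FormalSeries ℬ :=
  PowerSeries.map (Polynomial.mapRingHom (φ : 𝒜 →+* ℬ))

@[simp] theorem coeff₂_mapHom (φ : 𝒜 →ₐ[ℝ] ℬ) (f : FormalSeries 𝒜) (i k : ℕ) :
    (mapHom φ f).coeff₂ i k = φ (f.coeff₂ i k) := by
  simp [mapHom, coeff₂]

theorem coeff_zero_mapHom (φ : 𝒜 →ₐ[ℝ] ℬ) {f : FormalSeries 𝒜} (hf : coeff 0 f = 0) :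
    coeff 0 (mapHom φ f) = 0 := by
  rw [mapHom, PowerSeries.coeff_map, hf, map_zero]

theorem mapHom_exp (φ : 𝒜 →ₐ[ℝ] ℬ) {f : FormalSeries 𝒜} (hf : coeff 0 f = 0) :
    mapHom φ (exp f) = exp (mapHom φ f) := by
  refine ext₂ fun i k => ?_
  rw [coeff₂_mapHom, coeff₂_exp hf (Nat.lt_succ_self i),
    coeff₂_exp (coeff_zero_mapHom φ hf) (Nat.lt_succ_self i), map_sum]
  refine Finset.sum_congr rfl fun m _ => ?_
  rw [map_smul, ← coeff₂_mapHom, map_pow]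

theorem commute_of_coeff₂ {f g : FormalSeries 𝒜}
    (h : ∀ i k j l, Commute (f.coeff₂ i k) (g.coeff₂ j l)) : Commute f g := by
  refine ext₂ fun i k => ?_
  rw [coeff₂_mul, coeff₂_mul, ← Finset.Nat.sum_antidiagonal_swap]
  refine Finset.sum_congr rfl fun p _ => ?_
  rw [← Finset.Nat.sum_antidiagonal_swap]
  exact Finset.sum_congr rfl fun q _ => h _ _ _ _

theorem coeff_mul_of_coeff_eq_zero {D G : FormalSeries 𝒜} {n : ℕ}
    (hD : ∀ i < n, coeff i D = 0) (hG : coeff 0 G = 1) :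
    coeff n (D * G) = coeff n D ∧ coeff n (G * D) = coeff n D := by
  rw [PowerSeries.coeff_mul, PowerSeries.coeff_mul]
  constructor
  · rw [Finset.sum_eq_single (n, 0)]
    · rw [hG, mul_one]
    · intro p hp hne
      have hp := Finset.HasAntidiagonal.mem_antidiagonal.1 hp
      rw [hD p.1 (by by_contra h'; exact hne (Prod.ext (by simp; omega) (by simp; omega))),
        zero_mul]
    · intro h'
      simp at h'
  · rw [Finset.sum_eq_single (0, n)]
    · rw [hG, one_mul]
    · intro p hp hne
      have hp := Finset.HasAntidiagonal.mem_antidiagonal.1 hp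
      rw [hD p.2 (by by_contra h'; exact hne (Prod.ext (by simp; omega) (by simp; omega))),
        mul_zero]
    · intro h'
      simp at h'

/-- Linearization: both series begin with `1`, so in the first degree where they differ the other
factor counts as `1`. Applied to `X ⊗ 1` and `1 ⊗ X`, this turns multiplicativity into the Leibniz
rule. -/
theorem coeff₂_mapHom_mul_mapHom_sub (φ ψ : 𝒜 →ₐ[ℝ] ℬ) {G H : FormalSeries 𝒜}
    (hG : coeff 0 G = 1) (hH : coeff 0 H = 1) {n : ℕ} (h : ∀ i < n, coeff i (G - H) = 0) (k : ℕ) :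
    (mapHom φ G * mapHom ψ G - mapHom φ H * mapHom ψ H).coeff₂ n k =
      φ ((G - H).coeff₂ n k) + ψ ((G - H).coeff₂ n k) := by
  have hlow : ∀ χ : 𝒜 →ₐ[ℝ] ℬ, ∀ i < n, coeff i (mapHom χ (G - H)) = 0 := by
    intro χ i hi
    rw [mapHom, PowerSeries.coeff_map, h i hi, map_zero]
  have hone : ∀ (χ : 𝒜 →ₐ[ℝ] ℬ) {F : FormalSeries 𝒜}, coeff 0 F = 1 →
      coeff 0 (mapHom χ F) = 1 := by
    intro χ F hF
    rw [mapHom, PowerSeries.coeff_map, hF, map_one]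
  have hsplit : mapHom φ G * mapHom ψ G - mapHom φ H * mapHom ψ H =
      mapHom φ (G - H) * mapHom ψ G + mapHom φ H * mapHom ψ (G - H) := by
    rw [map_sub, map_sub]
    noncomm_ring
  rw [hsplit, coeff₂_add, ← coeff₂_mapHom, ← coeff₂_mapHom]
  unfold coeff₂
  rw [(coeff_mul_of_coeff_eq_zero (hlow φ) (hone ψ hG)).1,
    (coeff_mul_of_coeff_eq_zero (hlow ψ) (hone φ hH)).2]

/-- Cutting `A` off at degree `n` affects `exp A` first in degree `n`, and there linearly. This
isolates one coefficient of a logarithm for an induction. -/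
theorem exists_truncation {A : FormalSeries 𝒜} (hA : coeff 0 A = 0) {n : ℕ} (hn : 0 < n) :
    ∃ B : FormalSeries 𝒜, coeff 0 B = 0 ∧
      (∀ i k, B.coeff₂ i k = if i < n then A.coeff₂ i k else 0) ∧
      (∀ i < n, coeff i (exp A - exp B) = 0) ∧
      ∀ k, (exp A - exp B).coeff₂ n k = A.coeff₂ n k := by
  have hB : ∀ i k, coeff₂ (PowerSeries.mk fun i => if i < n then coeff i A else 0 :
      FormalSeries 𝒜) i k = if i < n then A.coeff₂ i k else 0 := by
    intro i k
    rw [coeff₂, coeff_mk]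
    split_ifs <;> simp [coeff₂]
  have hB0 : coeff 0 (PowerSeries.mk fun i => if i < n then coeff i A else 0 :
      FormalSeries 𝒜) = 0 := by rw [coeff_mk, if_pos hn, hA]
  set B : FormalSeries 𝒜 := PowerSeries.mk fun i => if i < n then coeff i A else 0
  have hlow : ∀ i < n, ∀ l, (A - B).coeff₂ i l = 0 := by
    intro i hi l
    rw [coeff₂_sub, hB, if_pos hi, sub_self]
  have hcoeff : ∀ i ≤ n, ∀ l, (exp A - exp B).coeff₂ i l = (A - B).coeff₂ i l := fun i hi l =>
    coeff₂_exp_sub (M := ∅) isUpperSet_empty hA hB0 (fun j hj l _ => hlow j (by omega) l) (by simp)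
  refine ⟨B, hB0, hB, fun i hi => Polynomial.ext fun l => (hcoeff i hi.le l).trans (hlow i hi l),
    fun k => ?_⟩
  rw [hcoeff n le_rfl, coeff₂_sub, hB, if_neg (lt_irrefl n), sub_zero]

end Map

/-! ### Derivations and automorphisms -/

section Lie

variable {V : Type*} [CommRing V] [Algebra ℝ V]

/-- The coefficients of `P`, operators on `V ⊗ V`, are intertwined with those of `X` by the
multiplication of `V`. -/
def Intertwines (P : FormalSeries (Module.End ℝ (V ⊗[ℝ] V)))
    (X : FormalSeries (Module.End ℝ V)) : Prop :=
  ∀ i k, LinearMap.mul' ℝ V ∘ₗ P.coeff₂ i k = X.coeff₂ i k ∘ₗ LinearMap.mul' ℝ V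

namespace Intertwines

variable {P Q : FormalSeries (Module.End ℝ (V ⊗[ℝ] V))} {X Y : FormalSeries (Module.End ℝ V)}

theorem mul (h₁ : Intertwines P X) (h₂ : Intertwines Q Y) : Intertwines (P * Q) (X * Y) := by
  intro i k
  ext1
  ext u v
  have h₁' := fun a b w => LinearMap.congr_fun (h₁ a b) w
  have h₂' := fun a b w => LinearMap.congr_fun (h₂ a b) w
  simp only [LinearMap.comp_apply] at h₁' h₂'
  simp [coeff₂_mul, h₁', h₂', -LinearMap.mul'_apply]

theorem one : Intertwines (1 : FormalSeries (Module.End ℝ (V ⊗[ℝ] V))) 1 := by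
  intro i k
  have h : ∀ (𝒜 : Type _) [Ring 𝒜], (1 : FormalSeries 𝒜).coeff₂ i k =
      if i = 0 ∧ k = 0 then 1 else 0 := by
    intro 𝒜 _
    by_cases hi : i = 0 <;> by_cases hk : k = 0 <;>
      simp [coeff₂, PowerSeries.coeff_one, Polynomial.coeff_one, hi, hk]
  have h' : ∀ (𝒜 : Type _) [Ring 𝒜], (1 : FormalSeries 𝒜).coeff₂ i k =
      if i = 0 ∧ k = 0 then 1 else 0 := by
    intro 𝒜 _
    by_cases hi : i = 0 <;> by_cases hk : k = 0 <;>
      simp [coeff₂, PowerSeries.coeff_one, Polynomial.coeff_one, hi, hk]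
  rw [h, h']
  split_ifs <;> ext <;> simp

theorem pow (h : Intertwines P X) (m : ℕ) : Intertwines (P ^ m) (X ^ m) := by
  induction m with
  | zero => simpa using one
  | succ m ih => simpa only [pow_succ] using ih.mul h

theorem exp (h : Intertwines P X) (hP : coeff 0 P = 0) (hX : coeff 0 X = 0) :
    Intertwines (exp P) (exp X) := by
  intro i k
  rw [coeff₂_exp hP (Nat.lt_succ_self i), coeff₂_exp hX (Nat.lt_succ_self i)]
  have h' := fun m w => LinearMap.congr_fun (h.pow m i k) w
  simp only [LinearMap.comp_apply] at h'
  ext1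
  ext u v
  simp [h', -LinearMap.mul'_apply]

end Intertwines

/-- `X ↦ X ⊗ 1` -/
abbrev tensorLeft : FormalSeries (Module.End ℝ V) →+* FormalSeries (Module.End ℝ (V ⊗[ℝ] V)) :=
  mapHom (Module.End.rTensorAlgHom ℝ V V)

/-- `X ↦ 1 ⊗ X` -/
abbrev tensorRight : FormalSeries (Module.End ℝ V) →+* FormalSeries (Module.End ℝ (V ⊗[ℝ] V)) :=
  mapHom (Module.End.lTensorAlgHom ℝ V V)

theorem commute_tensor (X Y : FormalSeries (Module.End ℝ V)) :
    Commute (tensorLeft X) (tensorRight Y) := by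
  refine commute_of_coeff₂ fun i k j l => ?_
  rw [coeff₂_mapHom, coeff₂_mapHom]
  refine LinearMap.ext fun w => ?_
  induction w using TensorProduct.induction_on with
  | zero => simp
  | tmul u v => rfl
  | add a b ha hb => rw [map_add, map_add, ha, hb]

/-- All coefficients are derivations. -/
def IsDerivationSeries (A : FormalSeries (Module.End ℝ V)) : Prop :=
  ∀ i k : ℕ, ∃ D : Derivation ℝ V V, A.coeff₂ i k = (D : V →ₗ[ℝ] V)

/-- `G` acts by automorphisms of the algebra of formal series over `V`. -/
def IsGroupLike (G : FormalSeries (Module.End ℝ V)) : Prop :=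
  Intertwines (tensorLeft G * tensorRight G) G

theorem IsGroupLike.mul {G G' : FormalSeries (Module.End ℝ V)} (h : IsGroupLike G)
    (h' : IsGroupLike G') : IsGroupLike (G * G') := by
  unfold IsGroupLike
  rw [map_mul, map_mul, (commute_tensor G' G).mul_mul_mul_comm]
  exact Intertwines.mul h h'

theorem IsGroupLike.one : IsGroupLike (1 : FormalSeries (Module.End ℝ V)) := by
  unfold IsGroupLike
  rw [map_one, map_one, mul_one]
  exact Intertwines.one

theorem IsGroupLike.list_prod {l : List (FormalSeries (Module.End ℝ V))}
    (h : ∀ G ∈ l, IsGroupLike G) : IsGroupLike l.prod :=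
  List.prod_induction _ (fun _ _ => IsGroupLike.mul) IsGroupLike.one h

/-- Evaluated on `u ⊗ v`, the intertwining relation is the Leibniz rule; in this form it is the
infinitesimal counterpart of `IsGroupLike`. -/
theorem exists_derivation_iff {D : Module.End ℝ V} :
    (∃ D' : Derivation ℝ V V, D = (D' : V →ₗ[ℝ] V)) ↔
      LinearMap.mul' ℝ V ∘ₗ (Module.End.rTensorAlgHom ℝ V V D + Module.End.lTensorAlgHom ℝ V V D) =
        D ∘ₗ LinearMap.mul' ℝ V := by
  constructor
  · rintro ⟨D', rfl⟩
    ext1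
    ext u v
    change LinearMap.mul' ℝ V (D' u ⊗ₜ[ℝ] v + u ⊗ₜ[ℝ] D' v) = D' (u * v)
    rw [map_add, LinearMap.mul'_apply, LinearMap.mul'_apply, Derivation.leibniz, smul_eq_mul,
      smul_eq_mul, mul_comm v, add_comm]
  · intro h
    refine ⟨Derivation.mk' D fun u v => ?_, rfl⟩
    have := LinearMap.congr_fun h (u ⊗ₜ v)
    change LinearMap.mul' ℝ V (D u ⊗ₜ[ℝ] v + u ⊗ₜ[ℝ] D v) = D (u * v) at this
    rw [map_add, LinearMap.mul'_apply, LinearMap.mul'_apply] at this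
    rw [← this, smul_eq_mul, smul_eq_mul]
    ring

theorem IsDerivationSeries.smul {A : FormalSeries (Module.End ℝ V)} (h : IsDerivationSeries A)
    (c : ℝ) : IsDerivationSeries (c • A) := by
  intro i k
  obtain ⟨D, hD⟩ := h i k
  exact ⟨c • D, by rw [coeff₂_smul, hD]; rfl⟩

/-- `A ⊗ 1` and `1 ⊗ A` commute, so the product of their exponentials is the exponential of their
sum, and exponentials inherit the intertwining of their exponents. -/
theorem IsDerivationSeries.isGroupLike_exp {A : FormalSeries (Module.End ℝ V)}
    (h : IsDerivationSeries A) (hA : coeff 0 A = 0) : IsGroupLike (FormalSeries.exp A) := by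
  unfold IsGroupLike
  rw [mapHom_exp _ hA, mapHom_exp _ hA, ← exp_add_of_commute (coeff_zero_mapHom _ hA)
    (coeff_zero_mapHom _ hA) (commute_tensor A A)]
  refine Intertwines.exp (fun i k => ?_) ?_ hA
  · rw [coeff₂_add, coeff₂_mapHom, coeff₂_mapHom]
    exact exists_derivation_iff.1 (h i k)
  · rw [map_add, coeff_zero_mapHom _ hA, coeff_zero_mapHom _ hA, add_zero]

/-- The logarithm of an automorphism is a derivation. -/
theorem IsDerivationSeries.of_isGroupLike_exp {A : FormalSeries (Module.End ℝ V)}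
    (hA : coeff 0 A = 0) (h : IsGroupLike (FormalSeries.exp A)) : IsDerivationSeries A := by
  intro n
  induction n using Nat.strong_induction_on with
  | _ n ih =>
  intro k
  rcases Nat.eq_zero_or_pos n with rfl | hn
  · exact ⟨0, by rw [coeff₂, hA]; rfl⟩
  -- By induction the truncation `B` is a series of derivations, so `exp B` is group-like too.
  -- Subtracting its multiplicativity from that of `exp A` leaves, in degree `n`, the Leibniz rule
  -- for the coefficient of `A`.
  obtain ⟨B, hB0, hB, hlow, htop⟩ := exists_truncation hA hn
  have hBd : IsDerivationSeries B := by
    intro i l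
    rw [hB]
    split_ifs with hi
    · exact ih i hi l
    · exact ⟨0, rfl⟩
  have hc := coeff₂_mapHom_mul_mapHom_sub (Module.End.rTensorAlgHom ℝ V V)
    (Module.End.lTensorAlgHom ℝ V V) (coeff_zero_exp A) (coeff_zero_exp B) hlow k
  rw [htop] at hc
  refine exists_derivation_iff.2 ?_
  rw [← hc, coeff₂_sub, LinearMap.comp_sub, h n k, hBd.isGroupLike_exp hB0 n k,
    ← LinearMap.sub_comp, ← coeff₂_sub, htop]

end Lie

end FormalSeries

end

noncomputable section

namespace FormalSeries

open PowerSeries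

/-! ### Substitution of central monomials for the variables -/

section Subst

variable {𝒜 ℬ : Type*} [Ring 𝒜] [Algebra ℝ 𝒜] [Ring ℬ] [Algebra ℝ ℬ]

theorem commute_monomial₂_one (i k : ℕ) (f : FormalSeries 𝒜) : Commute (monomial₂ i k 1) f := by
  refine commute_of_coeff₂ fun j l a b => ?_
  rw [coeff₂_monomial₂]
  split_ifs
  · exact Commute.one_left _
  · exact Commute.zero_left _

theorem monomial₂_mul (i k j l : ℕ) (x y : 𝒜) :
    monomial₂ i k x * monomial₂ j l y = monomial₂ (i + j) (k + l) (x * y) := by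
  rw [monomial₂, monomial₂, PowerSeries.monomial_mul_monomial, Polynomial.monomial_mul_monomial]
  rfl

theorem monomial₂_pow (i k : ℕ) (x : 𝒜) (m : ℕ) :
    monomial₂ i k x ^ m = monomial₂ (m * i) (m * k) (x ^ m) := by
  induction m with
  | zero =>
    rw [pow_zero, pow_zero, zero_mul, zero_mul, monomial₂, Polynomial.monomial_zero_one,
      PowerSeries.monomial_zero_eq_C_apply, map_one]
  | succ m ih => rw [pow_succ, ih, monomial₂_mul, pow_succ, add_mul, add_mul, one_mul, one_mul]

theorem smul_monomial₂ (c : ℝ) (i k : ℕ) (x : 𝒜) :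
    c • monomial₂ i k x = monomial₂ i k (c • x) := by
  refine ext₂ fun j l => ?_
  rw [coeff₂_smul, coeff₂_monomial₂, coeff₂_monomial₂]
  split_ifs <;> simp

theorem supportedIn_monomial₂ {M : Set (ℕ × ℕ)} {i k : ℕ} (h : (i, k) ∈ M) (x : 𝒜) :
    SupportedIn M (monomial₂ i k x) := by
  intro j l hjl
  rw [coeff₂_monomial₂] at hjl
  split_ifs at hjl with h'
  · rwa [← h'.1, ← h'.2]
  · exact (hjl rfl).elim

theorem coeff_monomial₂ (i k n : ℕ) (x : 𝒜) :
    coeff n (monomial₂ i k x) = if n = i then Polynomial.monomial k x else 0 := by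
  rw [monomial₂, PowerSeries.coeff_monomial]

theorem coeff_zero_monomial₂ {i : ℕ} (hi : i ≠ 0) (k : ℕ) (x : 𝒜) :
    coeff 0 (monomial₂ i k x) = 0 := by
  rw [monomial₂, PowerSeries.coeff_monomial, if_neg hi.symm]

theorem coeff_zero_smul (c : ℝ) {f : FormalSeries 𝒜} (hf : coeff 0 f = 0) :
    coeff 0 (c • f) = 0 := by
  rw [PowerSeries.coeff_smul, hf, smul_zero]

theorem coeff_zero_add {f g : FormalSeries 𝒜} (hf : coeff 0 f = 0) (hg : coeff 0 g = 0) :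
    coeff 0 (f + g) = 0 := by
  rw [map_add, hf, hg, add_zero]

/-- The homomorphism on polynomials in `ε` that extends `φ` and maps `ε` to `ε ^ q`. -/
def polyHom (φ : ℬ →ₐ[ℝ] FormalSeries 𝒜) (q : ℕ) : Polynomial ℬ →ₐ[ℝ] FormalSeries 𝒜 :=
  { Polynomial.eval₂RingHom' (φ : ℬ →+* FormalSeries 𝒜) (monomial₂ 0 q 1)
      (fun _ => (commute_monomial₂_one _ _ _).symm) with
    commutes' := fun r => by
      simp [Polynomial.algebraMap_apply] }

theorem polyHom_apply (φ : ℬ →ₐ[ℝ] FormalSeries 𝒜) (q : ℕ) (p : Polynomial ℬ) :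
    polyHom φ q p = p.sum fun k x => φ x * monomial₂ 0 (k * q) 1 := by
  change Polynomial.eval₂ (φ : ℬ →+* FormalSeries 𝒜) (monomial₂ 0 q 1) p = _
  rw [Polynomial.eval₂_eq_sum]
  simp [monomial₂_pow]

theorem coeff_monomial₂_pow_mul (j n i : ℕ) (h : n < i) (f : FormalSeries 𝒜) :
    coeff n (monomial₂ 1 j 1 ^ i * f) = 0 := by
  refine coeff_mul_eq_zero (i := i) (j := 0) (fun m hm => ?_) (fun m hm => by omega) (by omega)
  exact coeff_pow_eq_zero (coeff_zero_monomial₂ one_ne_zero j 1) hm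

/-- The homomorphism that extends `φ` and maps `h` to `h * ε ^ j` and `ε` to `ε ^ q`. -/
def substHom (φ : ℬ →ₐ[ℝ] FormalSeries 𝒜) (j q : ℕ) : FormalSeries ℬ →ₐ[ℝ] FormalSeries 𝒜 :=
  AlgHom.ofLinearMap
    { toFun := fun F => lsum fun i => monomial₂ 1 j 1 ^ i * polyHom φ q (coeff i F)
      map_add' := fun F G => by
        ext1 n
        simp [lsum, mul_add, Finset.sum_add_distrib]
      map_smul' := fun c F => by
        ext1 n
        simp [lsum, Finset.smul_sum] }
    (by
      ext1 n
      change coeff n (lsum _) = _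
      rw [lsum, coeff_mk, Finset.sum_range_succ']
      simp [PowerSeries.coeff_one])
    (by
      intro F G
      change lsum _ = lsum _ * lsum _
      rw [lsum_mul (fun i n h => coeff_monomial₂_pow_mul j n i h _)
        fun i n h => coeff_monomial₂_pow_mul j n i h _]
      congr 1
      funext n
      rw [PowerSeries.coeff_mul, map_sum, Finset.mul_sum]
      refine Finset.sum_congr rfl fun p hp => ?_
      rw [map_mul, ← Finset.HasAntidiagonal.mem_antidiagonal.1 hp, pow_add,
        Commute.mul_mul_mul_comm]
      exact ((commute_monomial₂_one 1 j _).pow_left _))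

theorem substHom_apply (φ : ℬ →ₐ[ℝ] FormalSeries 𝒜) (j q : ℕ) (F : FormalSeries ℬ) :
    substHom φ j q F = lsum fun i => monomial₂ 1 j 1 ^ i * polyHom φ q (coeff i F) := rfl

theorem coeff_substHom_congr (φ : ℬ →ₐ[ℝ] FormalSeries 𝒜) (j q : ℕ) {F G : FormalSeries ℬ} {n : ℕ}
    (h : ∀ i ≤ n, coeff i F = coeff i G) :
    coeff n (substHom φ j q F) = coeff n (substHom φ j q G) := by
  rw [substHom_apply, substHom_apply, lsum, lsum, coeff_mk, coeff_mk]
  refine Finset.sum_congr rfl fun i hi => ?_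
  rw [h i (Nat.lt_succ_iff.1 (Finset.mem_range.1 hi))]

theorem coeff_zero_substHom (φ : ℬ →ₐ[ℝ] FormalSeries 𝒜) (j q : ℕ) {F : FormalSeries ℬ}
    (hF : coeff 0 F = 0) : coeff 0 (substHom φ j q F) = 0 := by
  rw [coeff_substHom_congr φ j q (G := 0) (fun i hi => by rw [Nat.le_zero.1 hi, hF, map_zero]),
    map_zero, map_zero]

theorem substHom_exp (φ : ℬ →ₐ[ℝ] FormalSeries 𝒜) (j q : ℕ) {F : FormalSeries ℬ}
    (hF : coeff 0 F = 0) : substHom φ j q (exp F) = exp (substHom φ j q F) := by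
  ext1 n
  rw [coeff_substHom_congr φ j q fun i hi => coeff_exp hF (Nat.lt_succ_of_le hi),
    coeff_exp (coeff_zero_substHom φ j q hF) (Nat.lt_succ_self n), map_sum]
  simp only [map_smul, map_pow]

theorem substHom_compProd (φ : ℬ →ₐ[ℝ] FormalSeries 𝒜) (j q : ℕ) (C : CompMethod)
    {F G : FormalSeries ℬ} (hF : coeff 0 F = 0) (hG : coeff 0 G = 0) :
    substHom φ j q (compProd C F G) = compProd C (substHom φ j q F) (substHom φ j q G) := by
  rw [compProd, compProd, map_list_prod, List.map_map]
  congr 2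
  funext ab
  simp only [Function.comp_apply, map_mul]
  rw [substHom_exp _ _ _ (coeff_zero_smul _ hF), substHom_exp _ _ _ (coeff_zero_smul _ hG),
    map_smul, map_smul]

theorem substHom_monomial₂ (φ : ℬ →ₐ[ℝ] FormalSeries 𝒜) (j q k : ℕ) (x : ℬ) :
    substHom φ j q (monomial₂ 1 k x) = monomial₂ 1 (j + k * q) 1 * φ x := by
  have h : ∀ n i, i ≠ 1 → coeff n (monomial₂ 1 j 1 ^ i *
      polyHom φ q (coeff i (monomial₂ 1 k x))) = 0 := by
    intro n i hi
    rw [coeff_monomial₂, if_neg hi, map_zero, mul_zero, map_zero]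
  ext1 n
  rw [substHom_apply, coeff_lsum (fun i n h => coeff_monomial₂_pow_mul j n i h _)
    (show n < n + 2 by omega), map_sum, Finset.sum_eq_single 1 (fun i _ hi => h n i hi) (by simp)]
  rw [pow_one, coeff_monomial₂, if_pos rfl, polyHom_apply,
    Polynomial.sum_monomial_index _ _ (by simp), (commute_monomial₂_one _ _ (φ x)).symm.eq,
    ← mul_assoc, monomial₂_mul, mul_one, add_zero]

/-- The monomial `h ^ i ε ^ k` becomes `h ^ i ε ^ (i j + k q)` times the series that replaces its
coefficient. That factor can only raise exponents, which an upper set tolerates. -/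
theorem SupportedIn.substHom {M M' : Set (ℕ × ℕ)} (hM' : IsUpperSet M')
    (φ : ℬ →ₐ[ℝ] FormalSeries 𝒜) {j q : ℕ} (h : ∀ i k, (i, k) ∈ M → (i, i * j + k * q) ∈ M')
    {F : FormalSeries ℬ} (hF : SupportedIn M F) : SupportedIn M' (substHom φ j q F) := by
  have hi : ∀ i, SupportedIn M' (monomial₂ 1 j 1 ^ i * polyHom φ q (coeff i F)) := by
    intro i
    rw [polyHom_apply, Polynomial.sum, Finset.mul_sum]
    refine SupportedIn.sum fun k hk => ?_
    rw [(commute_monomial₂_one _ _ (φ _)).symm.eq, monomial₂_pow, ← mul_assoc, monomial₂_mul]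
    refine ((supportedIn_monomial₂ (M := M') ?_ _).mul SupportedIn.univ).mono
      (SupportedIn.add_subset_left hM' Set.univ)
    rw [mul_one, add_zero]
    exact h i k (hF i k (Polynomial.mem_support_iff.1 hk))
  rw [iff_of_notMem]
  intro n k hnk
  rw [coeff₂, substHom_apply, coeff_lsum (fun i n h => coeff_monomial₂_pow_mul j n i h _)
    (Nat.lt_succ_self n)]
  exact (SupportedIn.iff_of_notMem.1 (SupportedIn.sum fun i _ => hi i)) n k hnk

end Subst

/-! ### The exponents of composition methods -/

section Order

variable {𝒜 : Type*} [Ring 𝒜] [Algebra ℝ 𝒜]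

/-- The order of a composition method, transferred to series `f = O(h ε ^ j)` and
`g = O(h ε ^ (j + q))`. -/
theorem supportedIn_compProd_sub_exp {C : CompMethod} {o : List ℕ} (hC : C.HasOrder o)
    {M : Set (ℕ × ℕ)} (hM : IsUpperSet M) {j q : ℕ}
    (h : ∀ i k, (i, k) ∈ orderSet o → (i, i * j + k * q) ∈ M) (f g : FormalSeries 𝒜) :
    SupportedIn M (compProd C (monomial₂ 1 j 1 * f) (monomial₂ 1 (j + q) 1 * g) -
      exp (monomial₂ 1 j 1 * f + monomial₂ 1 (j + q) 1 * g)) := by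
  -- The universal property of the free algebra lets the variables become whole series, not just
  -- operators.
  let φ : FreeAlgebra ℝ (Fin 2) →ₐ[ℝ] FormalSeries 𝒜 := FreeAlgebra.lift ℝ ![f, g]
  have hA : φ (FreeAlgebra.ι ℝ 0) = f := by simp [φ]
  have hB : φ (FreeAlgebra.ι ℝ 1) = g := by simp [φ]
  have h₁ := SupportedIn.substHom hM φ h (isOfOrder_iff.1 hC.2)
  rw [map_sub, substHom_compProd _ _ _ _ (coeff_zero_monomial₂ one_ne_zero _ _)
    (coeff_zero_monomial₂ one_ne_zero _ _), substHom_exp _ _ _ (coeff_zero_add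
    (coeff_zero_monomial₂ one_ne_zero _ _) (coeff_zero_monomial₂ one_ne_zero _ _)), map_add,
    substHom_monomial₂, substHom_monomial₂, hA, hB, zero_mul, add_zero, one_mul] at h₁
  exact h₁

/-- Termwise division by `h ε ^ k`; it brings series to the shape required by
`supportedIn_compProd_sub_exp`. -/
theorem exists_eq_monomial₂_mul {k : ℕ} {f : FormalSeries 𝒜}
    (hf : SupportedIn {p | 1 ≤ p.1 ∧ k ≤ p.2} f) : ∃ g, f = monomial₂ 1 k 1 * g := by
  refine ⟨PowerSeries.mk fun i => (Polynomial.divX)^[k] (coeff (i + 1) f), ext₂ fun i l => ?_⟩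
  have hdiv : ∀ (k : ℕ) (p : Polynomial 𝒜) (l : ℕ),
      ((Polynomial.divX)^[k] p).coeff l = p.coeff (l + k) := by
    intro k
    induction k with
    | zero => intro p l; rfl
    | succ k ih => intro p l; rw [Function.iterate_succ_apply, ih, Polynomial.coeff_divX, add_assoc]
  rw [SupportedIn.iff_of_notMem] at hf
  have hz : ∀ g : FormalSeries 𝒜, ¬ (1 ≤ i ∧ k ≤ l) → (monomial₂ 1 k 1 * g).coeff₂ i l = 0 := by
    intro g hil
    refine (SupportedIn.iff_of_notMem.1 ((supportedIn_monomial₂ (M := {(1, k)}) rfl 1).mul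
      (SupportedIn.univ (f := g)))) i l ?_
    rintro ⟨_, rfl, ⟨a, b⟩, -, heq⟩
    simp only [Prod.mk_add_mk, Prod.mk.injEq] at heq
    omega
  by_cases hil : 1 ≤ i ∧ k ≤ l
  · obtain ⟨a, rfl⟩ := Nat.exists_eq_add_of_le hil.1
    obtain ⟨b, rfl⟩ := Nat.exists_eq_add_of_le hil.2
    rw [coeff₂_mul, Finset.sum_eq_single (1, a), Finset.sum_eq_single (k, b)]
    · rw [coeff₂_monomial₂, if_pos ⟨rfl, rfl⟩, one_mul, coeff₂, coeff₂, coeff_mk, hdiv, add_comm 1,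
        add_comm k]
    · intro p hp hne
      have hp := Finset.HasAntidiagonal.mem_antidiagonal.1 hp
      rw [coeff₂_monomial₂, if_neg, zero_mul]
      exact fun h' => hne (Prod.ext h'.2.symm (by simp; omega))
    · intro h'; simp at h'
    · intro p hp hne
      have hp := Finset.HasAntidiagonal.mem_antidiagonal.1 hp
      refine Finset.sum_eq_zero fun q _ => ?_
      rw [coeff₂_monomial₂, if_neg, zero_mul]
      exact fun h' => hne (Prod.ext h'.1.symm (by simp; omega))
    · intro h'; simp at h'
  · rw [hf i l hil, hz _ hil]

theorem mem_orderSet_singleton {p i k : ℕ} : (i, k) ∈ orderSet [p] ↔ p ≠ 0 ∧ p + 1 ≤ i := by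
  constructor
  · rintro ⟨l, _, h₀, h₁⟩
    rcases l with _ | l
    · exact ⟨by simpa using h₀, by simpa using h₁⟩
    · simp at h₀
  · exact fun h => ⟨0, by simp, by simpa using h.1, by simpa using h.2⟩

theorem getD_slowOrder (p l : ℕ) : (slowOrder p).getD l 0 = if l = p + 1 then p else 0 := by
  rw [slowOrder]
  rcases lt_trichotomy l (p + 1) with h | rfl | h
  · rw [List.getD_append _ _ _ _ (by simpa using h), List.getD_replicate _ h, if_neg h.ne]
  · rw [List.getD_append_right _ _ _ _ (by simp)]
    simp
  · rw [List.getD_append_right _ _ _ _ (by simp; omega), if_neg (by omega)]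
    obtain ⟨a, rfl⟩ := Nat.exists_eq_add_of_lt h
    simp [show p + 1 + a + 1 - (p + 1) = a + 1 by omega]

theorem mem_orderSet_slowOrder {p i k : ℕ} :
    (i, k) ∈ orderSet (slowOrder p) ↔ p ≠ 0 ∧ p + 1 ≤ i ∧ p + 1 ≤ k := by
  constructor
  · rintro ⟨l, hl, h₀, h₁⟩
    rw [getD_slowOrder] at h₀ h₁
    split_ifs at h₀ h₁ with h
    · exact ⟨h₀, h₁, by simpa [h] using hl⟩
    · exact (h₀ rfl).elim
  · rintro ⟨h₀, h₁, h₂⟩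
    exact ⟨p + 1, h₂, by rw [getD_slowOrder, if_pos rfl]; exact h₀,
      by rw [getD_slowOrder, if_pos rfl]; exact h₁⟩

/-- With `j = q = 0` the marker `ε` of the order condition is set to `1`. An order `[p]` constrains
only the power of `h`, so nothing is lost. -/
theorem supportedIn_fast {C : CompMethod} {p : ℕ} (hC : C.HasOrder [p]) (x y : 𝒜) :
    SupportedIn (orderSet [p]) (compProd C (monomial₂ 1 0 x) (monomial₂ 1 0 y) -
      exp (monomial₂ 1 0 x + monomial₂ 1 0 y)) := by
  have h := supportedIn_compProd_sub_exp hC (isUpperSet_orderSet [p]) (j := 0) (q := 0)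
    (fun i k h => by rw [mem_orderSet_singleton] at *; exact h) (monomial₂ 0 0 x) (monomial₂ 0 0 y)
  simpa [monomial₂_mul] using h

/-- With `j = 1` and `q = 0` the marker becomes `1` and every `h` becomes `h ε`, so a monomial with
at least `p + 1` factors `h` receives as many factors `ε`. -/
theorem supportedIn_slow {C : CompMethod} {p : ℕ} (hC : C.HasOrder [p]) (x y : 𝒜) :
    SupportedIn (orderSet (slowOrder p)) (compProd C (monomial₂ 1 1 x) (monomial₂ 1 1 y) -
      exp (monomial₂ 1 1 x + monomial₂ 1 1 y)) := by
  have h := supportedIn_compProd_sub_exp hC (isUpperSet_orderSet (slowOrder p)) (j := 1) (q := 0)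
    (fun i k h => by
      rw [mem_orderSet_singleton] at h
      rw [mem_orderSet_slowOrder]
      exact ⟨h.1, h.2, by omega⟩) (monomial₂ 0 0 x) (monomial₂ 0 0 y)
  simpa [monomial₂_mul] using h

/-- With `j = 0` and `q = 1` the monomials are unchanged. Since `f` and `g` are whole series, the
outer method can act on the exponents of the inner ones. -/
theorem supportedIn_outer {C : CompMethod} {o : List ℕ} (hC : C.HasOrder o) {f g : FormalSeries 𝒜}
    (hf : SupportedIn {p | 1 ≤ p.1} f) (hg : SupportedIn {p | 1 ≤ p.1 ∧ 1 ≤ p.2} g) :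
    SupportedIn (orderSet o) (compProd C f g - exp (f + g)) := by
  obtain ⟨f', rfl⟩ := exists_eq_monomial₂_mul (k := 0) (f := f) (by simpa using hf)
  obtain ⟨g', rfl⟩ := exists_eq_monomial₂_mul hg
  exact supportedIn_compProd_sub_exp hC (isUpperSet_orderSet o) (j := 0) (q := 1)
    (fun i k h => by simpa using h) f' g'

/-- The monomials that may occur in the error of the hierarchical composition. -/
def hierSet (p₁ p₂ : ℕ) (o : List ℕ) : Set (ℕ × ℕ) :=
  orderSet [p₁] ∪ orderSet (slowOrder p₂) ∪ orderSet o

theorem isUpperSet_hierSet (p₁ p₂ : ℕ) (o : List ℕ) : IsUpperSet (hierSet p₁ p₂ o) :=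
  ((isUpperSet_orderSet _).union (isUpperSet_orderSet _)).union (isUpperSet_orderSet _)

/-- The error of the hierarchical composition. -/
theorem supportedIn_hierProd_sub_exp {C₁ C₂ C₃ : CompMethod} {p₁ p₂ : ℕ} {o : List ℕ}
    (h₁ : C₁.HasOrder [p₁]) (h₂ : C₂.HasOrder [p₂]) (h₃ : C₃.HasOrder o) (x₁ x₂ x₃ x₄ : 𝒜) :
    SupportedIn (hierSet p₁ p₂ o)
      (hierProd C₁ C₂ C₃ (monomial₂ 1 0 x₁) (monomial₂ 1 0 x₂) (monomial₂ 1 1 x₃)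
        (monomial₂ 1 1 x₄) - exp (monomial₂ 1 0 x₁ + monomial₂ 1 0 x₂ + monomial₂ 1 1 x₃ +
          monomial₂ 1 1 x₄)) := by
  have hM := isUpperSet_hierSet p₁ p₂ o
  have ha : compProd C₃ (monomial₂ 1 0 x₁ + monomial₂ 1 0 x₂)
      (monomial₂ 1 1 x₃ + monomial₂ 1 1 x₄) = (C₃.map fun ab =>
      exp (ab.1 • (monomial₂ 1 0 x₁ + monomial₂ 1 0 x₂)) *
        exp (ab.2 • (monomial₂ 1 1 x₃ + monomial₂ 1 1 x₄))).prod := rfl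
  -- The intermediate product has exact exponentials in place of the inner methods: the first
  -- difference consists of inner errors, the second is the outer error.
  refine SupportedIn.trans_sub (b := compProd C₃ (monomial₂ 1 0 x₁ + monomial₂ 1 0 x₂)
    (monomial₂ 1 1 x₃ + monomial₂ 1 1 x₄)) ?_ ?_
  · rw [ha, hierProd]
    refine SupportedIn.list_prod_sub hM _ _ _ fun ab _ => SupportedIn.mul_sub_mul hM ?_ ?_
    · simp only [smul_monomial₂, smul_add]
      exact (supportedIn_fast h₁ _ _).mono fun _ h => Or.inl (Or.inl h)
    · simp only [smul_monomial₂, smul_add]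
      exact (supportedIn_slow h₂ _ _).mono fun _ h => Or.inl (Or.inr h)
  · rw [add_assoc _ (monomial₂ 1 1 x₃)]
    exact (supportedIn_outer h₃
      ((supportedIn_monomial₂ (by simp) _).add (supportedIn_monomial₂ (by simp) _))
      ((supportedIn_monomial₂ (by simp) _).add (supportedIn_monomial₂ (by simp) _))).mono
        fun _ h => Or.inr h

/-- A series supported in a union is a sum of two. -/
theorem SupportedIn.exists_add_of_union {M M' : Set (ℕ × ℕ)} {f : FormalSeries 𝒜}
    (hf : SupportedIn (M ∪ M') f) :
    ∃ g g', f = g + g' ∧ SupportedIn M g ∧ SupportedIn M' g' := by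
  classical
  let g : FormalSeries 𝒜 := PowerSeries.mk fun i =>
    ∑ k ∈ (coeff i f).support with (i, k) ∈ M, Polynomial.monomial k ((coeff i f).coeff k)
  have hg : ∀ i k, g.coeff₂ i k = if (i, k) ∈ M then f.coeff₂ i k else 0 := by
    intro i k
    simp only [g, coeff₂, coeff_mk, Polynomial.finsetSum_coeff, Polynomial.coeff_monomial]
    rw [Finset.sum_ite_eq' _ k fun k => (coeff i f).coeff k]
    by_cases h : (i, k) ∈ M <;> by_cases h' : (coeff i f).coeff k = 0 <;> simp [h, h']
  refine ⟨g, f - g, by abel, fun i k h => ?_, fun i k h => ?_⟩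
  · rw [hg] at h
    by_contra h'
    exact h (if_neg h')
  · rw [coeff₂_sub, hg] at h
    split_ifs at h with h'
    · exact (h (sub_self _)).elim
    · rw [sub_zero] at h
      exact (hf i k h).resolve_left h'

end Order

end FormalSeries

end

noncomputable section

namespace FormalSeries

open PowerSeries

/-! ### The exponents as series of derivations -/

section Exponents

variable {V : Type*} [CommRing V] [Algebra ℝ V]

theorem isDerivationSeries_monomial₂ (i k : ℕ) (D : Derivation ℝ V V) :
    IsDerivationSeries (monomial₂ i k (D : Module.End ℝ V)) := by
  intro j l
  rw [coeff₂_monomial₂]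
  split_ifs
  · exact ⟨D, rfl⟩
  · exact ⟨0, rfl⟩

theorem coeff_zero_compProd {𝒜 : Type*} [Ring 𝒜] [Algebra ℝ 𝒜] (C : CompMethod)
    (f g : FormalSeries 𝒜) : coeff 0 (compProd C f g) = 1 := by
  rw [compProd]
  refine List.prod_induction (fun F : FormalSeries 𝒜 => coeff 0 F = 1) ?_ (by simp) ?_
  · intro F G hF hG
    simp only [coeff_zero_eq_constantCoeff_apply, map_mul] at *
    rw [hF, hG, one_mul]
  · intro F hF
    obtain ⟨ab, -, rfl⟩ := List.mem_map.1 hF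
    have h₁ := coeff_zero_exp (ab.1 • f)
    have h₂ := coeff_zero_exp (ab.2 • g)
    simp only [coeff_zero_eq_constantCoeff_apply, map_mul] at *
    rw [h₁, h₂, one_mul]

theorem isGroupLike_compProd (C : CompMethod) {f g : FormalSeries (Module.End ℝ V)}
    (hf : IsDerivationSeries f) (hg : IsDerivationSeries g) (hf₀ : coeff 0 f = 0)
    (hg₀ : coeff 0 g = 0) : IsGroupLike (compProd C f g) := by
  refine IsGroupLike.list_prod fun G hG => ?_
  obtain ⟨ab, -, rfl⟩ := List.mem_map.1 hG
  exact ((hf.smul _).isGroupLike_exp (coeff_zero_smul _ hf₀)).mul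
    ((hg.smul _).isGroupLike_exp (coeff_zero_smul _ hg₀))

/-- The logarithm of an automorphism close to `exp f` is a series of derivations close to `f`. -/
theorem exists_exponent {M : Set (ℕ × ℕ)} (hM : IsUpperSet M) {G f : FormalSeries (Module.End ℝ V)}
    (hG : IsGroupLike G) (hG₀ : coeff 0 G = 1) (hf₀ : coeff 0 f = 0)
    (h : SupportedIn M (G - exp f)) :
    ∃ A, G = exp A ∧ coeff 0 A = 0 ∧ IsDerivationSeries A ∧ SupportedIn M (A - f) := by
  obtain ⟨A, hA₀, rfl⟩ := exists_exp_eq hG₀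
  exact ⟨A, rfl, hA₀, .of_isGroupLike_exp hA₀ hG, .of_exp_sub hM hA₀ hf₀ h⟩

variable {C₁ C₂ C₃ : CompMethod} {p₁ p₂ : ℕ} {o : List ℕ}

theorem exists_exponents (h₁ : C₁.HasOrder [p₁]) (h₂ : C₂.HasOrder [p₂]) (h₃ : C₃.HasOrder o)
    (D₁ D₂ D₃ D₄ : Derivation ℝ V V) {f₁ f₂ f₃ f₄ : FormalSeries (Module.End ℝ V)}
    (hf₁ : f₁ = monomial₂ 1 0 (D₁ : Module.End ℝ V))
    (hf₂ : f₂ = monomial₂ 1 0 (D₂ : Module.End ℝ V))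
    (hf₃ : f₃ = monomial₂ 1 1 (D₃ : Module.End ℝ V))
    (hf₄ : f₄ = monomial₂ 1 1 (D₄ : Module.End ℝ V)) :
    ∃ A₁ A₂ E₁ E₂ : FormalSeries (Module.End ℝ V),
      compProd C₁ f₁ f₂ = exp A₁ ∧ A₁ = f₁ + f₂ + E₁ ∧
      compProd C₂ f₃ f₄ = exp A₂ ∧ A₂ = f₃ + f₄ + E₂ ∧
      IsOfOrder [p₁] E₁ ∧ IsOfOrder (slowOrder p₂) E₂ ∧
      (coeff 0 A₁ = 0 ∧ IsDerivationSeries A₁) ∧ (coeff 0 A₂ = 0 ∧ IsDerivationSeries A₂) ∧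
      ∃ A₃ E₃ : FormalSeries (Module.End ℝ V),
        compProd C₃ A₁ A₂ = exp A₃ ∧ A₃ = A₁ + A₂ + E₃ ∧
        A₃ = f₁ + f₂ + f₃ + f₄ + E₁ + E₂ + E₃ ∧ IsOfOrder o E₃ ∧
        (coeff 0 A₃ = 0 ∧ IsDerivationSeries A₃) := by
  have hz₁ : coeff 0 f₁ = 0 := hf₁ ▸ coeff_zero_monomial₂ one_ne_zero _ _
  have hz₂ : coeff 0 f₂ = 0 := hf₂ ▸ coeff_zero_monomial₂ one_ne_zero _ _
  have hz₃ : coeff 0 f₃ = 0 := hf₃ ▸ coeff_zero_monomial₂ one_ne_zero _ _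
  have hz₄ : coeff 0 f₄ = 0 := hf₄ ▸ coeff_zero_monomial₂ one_ne_zero _ _
  have hd₁ : IsDerivationSeries f₁ := hf₁ ▸ isDerivationSeries_monomial₂ _ _ _
  have hd₂ : IsDerivationSeries f₂ := hf₂ ▸ isDerivationSeries_monomial₂ _ _ _
  have hd₃ : IsDerivationSeries f₃ := hf₃ ▸ isDerivationSeries_monomial₂ _ _ _
  have hd₄ : IsDerivationSeries f₄ := hf₄ ▸ isDerivationSeries_monomial₂ _ _ _
  obtain ⟨A₁, hA₁, hA₁₀, hA₁d, hE₁⟩ := exists_exponent (isUpperSet_orderSet [p₁])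
    (isGroupLike_compProd C₁ hd₁ hd₂ hz₁ hz₂) (coeff_zero_compProd _ _ _) (coeff_zero_add hz₁ hz₂)
    (by rw [hf₁, hf₂]; exact supportedIn_fast h₁ _ _)
  obtain ⟨A₂, hA₂, hA₂₀, hA₂d, hE₂⟩ := exists_exponent (isUpperSet_orderSet (slowOrder p₂))
    (isGroupLike_compProd C₂ hd₃ hd₄ hz₃ hz₄) (coeff_zero_compProd _ _ _) (coeff_zero_add hz₃ hz₄)
    (by rw [hf₃, hf₄]; exact supportedIn_slow h₂ _ _)
  -- The outer method needs its second argument divisible by `h ε`. The error of the slow method is,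
  -- because it carries `ε ^ (p₂ + 1) h ^ (p₂ + 1)`.
  have hA₂s : SupportedIn {p | 1 ≤ p.1 ∧ 1 ≤ p.2} A₂ := by
    rw [← sub_add_cancel A₂ (f₃ + f₄)]
    refine (hE₂.mono ?_).add ?_
    · rintro ⟨i, k⟩ h
      rw [mem_orderSet_slowOrder] at h
      exact ⟨by simp; omega, by simp; omega⟩
    · rw [hf₃, hf₄]
      exact (supportedIn_monomial₂ (by simp) _).add (supportedIn_monomial₂ (by simp) _)
  obtain ⟨A₃, hA₃, hA₃₀, hA₃d, hE₃⟩ := exists_exponent (isUpperSet_orderSet o)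
    (isGroupLike_compProd C₃ hA₁d hA₂d hA₁₀ hA₂₀) (coeff_zero_compProd _ _ _)
    (coeff_zero_add hA₁₀ hA₂₀) (supportedIn_outer h₃ (.of_coeff_zero hA₁₀) hA₂s)
  exact ⟨A₁, A₂, A₁ - (f₁ + f₂), A₂ - (f₃ + f₄), hA₁, by abel, hA₂, by abel, hE₁, hE₂,
    ⟨hA₁₀, hA₁d⟩, ⟨hA₂₀, hA₂d⟩, A₃, A₃ - (A₁ + A₂), hA₃, by abel, by abel, hE₃, hA₃₀, hA₃d⟩

theorem coeff_zero_hierProd {𝒜 : Type*} [Ring 𝒜] [Algebra ℝ 𝒜] (C₁ C₂ C₃ : CompMethod)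
    (f₁ f₂ f₃ f₄ : FormalSeries 𝒜) : coeff 0 (hierProd C₁ C₂ C₃ f₁ f₂ f₃ f₄) = 1 := by
  rw [hierProd]
  refine List.prod_induction (fun F : FormalSeries 𝒜 => coeff 0 F = 1) ?_ (by simp) ?_
  · intro F G hF hG
    simp only [coeff_zero_eq_constantCoeff_apply, map_mul] at *
    rw [hF, hG, one_mul]
  · intro F hF
    obtain ⟨ab, -, rfl⟩ := List.mem_map.1 hF
    have h₁ := coeff_zero_compProd C₁ (ab.1 • f₁) (ab.1 • f₂)
    have h₂ := coeff_zero_compProd C₂ (ab.2 • f₃) (ab.2 • f₄)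
    simp only [coeff_zero_eq_constantCoeff_apply, map_mul] at *
    rw [h₁, h₂, one_mul]

/-- The inner product with step `c h` is in general not `exp (c • A₁)`, as `A₁` is not linear in
`h`, so `exists_exponents` does not apply. The whole product is compared with the exact exponential,
and the error is distributed over the three sets of monomials afterwards. -/
theorem exists_hierarchical_exponent (h₁ : C₁.HasOrder [p₁]) (h₂ : C₂.HasOrder [p₂])
    (h₃ : C₃.HasOrder o) (D₁ D₂ D₃ D₄ : Derivation ℝ V V)
    {f₁ f₂ f₃ f₄ : FormalSeries (Module.End ℝ V)}
    (hf₁ : f₁ = monomial₂ 1 0 (D₁ : Module.End ℝ V))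
    (hf₂ : f₂ = monomial₂ 1 0 (D₂ : Module.End ℝ V))
    (hf₃ : f₃ = monomial₂ 1 1 (D₃ : Module.End ℝ V))
    (hf₄ : f₄ = monomial₂ 1 1 (D₄ : Module.End ℝ V)) :
    ∃ A₃ E₁ E₂ E₃ : FormalSeries (Module.End ℝ V),
      hierProd C₁ C₂ C₃ f₁ f₂ f₃ f₄ = exp A₃ ∧ A₃ = f₁ + f₂ + f₃ + f₄ + E₁ + E₂ + E₃ ∧
      IsOfOrder [p₁] E₁ ∧ IsOfOrder (slowOrder p₂) E₂ ∧ IsOfOrder o E₃ ∧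
      (coeff 0 A₃ = 0 ∧ IsDerivationSeries A₃) := by
  have hz₁ : coeff 0 f₁ = 0 := hf₁ ▸ coeff_zero_monomial₂ one_ne_zero _ _
  have hz₂ : coeff 0 f₂ = 0 := hf₂ ▸ coeff_zero_monomial₂ one_ne_zero _ _
  have hz₃ : coeff 0 f₃ = 0 := hf₃ ▸ coeff_zero_monomial₂ one_ne_zero _ _
  have hz₄ : coeff 0 f₄ = 0 := hf₄ ▸ coeff_zero_monomial₂ one_ne_zero _ _
  have hd₁ : IsDerivationSeries f₁ := hf₁ ▸ isDerivationSeries_monomial₂ _ _ _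
  have hd₂ : IsDerivationSeries f₂ := hf₂ ▸ isDerivationSeries_monomial₂ _ _ _
  have hd₃ : IsDerivationSeries f₃ := hf₃ ▸ isDerivationSeries_monomial₂ _ _ _
  have hd₄ : IsDerivationSeries f₄ := hf₄ ▸ isDerivationSeries_monomial₂ _ _ _
  have hG : IsGroupLike (hierProd C₁ C₂ C₃ f₁ f₂ f₃ f₄) := by
    refine IsGroupLike.list_prod fun G hG => ?_
    obtain ⟨ab, -, rfl⟩ := List.mem_map.1 hG
    exact (isGroupLike_compProd C₁ (hd₁.smul _) (hd₂.smul _) (coeff_zero_smul _ hz₁)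
      (coeff_zero_smul _ hz₂)).mul (isGroupLike_compProd C₂ (hd₃.smul _) (hd₄.smul _)
      (coeff_zero_smul _ hz₃) (coeff_zero_smul _ hz₄))
  obtain ⟨A, hA, hA₀, hAd, hE⟩ := exists_exponent (isUpperSet_hierSet p₁ p₂ o) hG
    (coeff_zero_hierProd _ _ _ _ _ _ _)
    (coeff_zero_add (coeff_zero_add (coeff_zero_add hz₁ hz₂) hz₃) hz₄)
    (by rw [hf₁, hf₂, hf₃, hf₄]; exact supportedIn_hierProd_sub_exp h₁ h₂ h₃ _ _ _ _)
  obtain ⟨E₁₂, E₃, hsum, hE₁₂, hE₃⟩ := hE.exists_add_of_union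
  obtain ⟨E₁, E₂, rfl, hE₁, hE₂⟩ := hE₁₂.exists_add_of_union
  refine ⟨A, E₁, E₂, E₃, hA, ?_, hE₁, hE₂, hE₃, hA₀, hAd⟩
  rw [add_assoc, add_assoc, ← add_assoc E₁, ← hsum]
  abel

end Exponents

end FormalSeries

end

noncomputable section

section Flow

open Set Metric Filter Topology
open scoped NNReal

variable {E : Type*} [NormedAddCommGroup E] [NormedSpace ℝ E]

/-! ### Smooth functions and Lie operators -/

theorem extendZero_of_notMem {U : TopologicalSpace.Opens E} (f : smoothFun U) {x : E}
    (hx : x ∉ U) : extendZero f x = 0 :=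
  Function.extend_apply' _ _ _ fun ⟨y, hy⟩ => hx (hy ▸ y.2)

theorem extendZero_add {U : TopologicalSpace.Opens E} (f g : smoothFun U) (x : E) :
    extendZero (f + g) x = extendZero f x + extendZero g x := by
  by_cases hx : x ∈ U
  · simpa using (extendZero_apply (f + g) ⟨x, hx⟩).trans
      (congr_arg₂ (· + ·) (extendZero_apply f ⟨x, hx⟩) (extendZero_apply g ⟨x, hx⟩)).symm
  · simp [extendZero_of_notMem _ hx]

theorem extendZero_smul {U : TopologicalSpace.Opens E} (c : ℝ) (f : smoothFun U) (x : E) :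
    extendZero (c • f) x = c * extendZero f x := by
  by_cases hx : x ∈ U
  · simpa using (extendZero_apply (c • f) ⟨x, hx⟩).trans
      (congr_arg (c * ·) (extendZero_apply f ⟨x, hx⟩)).symm
  · simp [extendZero_of_notMem _ hx]

theorem extendZero_mk {U : TopologicalSpace.Opens E} {F : E → ℝ} (hF : ContDiffOn ℝ ∞ F U) {x : E}
    (hx : x ∈ U) : extendZero (⟨fun x : U => F x, mem_smoothFun hF⟩ : smoothFun U) x = F x :=
  extendZero_apply _ ⟨x, hx⟩

/-- `D` is the derivative in the direction of the vector field `X`. -/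
def IsLieDerivative {U : TopologicalSpace.Opens E} (X : E → E)
    (D : Module.End ℝ (smoothFun U)) : Prop :=
  ∀ F : smoothFun U, ∀ x ∈ U, extendZero (D F) x = fderiv ℝ (extendZero F) x (X x)

theorem PoissonStructure.isLieDerivative_lieOp {U : TopologicalSpace.Opens E}
    (P : PoissonStructure U) {H : E → ℝ} (hH : ContDiffOn ℝ ∞ H U) :
    IsLieDerivative (P.vectorField H) (P.lieOp hH : Module.End ℝ (smoothFun U)) :=
  fun _ x hx => extendZero_apply _ (⟨x, hx⟩ : U)

theorem IsLieDerivative.add {U : TopologicalSpace.Opens E} {X Y : E → E}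
    {D D' : Module.End ℝ (smoothFun U)} (h : IsLieDerivative X D) (h' : IsLieDerivative Y D') :
    IsLieDerivative (fun x => X x + Y x) (D + D') := by
  intro F x hx
  rw [LinearMap.add_apply, extendZero_add, h F x hx, h' F x hx, map_add]

theorem IsLieDerivative.smul {U : TopologicalSpace.Opens E} {X : E → E}
    {D : Module.End ℝ (smoothFun U)} (h : IsLieDerivative X D) (c : ℝ) :
    IsLieDerivative (fun x => c • X x) (c • D) := by
  intro F x hx
  rw [LinearMap.smul_apply, extendZero_smul, h F x hx, map_smul, smul_eq_mul]

theorem IsLieDerivative.hasDerivWithinAt {U : TopologicalSpace.Opens E} {X : E → E}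
    {D : Module.End ℝ (smoothFun U)} (h : IsLieDerivative X D) (F : smoothFun U) {γ : ℝ → E}
    {s : Set ℝ} {t : ℝ} (hγ : HasDerivWithinAt γ (X (γ t)) s t) (hU : γ t ∈ U) :
    HasDerivWithinAt (fun t => extendZero F (γ t)) (extendZero (D F) (γ t)) s t := by
  rw [h F _ hU]
  exact (differentiableAt_extendZero F ⟨_, hU⟩).hasFDerivAt.comp_hasDerivWithinAt t hγ

/-- The Lie series of the flow, with remainder. -/
theorem IsLieDerivative.abs_sub_sum_le {U : TopologicalSpace.Opens E} {X : E → E}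
    {D : Module.End ℝ (smoothFun U)} (h : IsLieDerivative X D) {γ : ℝ → E} {s : Set ℝ}
    (hs : Convex ℝ s) (hγ : IsSolution U X γ s) {t₀ : ℝ} (ht₀ : t₀ ∈ s) (N : ℕ)
    (F : smoothFun U) {C : ℝ} (hC : ∀ t ∈ s, |extendZero ((D ^ N) F) (γ t)| ≤ C) {t : ℝ}
    (ht : t ∈ s) :
    |extendZero F (γ t) - ∑ m ∈ Finset.range N,
      (t - t₀) ^ m * (((Nat.factorial m : ℝ)⁻¹) * extendZero ((D ^ m) F) (γ t₀))| ≤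
      C * |t - t₀| ^ N := by
  induction N generalizing F t with
  | zero => simpa using hC t ht
  | succ N ih =>
    have hC₀ : 0 ≤ C := (abs_nonneg _).trans (hC t ht)
    set I := uIcc t₀ t with hI
    have hIs : I ⊆ s := by
      rw [hI, ← segment_eq_uIcc]
      exact hs.segment_subset ht₀ ht
    -- `g` is the Taylor remainder of `F` along `γ`, and its derivative `g'` is the remainder of `D
    -- F` with one term fewer. The induction hypothesis bounds `g'`, and the mean value inequality
    -- gains the factor `|t - t₀|`.
    let g : ℝ → ℝ := fun τ => extendZero F (γ τ) - ∑ m ∈ Finset.range (N + 1),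
      (τ - t₀) ^ m * (((Nat.factorial m : ℝ)⁻¹) * extendZero ((D ^ m) F) (γ t₀))
    let g' : ℝ → ℝ := fun τ => extendZero (D F) (γ τ) - ∑ m ∈ Finset.range N,
      (τ - t₀) ^ m * (((Nat.factorial m : ℝ)⁻¹) * extendZero ((D ^ m) (D F)) (γ t₀))
    have hg : ∀ τ ∈ I, HasDerivWithinAt g (g' τ) I τ := by
      intro τ hτ
      have h₁ := h.hasDerivWithinAt F ((hγ τ (hIs hτ)).2.mono hIs) (hγ τ (hIs hτ)).1
      refine h₁.sub ?_
      have h₂ : ∀ m ∈ Finset.range N, HasDerivWithinAt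
          (fun τ => (τ - t₀) ^ (m + 1) *
            (((Nat.factorial (m + 1) : ℝ)⁻¹) * extendZero ((D ^ (m + 1)) F) (γ t₀)))
          ((τ - t₀) ^ m * (((Nat.factorial m : ℝ)⁻¹) * extendZero ((D ^ m) (D F)) (γ t₀)))
          I τ := by
        intro m _
        have h₃ := ((((hasDerivAt_id τ).sub_const t₀).pow (m + 1)).mul_const
          (((Nat.factorial (m + 1) : ℝ)⁻¹) * extendZero ((D ^ (m + 1)) F)
            (γ t₀))).hasDerivWithinAt (s := I)
        refine h₃.congr_deriv ?_
        rw [Nat.factorial_succ, pow_succ D m]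
        have := Nat.factorial_ne_zero m
        push_cast
        simp only [id_eq, Module.End.mul_apply]
        field_simp
      have h₄ := (HasDerivWithinAt.fun_sum h₂).add_const
        ((τ - t₀) ^ 0 * (((Nat.factorial 0 : ℝ)⁻¹) * extendZero ((D ^ 0) F) (γ t₀)))
      simp only [Finset.sum_range_succ' _ N]
      simpa using h₄
    have hb : ∀ τ ∈ I, ‖g' τ‖ ≤ C * |t - t₀| ^ N := by
      intro τ hτ
      refine (ih (D F) (fun t ht => ?_) (hIs hτ)).trans ?_
      · have := hC t ht
        rwa [pow_succ, Module.End.mul_apply] at this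
      · refine mul_le_mul_of_nonneg_left (pow_le_pow_left₀ (abs_nonneg _) ?_ N) hC₀
        exact abs_sub_left_of_mem_uIcc hτ
    have hfin := (convex_uIcc t₀ t).norm_image_sub_le_of_norm_hasDerivWithin_le hg hb
      left_mem_uIcc right_mem_uIcc
    have hg₀ : g t₀ = 0 := by
      simp only [g, Finset.sum_range_succ']
      simp
    rw [hg₀, sub_zero, Real.norm_eq_abs, Real.norm_eq_abs] at hfin
    rw [pow_succ, ← mul_assoc]
    exact hfin

/-! ### Local existence of solutions, uniformly on compact sets -/

/-- The fixed point of the Picard operator is used directly, because its values are confined to the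
closed ball; this confinement yields the compact set that contains the trajectories. -/
theorem exists_solution_mem_closedBall [CompleteSpace E] {X : E → E} {x : E} {δ τ : ℝ} {M L : ℝ≥0}
    (hδ : 0 ≤ δ) (hτ : 0 ≤ τ) (hL : LipschitzOnWith L X (closedBall x δ))
    (hM : ∀ y ∈ closedBall x δ, ‖X y‖ ≤ M) (h : M * τ ≤ δ) :
    ∃ γ : ℝ → E, γ 0 = x ∧ ∀ t ∈ Icc (-τ) τ, γ t ∈ closedBall x δ ∧
      HasDerivWithinAt γ (X (γ t)) (Icc (-τ) τ) t := by
  have h₀ : (0 : ℝ) ∈ Icc (-τ) τ := ⟨by linarith, hτ⟩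
  have hf : IsPicardLindelof (fun _ => X) (⟨0, h₀⟩ : Icc (-τ) τ) x (δ.toNNReal) 0 M L :=
    { lipschitzOnWith := fun t _ => by rwa [Real.coe_toNNReal _ hδ]
      continuousOn := fun _ _ => continuousOn_const
      norm_le := fun t _ => by rwa [Real.coe_toNNReal _ hδ]
      mul_max_le := by
        rw [Real.coe_toNNReal _ hδ]
        simpa using h }
  have hx : x ∈ closedBall x (0 : ℝ≥0) := mem_closedBall_self le_rfl
  obtain ⟨α, hα⟩ := ODE.FunSpace.exists_isFixedPt_next hf hx
  refine ⟨α.compProj, ?_, fun t ht => ⟨?_, ?_⟩⟩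
  · have := ODE.FunSpace.next_apply₀ hf hx α
    rw [hα] at this
    rw [ODE.FunSpace.compProj_of_mem h₀, this]
  · simpa [Real.coe_toNNReal _ hδ] using α.compProj_mem_closedBall (t := t) hf.mul_max_le
  · apply ODE.hasDerivWithinAt_picard_Icc h₀ hf.continuousOn_uncurry
      α.continuous_compProj.continuousOn (fun _ _ => α.compProj_mem_closedBall hf.mul_max_le)
      x ht |>.congr_of_mem _ ht
    intro t' ht'
    nth_rw 1 [← hα]
    rw [ODE.FunSpace.compProj_of_mem ht', ODE.FunSpace.next_apply]

/-- On a compact thickening of `K` inside `U` the field and its derivative are bounded, so the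
existence time depends on the bound of the field and the radius but not on the starting point. -/
theorem exists_solution_of_isCompact [FiniteDimensional ℝ E] {U : TopologicalSpace.Opens E}
    {X : E → E} (hX : ContDiffOn ℝ ∞ X U) {K : Set E} (hK : IsCompact K) (hKU : K ⊆ U) :
    ∃ K' : Set E, IsCompact K' ∧ K' ⊆ U ∧ ∃ τ > 0, ∀ x ∈ K, ∃ γ : ℝ → E, γ 0 = x ∧
      IsSolution U X γ (Icc (-τ) τ) ∧ ∀ t ∈ Icc (-τ) τ, γ t ∈ K' := by
  have := FiniteDimensional.complete ℝ E
  have := FiniteDimensional.proper_real E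
  obtain ⟨δ, hδ, hδU⟩ := hK.exists_cthickening_subset_open U.isOpen hKU
  have hK' : IsCompact (cthickening δ K) := hK.cthickening
  obtain ⟨M, hM⟩ := hK'.exists_bound_of_continuousOn (hX.continuousOn.mono hδU)
  obtain ⟨L, hL⟩ := hK'.exists_bound_of_continuousOn
    ((hX.continuousOn_fderiv_of_isOpen U.isOpen (by simp)).mono hδU)
  have hM' : ∀ x ∈ cthickening δ K, ‖X x‖ ≤ M.toNNReal := fun x hx =>
    (hM x hx).trans (Real.le_coe_toNNReal M)
  have hL' : ∀ x ∈ cthickening δ K, ‖fderiv ℝ X x‖₊ ≤ L.toNNReal := fun x hx => by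
    rw [← NNReal.coe_le_coe]
    exact (hL x hx).trans (Real.le_coe_toNNReal L)
  -- This time satisfies `M * τ ≤ δ`; the `+ 1` guards against a vanishing bound.
  refine ⟨cthickening δ K, hK', hδU, δ / (M.toNNReal + 1), by positivity, fun x hx => ?_⟩
  have hball : closedBall x δ ⊆ cthickening δ K := closedBall_subset_cthickening hx δ
  have hLip : LipschitzOnWith L.toNNReal X (closedBall x δ) :=
    (convex_closedBall x δ).lipschitzOnWith_of_nnnorm_fderiv_le
      (fun y hy => (hX.contDiffAt (U.isOpen.mem_nhds (hδU (hball hy)))).differentiableAt (by simp))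
      fun y hy => hL' y (hball hy)
  obtain ⟨γ, hγ₀, hγ⟩ := exists_solution_mem_closedBall (τ := δ / (M.toNNReal + 1)) hδ.le
    (by positivity) hLip (fun y hy => hM' y (hball hy)) (by
      rw [← mul_div_assoc, div_le_iff₀ (by positivity)]
      nlinarith [M.toNNReal.coe_nonneg])
  exact ⟨γ, hγ₀, fun t ht => ⟨hδU (hball (hγ t ht).1), (hγ t ht).2⟩, fun t ht => hball (hγ t ht).1⟩

end Flow

end

/-! ### Evaluation of the parameter `ε` at a real number -/

noncomputable section

namespace FormalSeries

open PowerSeries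

variable {𝒜 : Type*} [Ring 𝒜] [Algebra ℝ 𝒜]

/-- The evaluation of a polynomial in `ε` at a real number. -/
def evalAt (ε : ℝ) : Polynomial 𝒜 →ₐ[ℝ] 𝒜 :=
  { Polynomial.eval₂RingHom' (RingHom.id 𝒜) (algebraMap ℝ 𝒜 ε)
      (fun a => (Algebra.commutes ε a).symm) with
    commutes' := fun r => by
      change Polynomial.eval₂ _ _ _ = _
      rw [Polynomial.algebraMap_apply, Polynomial.eval₂_C, RingHom.id_apply] }

theorem evalAt_monomial (ε : ℝ) (k : ℕ) (a : 𝒜) :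
    evalAt ε (Polynomial.monomial k a) = ε ^ k • a := by
  change Polynomial.eval₂ (RingHom.id 𝒜) (algebraMap ℝ 𝒜 ε) (Polynomial.monomial k a) = _
  rw [Polynomial.eval₂_monomial, RingHom.id_apply, ← map_pow, ← Algebra.commutes,
    ← Algebra.smul_def]

theorem coeff_exp_monomial (p : Polynomial 𝒜) (n : ℕ) :
    coeff n (exp (PowerSeries.monomial 1 p)) = ((Nat.factorial n : ℝ)⁻¹) • p ^ n := by
  have hpow : ∀ m, (PowerSeries.monomial 1 p : FormalSeries 𝒜) ^ m =
      PowerSeries.monomial m (p ^ m) := by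
    intro m
    induction m with
    | zero => simp [PowerSeries.monomial_zero_eq_C_apply]
    | succ m ih => rw [pow_succ, ih, PowerSeries.monomial_mul_monomial, pow_succ]
  rw [coeff_exp (by rw [PowerSeries.coeff_monomial, if_neg zero_ne_one]) (Nat.lt_succ_self n),
    map_sum, Finset.sum_eq_single n]
  · rw [PowerSeries.coeff_smul, hpow, PowerSeries.coeff_monomial, if_pos rfl]
  · intro m _ hm
    rw [PowerSeries.coeff_smul, hpow, PowerSeries.coeff_monomial, if_neg hm.symm, smul_zero]
  · simp

end FormalSeries

section Representation

open Set Metric Filter Topology Asymptotics FormalSeries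

variable {E : Type*} [NormedAddCommGroup E] [NormedSpace ℝ E] {U : TopologicalSpace.Opens E}

/-! ### Expansions of one-step maps -/

/-- The filter of the triples `(h, ε, x)` with `h → 0`, `0 ≤ ε ≤ ε₀` and `x ∈ K`. -/
def stepFilter (ε₀ : ℝ) (K : Set E) : Filter (ℝ × ℝ × E) :=
  𝓝[>] 0 ×ˢ 𝓟 (Icc 0 ε₀ ×ˢ K)

theorem eventually_stepFilter {ε₀ : ℝ} {K : Set E} {p : ℝ × ℝ × E → Prop} :
    (∀ᶠ z in stepFilter ε₀ K, p z) ↔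
      ∃ h₀ > 0, ∀ h, 0 < h → h ≤ h₀ → ∀ ε ∈ Icc 0 ε₀, ∀ x ∈ K, p (h, ε, x) := by
  rw [stepFilter, eventually_prod_principal_iff, eventually_iff, mem_nhdsGT_iff_exists_Ioc_subset]
  constructor
  · rintro ⟨h₀, hpos, hsub⟩
    exact ⟨h₀, hpos, fun h h₁ h₂ ε hε x hx => hsub ⟨h₁, h₂⟩ (ε, x) ⟨hε, hx⟩⟩
  · rintro ⟨h₀, hpos, H⟩
    exact ⟨h₀, hpos, fun h hh ⟨ε, x⟩ hx => H h hh.1 hh.2 ε hx.1 x hx.2⟩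

/-- The algebra of operators on `C^∞(U)`, with the opposite multiplication: composition of maps of
`U` reverses the order of the operators that they induce on functions. -/
def OppositeOperators (U : TopologicalSpace.Opens E) : Type _ := (Module.End ℝ (smoothFun U))ᵐᵒᵖ

instance : Ring (OppositeOperators U) := inferInstanceAs (Ring (Module.End ℝ (smoothFun U))ᵐᵒᵖ)

instance : Algebra ℝ (OppositeOperators U) :=
  inferInstanceAs (Algebra ℝ (Module.End ℝ (smoothFun U))ᵐᵒᵖ)

namespace OppositeOperators

/-- The operator underlying an element of `OppositeOperators U`. -/
def toEnd (a : OppositeOperators U) : Module.End ℝ (smoothFun U) := MulOpposite.unop a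

/-- An operator as an element of `OppositeOperators U`. -/
def ofEnd (D : Module.End ℝ (smoothFun U)) : OppositeOperators U := MulOpposite.op D

theorem toEnd_ofEnd (D : Module.End ℝ (smoothFun U)) : (ofEnd D).toEnd = D := rfl

theorem toEnd_add (a b : OppositeOperators U) : (a + b).toEnd = a.toEnd + b.toEnd := rfl

theorem toEnd_smul (c : ℝ) (a : OppositeOperators U) : (c • a).toEnd = c • a.toEnd := rfl

theorem toEnd_mul (a b : OppositeOperators U) : (a * b).toEnd = b.toEnd * a.toEnd := rfl

theorem toEnd_pow (a : OppositeOperators U) (n : ℕ) : (a ^ n).toEnd = a.toEnd ^ n := by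
  induction n with
  | zero => rfl
  | succ n ih => rw [pow_succ, pow_succ', toEnd_mul, ih]

end OppositeOperators

open OppositeOperators

/-- The function obtained by applying to `F` the operator `p(ε)`. -/
def applyAt (p : Polynomial (OppositeOperators U)) (ε : ℝ) (F : smoothFun U) :
    smoothFun U :=
  (evalAt ε p).toEnd F

/-- The value of `p(ε) F` at the point `x`, for the triple `(h, ε, x)`. -/
def value (p : Polynomial (OppositeOperators U)) (F : smoothFun U)
    (z : ℝ × ℝ × E) : ℝ :=
  extendZero (applyAt p z.2.1 F) z.2.2

theorem value_add (p q : Polynomial (OppositeOperators U)) (F : smoothFun U)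
    (z : ℝ × ℝ × E) : value (p + q) F z = value p F z + value q F z := by
  rw [value, value, value, ← extendZero_add, applyAt, map_add]
  rfl

theorem value_monomial (k : ℕ) (a : OppositeOperators U) (F : smoothFun U)
    (z : ℝ × ℝ × E) :
    value (Polynomial.monomial k a) F z = z.2.1 ^ k * extendZero (a.toEnd F) z.2.2 := by
  rw [value, ← extendZero_smul, applyAt, evalAt_monomial]
  rfl

theorem value_smul (c : ℝ) (p : Polynomial (OppositeOperators U)) (F : smoothFun U)
    (z : ℝ × ℝ × E) : value (c • p) F z = c * value p F z := by
  rw [value, value, ← extendZero_smul, applyAt, map_smul]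
  rfl

theorem value_zero (F : smoothFun U) (z : ℝ × ℝ × E) :
    value (0 : Polynomial (OppositeOperators U)) F z = 0 := by
  simpa using value_smul 0 0 F z

theorem value_sub (p q : Polynomial (OppositeOperators U)) (F : smoothFun U)
    (z : ℝ × ℝ × E) : value (p - q) F z = value p F z - value q F z := by
  rw [eq_sub_iff_add_eq, ← value_add, sub_add_cancel]

theorem value_sum {ι : Type*} (s : Finset ι)
    (p : ι → Polynomial (OppositeOperators U)) (F : smoothFun U) (z : ℝ × ℝ × E) :
    value (∑ i ∈ s, p i) F z = ∑ i ∈ s, value (p i) F z := by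
  classical
  induction s using Finset.induction_on with
  | empty => simp [value_zero]
  | insert i s hi ih => rw [Finset.sum_insert hi, Finset.sum_insert hi, value_add, ih]

theorem value_one (F : smoothFun U) (z : ℝ × ℝ × E) :
    value (1 : Polynomial (OppositeOperators U)) F z = extendZero F z.2.2 := by
  rw [value, applyAt, map_one]
  rfl

theorem value_mul (p q : Polynomial (OppositeOperators U)) (F : smoothFun U)
    (z : ℝ × ℝ × E) : value (p * q) F z = value q (applyAt p z.2.1 F) z := by
  rw [value, value, applyAt, map_mul]
  rfl

theorem isBigO_of_bound_on {ε₀ : ℝ} {K : Set E} {f g : ℝ × ℝ × E → ℝ} {C : ℝ}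
    (h : ∀ h, 0 < h → h ≤ 1 → ∀ ε ∈ Icc 0 ε₀, ∀ x ∈ K, ‖f (h, ε, x)‖ ≤ C * ‖g (h, ε, x)‖) :
    f =O[stepFilter ε₀ K] g :=
  IsBigO.of_bound C (eventually_stepFilter.2 ⟨1, one_pos, h⟩)

theorem isBigO_pow_of_le {ε₀ : ℝ} {K : Set E} {m n : ℕ} (h : m ≤ n) :
    (fun z : ℝ × ℝ × E => z.1 ^ n) =O[stepFilter ε₀ K] fun z => z.1 ^ m := by
  refine isBigO_of_bound_on (C := 1) fun t ht ht' ε _ x _ => ?_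
  rw [one_mul, norm_pow, norm_pow, Real.norm_of_nonneg ht.le]
  exact pow_le_pow_of_le_one ht.le ht' h

theorem isBigO_eps_pow {ε₀ : ℝ} {K : Set E} (k : ℕ) :
    (fun z : ℝ × ℝ × E => z.2.1 ^ k) =O[stepFilter ε₀ K] fun _ => (1 : ℝ) := by
  refine isBigO_of_bound_on (C := ε₀ ^ k) fun t _ _ ε hε x _ => ?_
  rw [norm_one, mul_one, norm_pow, Real.norm_of_nonneg hε.1]
  exact pow_le_pow_left₀ hε.1 hε.2 k

theorem isBigO_extendZero {ε₀ : ℝ} {K : Set E} (hK : IsCompact K) (hKU : K ⊆ U)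
    (F : smoothFun U) :
    (fun z : ℝ × ℝ × E => extendZero F z.2.2) =O[stepFilter ε₀ K] fun _ => (1 : ℝ) := by
  obtain ⟨C, hC⟩ := hK.exists_bound_of_continuousOn
    ((contDiffOn_extendZero F).continuousOn.mono hKU)
  refine isBigO_of_bound_on (C := C) fun t _ _ ε _ x hx => ?_
  rw [norm_one, mul_one]
  exact hC x hx

theorem isBigO_value {ε₀ : ℝ} {K : Set E} (hK : IsCompact K) (hKU : K ⊆ U)
    (p : Polynomial (OppositeOperators U)) (F : smoothFun U) :
    value p F =O[stepFilter ε₀ K] fun _ => (1 : ℝ) := by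
  induction p using Polynomial.induction_on' with
  | add p q hp hq => exact (hp.add hq).congr_left fun z => (value_add p q F z).symm
  | monomial k a =>
    have h := (isBigO_eps_pow (K := K) (ε₀ := ε₀) k).mul (isBigO_extendZero hK hKU (a.toEnd F))
    simp only [mul_one] at h
    exact h.congr_left fun z => (value_monomial k a F z).symm

/-- The one-step maps `φ ε h` are given by the operator series `G`, up to terms
`O(h ^ (N + 1))`. -/
def Represents (N : ℕ) (ε₀ : ℝ) (φ : ℝ → ℝ → E → E)
    (G : FormalSeries (OppositeOperators U)) : Prop :=
  ∀ K : Set E, IsCompact K → K ⊆ U →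
    (∃ K' : Set E, IsCompact K' ∧ K' ⊆ U ∧
      Tendsto (fun z : ℝ × ℝ × E => (z.1, z.2.1, φ z.2.1 z.1 z.2.2)) (stepFilter ε₀ K)
        (stepFilter ε₀ K')) ∧
    ∀ F : smoothFun U, (fun z : ℝ × ℝ × E => extendZero F (φ z.2.1 z.1 z.2.2) -
      ∑ i ∈ Finset.range (N + 1), z.1 ^ i * value (PowerSeries.coeff i G) F z) =O[stepFilter ε₀ K]
        fun z => z.1 ^ (N + 1)

theorem tendsto_stepFilter {ε₀ : ℝ} {K K' : Set E} {φ : ℝ → ℝ → E → E}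
    (h : ∀ᶠ z in stepFilter ε₀ K, φ z.2.1 z.1 z.2.2 ∈ K') :
    Tendsto (fun z : ℝ × ℝ × E => (z.1, z.2.1, φ z.2.1 z.1 z.2.2)) (stepFilter ε₀ K)
      (stepFilter ε₀ K') := by
  have h₁ : Tendsto (fun z : ℝ × ℝ × E => z.1) (stepFilter ε₀ K) (𝓝[>] 0) := tendsto_fst
  have h₂ : ∀ᶠ z in stepFilter ε₀ K, z.2 ∈ Icc 0 ε₀ ×ˢ K :=
    tendsto_principal.1 (tendsto_snd : Tendsto Prod.snd (stepFilter ε₀ K) _)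
  refine h₁.prodMk (tendsto_principal.2 ?_)
  filter_upwards [h, h₂] with z hz hz'
  exact ⟨hz'.1, hz⟩

theorem eventually_of_tendsto {ε₀ : ℝ} {K K' : Set E} {φ : ℝ → ℝ → E → E}
    (h : Tendsto (fun z : ℝ × ℝ × E => (z.1, z.2.1, φ z.2.1 z.1 z.2.2)) (stepFilter ε₀ K)
      (stepFilter ε₀ K')) : ∀ᶠ z in stepFilter ε₀ K, φ z.2.1 z.1 z.2.2 ∈ K' := by
  have h₁ : ∀ᶠ z in stepFilter ε₀ K', z.2 ∈ Icc 0 ε₀ ×ˢ K' :=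
    tendsto_principal.1 (tendsto_snd : Tendsto Prod.snd (stepFilter ε₀ K') _)
  exact (h.eventually h₁).mono fun z hz => hz.2

theorem Represents.id (N : ℕ) (ε₀ : ℝ) :
    Represents N ε₀ (fun _ _ => _root_.id) (1 : FormalSeries (OppositeOperators U)) := by
  refine fun K hK hKU => ⟨⟨K, hK, hKU, tendsto_id⟩, fun F => ?_⟩
  refine (isBigO_zero (E' := ℝ) _ _).congr_left fun z => ?_
  rw [Finset.sum_range_succ', Finset.sum_eq_zero]
  · simp [value_one]
  · intro i _
    rw [PowerSeries.coeff_one, if_neg (by omega), value_zero, mul_zero]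

/-- The function `p(ε) F` varies with `ε`, whereas `Represents` speaks of a fixed function. For a
monomial in `ε` the dependence is a bounded scalar in front of a fixed function; the general case
follows by additivity. -/
theorem Represents.isBigO_value_sub {N : ℕ} {ε₀ : ℝ} {φ : ℝ → ℝ → E → E}
    {G : FormalSeries (OppositeOperators U)} (hφ : Represents N ε₀ φ G) {K : Set E}
    (hK : IsCompact K) (hKU : K ⊆ U) (p : Polynomial (OppositeOperators U))
    (F : smoothFun U) :
    (fun z : ℝ × ℝ × E => value p F (z.1, z.2.1, φ z.2.1 z.1 z.2.2) -
      ∑ i ∈ Finset.range (N + 1), z.1 ^ i * value (p * PowerSeries.coeff i G) F z)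
        =O[stepFilter ε₀ K] fun z => z.1 ^ (N + 1) := by
  induction p using Polynomial.induction_on' with
  | add p q hp hq =>
    refine (hp.add hq).congr_left fun z => ?_
    simp only [add_mul, value_add, mul_add, Finset.sum_add_distrib]
    ring
  | monomial k a =>
    have h := (isBigO_eps_pow (K := K) (ε₀ := ε₀) k).mul ((hφ K hK hKU).2 (a.toEnd F))
    simp only [one_mul] at h
    refine h.congr_left fun z => ?_
    rw [value_monomial, mul_sub, Finset.mul_sum]
    congr 1
    refine Finset.sum_congr rfl fun i _ => ?_
    have hF : applyAt (Polynomial.monomial k a) z.2.1 F = z.2.1 ^ k • (a.toEnd F) := by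
      rw [applyAt, evalAt_monomial]
      rfl
    have hv : ∀ (c : ℝ) (q : Polynomial (OppositeOperators U)) (F : smoothFun U),
        value q (c • F) z = c * value q F z := by
      intro c q F
      rw [value, value, applyAt, map_smul, extendZero_smul]
      rfl
    rw [value_mul, hF, hv]
    ring

/-- The first sum on the right is the truncated Cauchy product; the second collects the pairs of
total degree at least `N + 1`, which go into the remainder. -/
theorem sum_range_mul_sum_range (f : ℕ → ℕ → ℝ) (t : ℝ) (N : ℕ) :
    ∑ i ∈ Finset.range (N + 1), t ^ i * ∑ j ∈ Finset.range (N + 1), t ^ j * f i j =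
      ∑ n ∈ Finset.range (N + 1),
        t ^ n * ∑ p ∈ Finset.HasAntidiagonal.antidiagonal n, f p.1 p.2 +
      ∑ p ∈ (Finset.range (N + 1) ×ˢ Finset.range (N + 1)) with ¬ p.1 + p.2 < N + 1,
        t ^ (p.1 + p.2) * f p.1 p.2 := by
  have h : ∑ i ∈ Finset.range (N + 1), t ^ i * ∑ j ∈ Finset.range (N + 1), t ^ j * f i j =
      ∑ p ∈ Finset.range (N + 1) ×ˢ Finset.range (N + 1), t ^ (p.1 + p.2) * f p.1 p.2 := by
    rw [Finset.sum_product]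
    refine Finset.sum_congr rfl fun i _ => ?_
    rw [Finset.mul_sum]
    exact Finset.sum_congr rfl fun j _ => by rw [pow_add, mul_assoc]
  rw [h, ← Finset.sum_filter_add_sum_filter_not _ (fun p : ℕ × ℕ => p.1 + p.2 < N + 1)]
  congr 1
  rw [← Finset.sum_fiberwise_of_maps_to (t := Finset.range (N + 1)) (g := fun p => p.1 + p.2)
    (by intro p hp; exact Finset.mem_range.2 (Finset.mem_filter.1 hp).2)]
  refine Finset.sum_congr rfl fun n hn => ?_
  rw [Finset.mul_sum]
  refine Finset.sum_congr ?_ fun p hp => ?_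
  · ext p
    simp only [Finset.mem_filter, Finset.mem_product, Finset.mem_range,
      Finset.HasAntidiagonal.mem_antidiagonal] at *
    omega
  · rw [Finset.HasAntidiagonal.mem_antidiagonal.1 hp]

/-- The outer map is expanded at the image under the inner one, which stays in a compact subset of
`U` by the first clause of `Represents`; then each coefficient is transported by the inner map. The
opposite multiplication keeps the factors in the order of the maps. -/
theorem Represents.comp {N : ℕ} {ε₀ : ℝ} {φ ψ : ℝ → ℝ → E → E}
    {G G' : FormalSeries (OppositeOperators U)} (hφ : Represents N ε₀ φ G)
    (hψ : Represents N ε₀ ψ G') : Represents N ε₀ (fun ε h => φ ε h ∘ ψ ε h) (G * G') := by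
  intro K hK hKU
  obtain ⟨K', hK', hKU', hψt⟩ := (hψ K hK hKU).1
  obtain ⟨K'', hK'', hKU'', hφt⟩ := (hφ K' hK' hKU').1
  refine ⟨⟨K'', hK'', hKU'', hφt.comp hψt⟩, fun F => ?_⟩
  have h₁ := ((hφ K' hK' hKU').2 F).comp_tendsto hψt
  have h₂ : ∀ i ∈ Finset.range (N + 1), (fun z : ℝ × ℝ × E => z.1 ^ i *
      (value (PowerSeries.coeff i G) F (z.1, z.2.1, ψ z.2.1 z.1 z.2.2) -
        ∑ j ∈ Finset.range (N + 1),
          z.1 ^ j * value (PowerSeries.coeff i G * PowerSeries.coeff j G') F z))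
      =O[stepFilter ε₀ K] fun z => z.1 ^ (N + 1) := by
    intro i _
    have h := (isBigO_pow_of_le (ε₀ := ε₀) (K := K) (Nat.zero_le i)).mul
      (hψ.isBigO_value_sub hK hKU (PowerSeries.coeff i G) F)
    simpa only [pow_zero, one_mul] using h
  have h₃ : ∀ p ∈ (Finset.range (N + 1) ×ˢ Finset.range (N + 1)).filter
      (fun p => ¬ p.1 + p.2 < N + 1), (fun z : ℝ × ℝ × E => z.1 ^ (p.1 + p.2) *
        value (PowerSeries.coeff p.1 G * PowerSeries.coeff p.2 G') F z)
      =O[stepFilter ε₀ K] fun z => z.1 ^ (N + 1) := by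
    intro p hp
    have h := (isBigO_pow_of_le (ε₀ := ε₀) (K := K) (not_lt.1 (Finset.mem_filter.1 hp).2)).mul
      (isBigO_value hK hKU (PowerSeries.coeff p.1 G * PowerSeries.coeff p.2 G') F)
    simpa only [mul_one] using h
  refine ((h₁.add (IsBigO.fun_sum h₂)).add (IsBigO.fun_sum h₃)).congr_left fun z => ?_
  simp only [mul_sub, Finset.sum_sub_distrib]
  rw [sum_range_mul_sum_range
    (fun i j => value (PowerSeries.coeff i G * PowerSeries.coeff j G') F z)]
  simp only [PowerSeries.coeff_mul, value_sum, Function.comp_apply]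
  ring

/-- Stated for arbitrary families that are expanded at every multiple of the step, so that it
applies to flows and again to methods built from them. -/
theorem Represents.compose {N : ℕ} {ε₀ : ℝ} {Φ Ψ : ℝ → ℝ → E → E}
    {F G : ℝ → FormalSeries (OppositeOperators U)}
    (hΦ : ∀ c, Represents N ε₀ (fun ε h => Φ ε (c * h)) (F c))
    (hΨ : ∀ c, Represents N ε₀ (fun ε h => Ψ ε (c * h)) (G c)) (C : CompMethod) (c : ℝ) :
    Represents N ε₀ (fun ε h => C.compose (Φ ε) (Ψ ε) (c * h))
      (C.map fun ab => F (ab.1 * c) * G (ab.2 * c)).prod := by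
  induction C with
  | nil => exact Represents.id N ε₀
  | cons ab C ih =>
    rw [List.map_cons, List.prod_cons]
    have h := ((hΦ (ab.1 * c)).comp (hΨ (ab.2 * c))).comp ih
    simp only [mul_assoc ab.1, mul_assoc ab.2] at h
    exact h

end Representation

end

noncomputable section

section GlobalError

open Set Metric Filter Topology Asymptotics FormalSeries OppositeOperators

variable {E : Type*} [NormedAddCommGroup E] [NormedSpace ℝ E] {U : TopologicalSpace.Opens E}

/-! ### The expansion of a flow -/

theorem isSolution_scale {X : E → E} {γ : ℝ → E} {τ a s : ℝ}
    (hγ : IsSolution U X γ (Icc (-τ) τ)) (ha : |a * s| ≤ τ) :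
    IsSolution U (fun x => a • X x) (fun t => γ (a * t)) (uIcc 0 s) := by
  have hmaps : MapsTo (fun t => a * t) (uIcc 0 s) (Icc (-τ) τ) := by
    intro t ht
    rw [mem_Icc, ← abs_le]
    refine le_trans ?_ ha
    rw [abs_mul, abs_mul]
    have := abs_sub_left_of_mem_uIcc ht
    rw [sub_zero, sub_zero] at this
    exact mul_le_mul_of_nonneg_left this (abs_nonneg a)
  intro t ht
  refine ⟨(hγ _ (hmaps ht)).1, ?_⟩
  have h₁ : HasDerivWithinAt (fun t => a * t) a (uIcc 0 s) t := by
    simpa using ((hasDerivAt_id t).const_mul a).hasDerivWithinAt (s := uIcc 0 s)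
  exact (hγ _ (hmaps ht)).2.scomp t h₁ hmaps

/-- The flow of `ε ^ k X` at time `c h` is that of `X` at time `ε ^ k c h`. Solutions from `K` exist
for a common time inside one compact set, where the remainder of the Lie series is uniform. -/
theorem represents_flow [FiniteDimensional ℝ E] (N : ℕ) (ε₀ : ℝ) {X : E → E}
    (hX : ContDiffOn ℝ ∞ X U) {D : Module.End ℝ (smoothFun U)} (hD : IsLieDerivative X D) (k : ℕ)
    {Φ : ℝ → ℝ → E → E} (hΦ : ∀ ε, IsFlow U (fun x => ε ^ k • X x) (Φ ε)) (c : ℝ) :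
    Represents N ε₀ (fun ε h => Φ ε (c * h)) (FormalSeries.exp (c • monomial₂ 1 k (ofEnd D))) := by
  intro K hK hKU
  obtain ⟨K', hK', hKU', τ, hτ, H⟩ := exists_solution_of_isCompact hX hK hKU
  set B : ℝ := |ε₀| ^ k * |c| with hB
  have hB₀ : 0 ≤ B := by positivity
  have hev : ∀ᶠ z in stepFilter ε₀ K, ∃ γ : ℝ → E, γ 0 = z.2.2 ∧ IsSolution U X γ (Icc (-τ) τ) ∧
      (∀ t ∈ Icc (-τ) τ, γ t ∈ K') ∧ z.2.1 ^ k * (c * z.1) ∈ Icc (-τ) τ ∧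
      |z.2.1 ^ k * (c * z.1)| ≤ B * z.1 ∧ 0 < z.1 ∧
      Φ z.2.1 (c * z.1) z.2.2 = γ (z.2.1 ^ k * (c * z.1)) := by
    -- For these `h` the rescaled time `ε ^ k c h` is at most `B h ≤ τ` in absolute value.
    refine eventually_stepFilter.2 ⟨τ / (B + 1), by positivity, fun h hh hh' ε hε x hx => ?_⟩
    obtain ⟨γ, hγ₀, hγ, hγK⟩ := H x hx
    have h₁ : |ε ^ k * (c * h)| ≤ B * h := by
      rw [abs_mul, abs_mul, abs_of_pos hh, ← mul_assoc, hB, abs_pow]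
      gcongr
      · exact hε.1
      · exact hε.2
    have h₂ : |ε ^ k * (c * h)| ≤ τ := by
      rw [le_div_iff₀ (by positivity)] at hh'
      nlinarith
    have h₃ := hΦ ε (fun t => γ (ε ^ k * t)) (c * h) (isSolution_scale hγ h₂)
    simp only [mul_zero, hγ₀] at h₃
    exact ⟨γ, hγ₀, hγ, hγK, abs_le.1 h₂, h₁, hh, h₃⟩
  refine ⟨⟨K', hK', hKU', tendsto_stepFilter (φ := fun ε h => Φ ε (c * h)) ?_⟩,
    fun F => ?_⟩
  · filter_upwards [hev] with z hz
    obtain ⟨γ, -, -, hγK, hs, -, -, hΦz⟩ := hz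
    rw [hΦz]
    exact hγK _ hs
  · obtain ⟨C, hC⟩ := hK'.exists_bound_of_continuousOn
      ((contDiffOn_extendZero ((D ^ (N + 1)) F)).continuousOn.mono hKU')
    refine IsBigO.of_bound (C * B ^ (N + 1)) ?_
    filter_upwards [hev] with z hz
    obtain ⟨γ, hγ₀, hγ, hγK, hs, hsB, hz, hΦz⟩ := hz
    have hC₀ : 0 ≤ C := (norm_nonneg _).trans (hC _ (hγK _ hs))
    have h := hD.abs_sub_sum_le (convex_Icc (-τ) τ) hγ (t₀ := 0) ⟨by linarith, hτ.le⟩ (N + 1) F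
      (fun t ht => hC _ (hγK t ht)) hs
    have hsum : ∀ i, z.1 ^ i * value (PowerSeries.coeff i
        (FormalSeries.exp (c • monomial₂ 1 k (ofEnd D)))) F z = (z.2.1 ^ k * (c * z.1)) ^ i *
          (((Nat.factorial i : ℝ)⁻¹) * extendZero ((D ^ i) F) z.2.2) := by
      intro i
      rw [smul_monomial₂, monomial₂, coeff_exp_monomial, value_smul, Polynomial.monomial_pow,
        value_monomial, toEnd_pow, toEnd_smul, toEnd_ofEnd, smul_pow, LinearMap.smul_apply,
        extendZero_smul, mul_pow, mul_pow, pow_mul]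
      ring
    simp only [hsum, hΦz]
    rw [Real.norm_eq_abs, norm_pow, Real.norm_of_nonneg hz.le, mul_assoc, ← mul_pow]
    simp only [sub_zero, hγ₀] at h
    refine h.trans (mul_le_mul_of_nonneg_left ?_ hC₀)
    exact pow_le_pow_left₀ (abs_nonneg _) hsB _

/-! ### Bounds that are uniform in the parameter -/

theorem exists_abs_value_le (ε₀ : ℝ) {K : Set E} (hK : IsCompact K) (hKU : K ⊆ U)
    (p : Polynomial (OppositeOperators U)) (F : smoothFun U) :
    ∃ C, ∀ ε ∈ Icc 0 ε₀, ∀ x ∈ K, ∀ h, |value p F (h, ε, x)| ≤ C := by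
  obtain ⟨C, hC⟩ := (isBigO_value (ε₀ := ε₀) hK hKU p F).bound
  obtain ⟨h₀, hpos, H⟩ := eventually_stepFilter.1 hC
  refine ⟨C, fun ε hε x hx h => ?_⟩
  -- `value` ignores the step component, so the bound at the single step `h₀` serves for every `h`.
  have h₁ := H h₀ hpos le_rfl ε hε x hx
  rw [norm_one, mul_one] at h₁
  exact h₁

theorem exists_lipschitz_extendZero {K : Set E} {δ : ℝ} (hK : IsCompact (cthickening δ K))
    (hKU : cthickening δ K ⊆ U) (F : smoothFun U) :
    ∃ L, ∀ y ∈ K, ∀ x ∈ closedBall y δ,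
      |extendZero F x - extendZero F y| ≤ L * ‖x - y‖ := by
  obtain ⟨L, hL⟩ := hK.exists_bound_of_continuousOn
    (((contDiffOn_extendZero F).continuousOn_fderiv_of_isOpen U.isOpen (by simp)).mono hKU)
  refine ⟨L, fun y hy x hx => ?_⟩
  have hball : closedBall y δ ⊆ cthickening δ K := closedBall_subset_cthickening hy δ
  exact (convex_closedBall y δ).norm_image_sub_le_of_norm_fderiv_le
    (fun z hz => differentiableAt_extendZero F ⟨z, hKU (hball hz)⟩) (fun z hz => hL z (hball hz))
    (mem_closedBall_self (dist_nonneg.trans hx)) hx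

theorem exists_lipschitz_value (ε₀ : ℝ) {K : Set E} {δ : ℝ} (hK : IsCompact (cthickening δ K))
    (hKU : cthickening δ K ⊆ U) (p : Polynomial (OppositeOperators U)) (F : smoothFun U) :
    ∃ L, ∀ ε ∈ Icc 0 ε₀, ∀ y ∈ K, ∀ x ∈ closedBall y δ, ∀ h h',
      |value p F (h, ε, x) - value p F (h', ε, y)| ≤ L * ‖x - y‖ := by
  induction p using Polynomial.induction_on' with
  | add p q hp hq =>
    obtain ⟨L, hL⟩ := hp
    obtain ⟨L', hL'⟩ := hq
    refine ⟨L + L', fun ε hε y hy x hx h h' => ?_⟩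
    rw [value_add, value_add, add_sub_add_comm, add_mul]
    exact (abs_add_le _ _).trans (add_le_add (hL ε hε y hy x hx h h') (hL' ε hε y hy x hx h h'))
  | monomial k a =>
    obtain ⟨L, hL⟩ := exists_lipschitz_extendZero hK hKU (a.toEnd F)
    refine ⟨ε₀ ^ k * L, fun ε hε y hy x hx h h' => ?_⟩
    rw [value_monomial, value_monomial, ← mul_sub, abs_mul, abs_pow, abs_of_nonneg hε.1, mul_assoc]
    have h₁ := hL y hy x hx
    have h₂ : ε ^ k ≤ ε₀ ^ k := pow_le_pow_left₀ hε.1 hε.2 k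
    exact mul_le_mul h₂ h₁ (abs_nonneg _) ((pow_nonneg hε.1 k).trans h₂)

/-! ### Local and global errors -/

section

variable {X : ℝ → E → E} {φ : ℝ → ℝ → E → E} {p : Polynomial (OppositeOperators U)}
  {G : FormalSeries (OppositeOperators U)} {N : ℕ} {M : Set (ℕ × ℕ)} {e : ℝ → ℝ → ℝ} {ε₀ : ℝ}

/-- The error `e` dominates, in the local error, all the monomials of `M`. -/
def Dominates (M : Set (ℕ × ℕ)) (e : ℝ → ℝ → ℝ) (ε₀ : ℝ) : Prop :=
  ∀ i k, (i, k) ∈ M → ∃ C, ∀ ε ∈ Icc 0 ε₀, ∀ h, 0 < h → h ≤ 1 → h ^ i * ε ^ k ≤ C * (h * e ε h)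

theorem Dominates.isBigO (he : Dominates M e ε₀) (K : Set E) {i k : ℕ} (hik : (i, k) ∈ M) :
    (fun z : ℝ × ℝ × E => z.1 ^ i * z.2.1 ^ k) =O[stepFilter ε₀ K]
      fun z => z.1 * e z.2.1 z.1 := by
  obtain ⟨C, hC⟩ := he i k hik
  refine isBigO_of_bound_on (C := |C|) fun h hh hh' ε hε x _ => ?_
  have h₀ : 0 ≤ h ^ i * ε ^ k := mul_nonneg (pow_nonneg hh.le i) (pow_nonneg hε.1 k)
  rw [Real.norm_of_nonneg h₀, Real.norm_eq_abs, ← abs_mul]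
  exact (hC ε hε h hh hh').trans (le_abs_self _)

theorem Dominates.isBigO_value (he : Dominates M e ε₀) {K : Set E} (hK : IsCompact K)
    (hKU : K ⊆ U) {D : FormalSeries (OppositeOperators U)} (hD : SupportedIn M D) (i : ℕ)
    (F : smoothFun U) :
    (fun z : ℝ × ℝ × E => z.1 ^ i * value (PowerSeries.coeff i D) F z) =O[stepFilter ε₀ K]
      fun z => z.1 * e z.2.1 z.1 := by
  have h : ∀ k ∈ (PowerSeries.coeff i D).support, (fun z : ℝ × ℝ × E =>
      z.1 ^ i * z.2.1 ^ k * extendZero (((PowerSeries.coeff i D).coeff k).toEnd F) z.2.2)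
        =O[stepFilter ε₀ K] fun z => z.1 * e z.2.1 z.1 := by
    intro k hk
    have h₁ := (he.isBigO K (hD i k (Polynomial.mem_support_iff.1 hk))).mul
      (isBigO_extendZero (ε₀ := ε₀) hK hKU (((PowerSeries.coeff i D).coeff k).toEnd F))
    simpa only [mul_one] using h₁
  refine (IsBigO.fun_sum h).congr_left fun z => ?_
  conv_rhs => rw [(PowerSeries.coeff i D).as_sum_support, value_sum, Finset.mul_sum]
  refine Finset.sum_congr rfl fun k _ => ?_
  rw [value_monomial, mul_assoc]

/-- Replacing `G` by `G'` costs monomials of `M`, which `e` dominates; the truncation remainder `h ^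
(N + 1)` is absorbed because it belongs to `M` itself. -/
theorem Represents.isBigO_local_error (hφ : Represents N ε₀ φ G)
    {G' : FormalSeries (OppositeOperators U)} (hG : SupportedIn M (G - G'))
    (he : Dominates M e ε₀) (hN : (N + 1, 0) ∈ M) {K : Set E} (hK : IsCompact K) (hKU : K ⊆ U)
    (F : smoothFun U) :
    (fun z : ℝ × ℝ × E => extendZero F (φ z.2.1 z.1 z.2.2) -
      ∑ i ∈ Finset.range (N + 1), z.1 ^ i * value (PowerSeries.coeff i G') F z)
        =O[stepFilter ε₀ K] fun z => z.1 * e z.2.1 z.1 := by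
  have h₁ := ((hφ K hK hKU).2 F).trans (by simpa using he.isBigO K hN)
  have h₂ : (fun z : ℝ × ℝ × E => ∑ i ∈ Finset.range (N + 1),
      z.1 ^ i * value (PowerSeries.coeff i (G - G')) F z)
        =O[stepFilter ε₀ K] fun z => z.1 * e z.2.1 z.1 :=
    IsBigO.fun_sum fun i _ => he.isBigO_value hK hKU hG i F
  refine (h₁.add h₂).congr_left fun z => ?_
  simp only [map_sub, value_sub, mul_sub, Finset.sum_sub_distrib]
  ring

theorem abs_solution_sub_sum_le (hX : ∀ ε, IsLieDerivative (X ε) (evalAt ε p).toEnd) (N : ℕ)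
    (ε₀ : ℝ) {K : Set E} (hK : IsCompact K) (hKU : K ⊆ U) (F : smoothFun U) :
    ∃ C, ∀ ε ∈ Icc 0 ε₀, ∀ (T : ℝ) (γ : ℝ → E), IsSolution U (X ε) γ (Icc 0 T) →
      (∀ t ∈ Icc 0 T, γ t ∈ K) → ∀ t h, 0 ≤ t → 0 < h → t + h ≤ T →
      |extendZero F (γ (t + h)) - ∑ i ∈ Finset.range (N + 1), h ^ i *
        value (PowerSeries.coeff i (FormalSeries.exp (PowerSeries.monomial 1 p))) F (h, ε, γ t)| ≤
          C * h ^ (N + 1) := by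
  have hval : ∀ (i : ℕ) (z : ℝ × ℝ × E),
      value (p ^ i) F z = extendZero (((evalAt z.2.1 p).toEnd ^ i) F) z.2.2 := by
    intro i z
    rw [value, applyAt, map_pow, toEnd_pow]
  obtain ⟨C, hC⟩ := exists_abs_value_le ε₀ hK hKU (p ^ (N + 1)) F
  refine ⟨C, fun ε hε T γ hγ hγK t h ht hh hth => ?_⟩
  have h₁ := (hX ε).abs_sub_sum_le (convex_Icc 0 T) hγ (t₀ := t) ⟨ht, by linarith⟩ (N + 1) F
    (C := C) (fun s hs => by
      have := hC ε hε _ (hγK s hs) 0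
      rwa [hval] at this) (t := t + h) ⟨by linarith, hth⟩
  rw [add_sub_cancel_left, abs_of_pos hh] at h₁
  refine le_of_eq_of_le ?_ h₁
  congr 2
  refine Finset.sum_congr rfl fun i _ => ?_
  rw [coeff_exp_monomial, value_smul, hval]

/-- The propagation of the error in one step, measured by a function `F`. -/
theorem Represents.exists_step_le (hX : ∀ ε, IsLieDerivative (X ε) (evalAt ε p).toEnd)
    (hφ : Represents N ε₀ φ G)
    (hG : SupportedIn M (G - FormalSeries.exp (PowerSeries.monomial 1 p)))
    (he : Dominates M e ε₀) (he₀ : ∀ ε h, 0 ≤ ε → 0 < h → 0 ≤ e ε h) (hN : (N + 1, 0) ∈ M)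
    {K : Set E} {δ : ℝ} (hK : IsCompact (cthickening δ K))
    (hKU : cthickening δ K ⊆ U) (F : smoothFun U) :
    ∃ C ≥ 0, ∃ L ≥ 0, ∀ᶠ h in 𝓝[>] (0 : ℝ), ∀ ε ∈ Icc 0 ε₀, ∀ (T : ℝ) (γ : ℝ → E),
      IsSolution U (X ε) γ (Icc 0 T) → (∀ t ∈ Icc 0 T, γ t ∈ K) → ∀ t, 0 ≤ t → t + h ≤ T →
      ∀ x ∈ closedBall (γ t) δ, |extendZero F (φ ε h x) - extendZero F (γ (t + h))| ≤
        |extendZero F x - extendZero F (γ t)| + L * h * ‖x - γ t‖ + C * (h * e ε h) := by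
  set f : FormalSeries (OppositeOperators U) := FormalSeries.exp (PowerSeries.monomial 1 p) with hf
  obtain ⟨C₁, hC₁⟩ := (hφ.isBigO_local_error hG he hN hK hKU F).bound
  obtain ⟨h₀, hpos, H⟩ := eventually_stepFilter.1 hC₁
  have hKδ : K ⊆ cthickening δ K := self_subset_cthickening K
  obtain ⟨C₂, hC₂⟩ := abs_solution_sub_sum_le hX N ε₀ hK hKU F
  obtain ⟨C₃, hC₃⟩ := he _ _ hN
  choose L hL using fun i => exists_lipschitz_value ε₀ hK hKU (PowerSeries.coeff i f) F
  refine ⟨|C₁| + |C₂| * |C₃|, by positivity, ∑ i ∈ Finset.range N, |L (i + 1)|,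
    Finset.sum_nonneg fun _ _ => abs_nonneg _, ?_⟩
  have hsmall : ∀ᶠ h in 𝓝[>] (0 : ℝ), h ∈ Ioc 0 (min h₀ 1) :=
    Ioc_mem_nhdsGT (lt_min hpos one_pos)
  filter_upwards [hsmall] with h hh ε hε T γ hγ hγK t ht hth x hx
  have hh0 := hh.1
  have hh1 : h ≤ 1 := hh.2.trans (min_le_right _ _)
  have hy : γ t ∈ K := hγK t ⟨ht, by linarith⟩
  have hxK : x ∈ cthickening δ K := closedBall_subset_cthickening hy δ hx
  have hhe : 0 ≤ h * e ε h := mul_nonneg hh0.le (he₀ ε h hε.1 hh0)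
  have b₁ := H h hh0 (hh.2.trans (min_le_left _ _)) ε hε x hxK
  have b₂ := hC₂ ε hε T γ hγ (fun s hs => hKδ (hγK s hs)) t h ht hh0 hth
  have b₃ := hC₃ ε hε h hh0 hh1
  rw [pow_zero, mul_one] at b₃
  rw [Real.norm_eq_abs, Real.norm_of_nonneg hhe] at b₁
  have b₁' := b₁.trans (mul_le_mul_of_nonneg_right (le_abs_self C₁) hhe)
  have b₂' : C₂ * h ^ (N + 1) ≤ |C₂| * |C₃| * (h * e ε h) := by
    rw [mul_assoc]
    refine mul_le_mul (le_abs_self _) (b₃.trans ?_) (by positivity) (abs_nonneg _)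
    exact mul_le_mul_of_nonneg_right (le_abs_self _) hhe
  have b₄ : |∑ i ∈ Finset.range (N + 1), h ^ i * value (PowerSeries.coeff i f) F (h, ε, x) -
      ∑ i ∈ Finset.range (N + 1), h ^ i * value (PowerSeries.coeff i f) F (h, ε, γ t)| ≤
      |extendZero F x - extendZero F (γ t)| +
        (∑ i ∈ Finset.range N, |L (i + 1)|) * h * ‖x - γ t‖ := by
    -- The term of degree zero is the old difference with factor exactly one; every other term
    -- carries an `h` and a Lipschitz constant. A growth factor `1 + O(h)` per step is what survives
    -- `n` steps.
    rw [← Finset.sum_sub_distrib, Finset.sum_range_succ', add_comm]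
    refine (abs_add_le _ _).trans (add_le_add ?_ ?_)
    · rw [hf, coeff_zero_exp, value_one, value_one, pow_zero, one_mul, one_mul]
    · rw [Finset.sum_mul, Finset.sum_mul]
      refine (Finset.abs_sum_le_sum_abs _ _).trans (Finset.sum_le_sum fun i _ => ?_)
      rw [← mul_sub, abs_mul, abs_of_nonneg (by positivity), mul_comm |L (i + 1)|, mul_assoc]
      refine mul_le_mul (pow_le_of_le_one hh0.le hh1 (by omega)) ?_ (abs_nonneg _) hh0.le
      refine (hL (i + 1) ε hε _ hy x hx h h).trans ?_
      exact mul_le_mul_of_nonneg_right (le_abs_self _) (norm_nonneg _)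
  rw [abs_le] at *
  constructor <;> linarith [b₁'.1, b₁'.2, b₂.1, b₂.2, b₄.1, b₄.2]

/-- The expansions control smooth functions of the state; linear coordinates are such functions, and
together they dominate the norm. -/
theorem exists_coordinates [FiniteDimensional ℝ E] :
    ∃ (d : ℕ) (ℓ : Fin d → E →L[ℝ] ℝ) (c : ℝ), 0 ≤ c ∧ ∀ v, ‖v‖ ≤ c * ∑ j, |ℓ j v| := by
  let b := Module.finBasis ℝ E
  refine ⟨_, fun j => LinearMap.toContinuousLinearMap (b.coord j), ∑ j, ‖b j‖,
    Finset.sum_nonneg fun _ _ => norm_nonneg _, fun v => ?_⟩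
  conv_lhs => rw [← b.sum_repr v]
  refine (norm_sum_le _ _).trans ?_
  rw [Finset.mul_sum]
  refine Finset.sum_le_sum fun j _ => ?_
  rw [norm_smul, mul_comm, Real.norm_eq_abs]
  refine mul_le_mul_of_nonneg_right ?_ (abs_nonneg _)
  exact Finset.single_le_sum (f := fun j => ‖b j‖) (fun _ _ => norm_nonneg _) (Finset.mem_univ j)

/-- Local errors of size `h * e` accumulate over at most `T / h` steps and are amplified at most
exponentially in `T`. The step estimate holds only in a tube around the solution; the induction
itself keeps the iterates there, because `e = O(h)`. -/
theorem hasGlobalError_of_represents [FiniteDimensional ℝ E]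
    (hX : ∀ ε, IsLieDerivative (X ε) (evalAt ε p).toEnd) (hφ : ∀ ε₀, Represents N ε₀ φ G)
    (hG : SupportedIn M (G - FormalSeries.exp (PowerSeries.monomial 1 p)))
    (he : ∀ ε₀, Dominates M e ε₀) (he₀ : ∀ ε h, 0 ≤ ε → 0 < h → 0 ≤ e ε h)
    (he₁ : ∀ ε₀, ∃ C, ∀ ε ∈ Icc 0 ε₀, ∀ h, 0 < h → h ≤ 1 → e ε h ≤ C * h)
    (hN : (N + 1, 0) ∈ M) : HasGlobalError U X φ univ e := by
  have := FiniteDimensional.proper_real E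
  intro K hK hKU T ε₀
  obtain ⟨δ, hδ, hδU⟩ := hK.exists_cthickening_subset_open U.isOpen hKU
  have hK' : IsCompact (cthickening δ K) := hK.cthickening
  obtain ⟨d, ℓ, c, hc, hℓ⟩ := exists_coordinates (E := E)
  let F : Fin d → smoothFun U := fun j =>
    ⟨fun x : U => ℓ j x, mem_smoothFun (F := ℓ j) (ℓ j).contDiff.contDiffOn⟩
  have hF : ∀ j, ∀ x ∈ U, extendZero (F j) x = ℓ j x := fun j x hx =>
    extendZero_mk (ℓ j).contDiff.contDiffOn hx
  choose C hC₀ L hL₀ hstep using fun j => (hφ ε₀).exists_step_le hX hG (he ε₀) he₀ hN hK' hδU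
    (F j)
  obtain ⟨⟨K'', -, hKU'', hmap⟩, -⟩ := hφ ε₀ _ hK' hδU
  obtain ⟨h₁, hh₁, hmem⟩ := eventually_stepFilter.1 (eventually_of_tendsto hmap)
  obtain ⟨h₂, hh₂, hstep⟩ := mem_nhdsGT_iff_exists_Ioc_subset.1 (eventually_all.2 hstep)
  obtain ⟨C₁, hC₁⟩ := he₁ ε₀
  set Λ := (∑ j, L j) * c with hΛ
  set C' := ∑ j, C j with hC'
  have hΛ₀ : 0 ≤ Λ := mul_nonneg (Finset.sum_nonneg fun j _ => hL₀ j) hc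
  have hC'₀ : 0 ≤ C' := Finset.sum_nonneg fun j _ => hC₀ j
  -- The final error constant. It does not depend on `h`, so the step bound `δ / (B * |C₁| + 1)`
  -- chosen below can enforce `B * e ε h ≤ δ`.
  set B := c * (C' * |T| * Real.exp (Λ * |T|)) with hB
  have hB₀ : 0 ≤ B := by positivity
  refine ⟨B + 1, by positivity, min (min h₁ h₂) (min 1 (δ / (B * |C₁| + 1))), by
    have : 0 < h₂ := hh₂
    positivity, ?_⟩
  intro ε h _ hε hε₀ hh hh' γ hγ hγK
  have l₁ : h ≤ h₁ := hh'.trans ((min_le_left _ _).trans (min_le_left _ _))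
  have l₂ : h ≤ h₂ := hh'.trans ((min_le_left _ _).trans (min_le_right _ _))
  have l₃ : h ≤ 1 := hh'.trans ((min_le_right _ _).trans (min_le_left _ _))
  have l₄ : h ≤ δ / (B * |C₁| + 1) := hh'.trans ((min_le_right _ _).trans (min_le_right _ _))
  have hε' : ε ∈ Icc 0 ε₀ := ⟨hε, hε₀⟩
  have hee := he₀ ε h hε hh
  have heδ : B * e ε h ≤ δ := by
    rw [le_div_iff₀ (by positivity)] at l₄
    have : e ε h ≤ |C₁| * h :=
      (hC₁ ε hε' h hh l₃).trans (mul_le_mul_of_nonneg_right (le_abs_self _) hh.le)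
    nlinarith
  have hstep' := hstep ⟨hh, l₂⟩
  set x : ℕ → E := fun n => (φ ε h)^[n] (γ 0) with hx
  have key : ∀ n : ℕ, n * h ≤ T →
      ∑ j, |ℓ j (x n - γ (n * h))| ≤ C' * (n * h) * e ε h * Real.exp (Λ * (n * h)) := by
    intro n
    induction n with
    | zero => intro _; simp [hx]
    | succ n ih =>
      intro hn
      have ht : (0 : ℝ) ≤ n * h := by positivity
      have hnh : n * h + h ≤ T := by push_cast at hn; linarith
      have hT : 0 ≤ T := by linarith
      have ih := ih (by linarith)
      have hyK : γ (n * h) ∈ K := hγK _ ⟨ht, by linarith⟩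
      have hdist : ‖x n - γ (n * h)‖ ≤ c * ∑ j, |ℓ j (x n - γ (n * h))| := hℓ _
      -- The bootstrap: the bound already proved after `n` steps places the iterate in the tube,
      -- where the next step may be estimated.
      have hball : x n ∈ closedBall (γ (n * h)) δ := by
        rw [mem_closedBall_iff_norm]
        refine hdist.trans ((mul_le_mul_of_nonneg_left ih hc).trans (le_trans ?_ heδ))
        have : (n * h : ℝ) ≤ |T| := (by linarith : (n * h : ℝ) ≤ T).trans (le_abs_self T)
        calc c * (C' * (n * h) * e ε h * Real.exp (Λ * (n * h)))
            ≤ c * (C' * |T| * e ε h * Real.exp (Λ * |T|)) := by gcongr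
          _ = B * e ε h := by rw [hB]; ring
      have hxK : x n ∈ cthickening δ K := closedBall_subset_cthickening hyK δ hball
      have hxU : x (n + 1) ∈ U := by
        simp only [hx, Function.iterate_succ_apply']
        exact hKU'' (hmem h hh l₁ ε hε' _ hxK)
      have hyU : γ (n * h + h) ∈ U := hKU (hγK _ ⟨by linarith, hnh⟩)
      have hj : ∀ j, |ℓ j (x (n + 1) - γ (n * h + h))| ≤
          |ℓ j (x n - γ (n * h))| + L j * h * ‖x n - γ (n * h)‖ + C j * (h * e ε h) := by
        intro j
        have := hstep' j ε hε' T γ hγ hγK (n * h) ht hnh (x n) hball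
        have hxs : φ ε h (x n) = x (n + 1) := by
          simp only [hx, Function.iterate_succ_apply']
        rw [hxs, hF j _ hxU, hF j _ hyU, hF j _ (hδU hxK), hF j _ (hKU hyK)] at this
        rwa [map_sub, map_sub]
      have hcast : ((n + 1 : ℕ) : ℝ) * h = n * h + h := by push_cast; ring
      rw [hcast]
      set S := ∑ j, |ℓ j (x n - γ (n * h))| with hS
      have hS₀ : 0 ≤ S := Finset.sum_nonneg fun _ _ => abs_nonneg _
      have hLs : 0 ≤ ∑ j, L j := Finset.sum_nonneg fun j _ => hL₀ j
      calc ∑ j, |ℓ j (x (n + 1) - γ (n * h + h))|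
          ≤ ∑ j, (|ℓ j (x n - γ (n * h))| + L j * h * ‖x n - γ (n * h)‖ + C j * (h * e ε h)) :=
            Finset.sum_le_sum fun j _ => hj j
        _ = S + (∑ j, L j) * h * ‖x n - γ (n * h)‖ + C' * (h * e ε h) := by
            rw [Finset.sum_add_distrib, Finset.sum_add_distrib, Finset.sum_mul, Finset.sum_mul,
              hC', Finset.sum_mul]
        _ ≤ S + (∑ j, L j) * h * (c * S) + C' * (h * e ε h) := by gcongr
        _ = (Λ * h + 1) * S + C' * (h * e ε h) := by rw [hΛ]; ring
        _ ≤ Real.exp (Λ * h) * (C' * (n * h) * e ε h * Real.exp (Λ * (n * h))) +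
            C' * (h * e ε h) * Real.exp (Λ * (n * h + h)) := by
            refine add_le_add (mul_le_mul (Real.add_one_le_exp _) ih hS₀ (Real.exp_nonneg _)) ?_
            exact le_mul_of_one_le_right (by positivity) (Real.one_le_exp (by positivity))
        _ = C' * (n * h + h) * e ε h * Real.exp (Λ * (n * h + h)) := by
            rw [mul_add Λ, Real.exp_add]; ring
  intro n hn
  have ht : (0 : ℝ) ≤ n * h := by positivity
  have hT : (n * h : ℝ) ≤ |T| := hn.trans (le_abs_self T)
  calc ‖(φ ε h)^[n] (γ 0) - γ (n * h)‖ ≤ c * ∑ j, |ℓ j (x n - γ (n * h))| := hℓ _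
    _ ≤ c * (C' * (n * h) * e ε h * Real.exp (Λ * (n * h))) :=
        mul_le_mul_of_nonneg_left (key n hn) hc
    _ ≤ c * (C' * |T| * e ε h * Real.exp (Λ * |T|)) := by gcongr
    _ = B * e ε h := by rw [hB]; ring
    _ ≤ (B + 1) * e ε h := by linarith

end

end GlobalError

end

noncomputable section

namespace FormalSeries

open PowerSeries

/-! ### Orders of the methods used -/

section

variable {𝒜 : Type*} [Ring 𝒜] [Algebra ℝ 𝒜]

theorem coeff_exp_smul_monomial (c : ℝ) (p : Polynomial 𝒜) (n : ℕ) :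
    coeff n (exp (c • (PowerSeries.monomial 1 p : FormalSeries 𝒜))) =
      (c ^ n * (Nat.factorial n : ℝ)⁻¹) • p ^ n := by
  have h : c • (PowerSeries.monomial 1 p : FormalSeries 𝒜) = PowerSeries.monomial 1 (c • p) := by
    ext1 n
    rw [PowerSeries.coeff_smul, PowerSeries.coeff_monomial, PowerSeries.coeff_monomial]
    split_ifs <;> simp
  rw [h, coeff_exp_monomial, smul_pow, smul_smul, mul_comm]

theorem list_prod_exp_smul {f : FormalSeries 𝒜} (hf : coeff 0 f = 0) (l : List ℝ) :
    (l.map fun c => exp (c • f)).prod = exp (l.sum • f) := by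
  induction l with
  | nil => simp [exp_zero]
  | cons c l ih =>
    rw [List.map_cons, List.prod_cons, ih, List.sum_cons, add_smul,
      exp_add_of_commute (coeff_zero_smul _ hf) (coeff_zero_smul _ hf)]
    exact ((Commute.refl f).smul_left c).smul_right _

/-- Without the terms in `ε`, a consistent method is exact. -/
theorem supportedIn_pos_compProd_sub_exp {C : CompMethod} (hC : (C.map Prod.fst).sum = 1)
    (x y : 𝒜) : SupportedIn {p | 1 ≤ p.2}
      (compProd C (monomial₂ 1 0 x) (monomial₂ 1 1 y) -
        exp (monomial₂ 1 0 x + monomial₂ 1 1 y)) := by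
  have hM : IsUpperSet {p : ℕ × ℕ | 1 ≤ p.2} := fun p q hpq hp => le_trans hp hpq.2
  have hx := coeff_zero_monomial₂ one_ne_zero 0 x
  have hy := coeff_zero_monomial₂ one_ne_zero 1 y
  have hys : SupportedIn {p : ℕ × ℕ | 1 ≤ p.2} (monomial₂ 1 1 y) :=
    supportedIn_monomial₂ (by simp) y
  -- Both the product and the exponential reduce to `exp (h x)` once all terms with `ε` are
  -- discarded.
  refine SupportedIn.trans_sub (b := exp (monomial₂ 1 0 x)) ?_ ?_
  · have h := list_prod_exp_smul hx (C.map Prod.fst)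
    rw [hC, one_smul, List.map_map] at h
    rw [← h, compProd]
    refine SupportedIn.list_prod_sub hM _ _ _ fun ab _ => ?_
    rw [Function.comp_apply, ← mul_one (exp (ab.1 • monomial₂ 1 0 x)), mul_assoc, one_mul]
    refine SupportedIn.mul_sub_mul hM (by simpa using SupportedIn.zero) ?_
    rw [← exp_zero]
    refine SupportedIn.exp_sub hM (coeff_zero_smul _ hy) (map_zero _) ?_
    rw [sub_zero]
    exact hys.smul _
  · refine SupportedIn.exp_sub hM hx (coeff_zero_add hx hy) ?_
    rw [sub_add_cancel_left, ← zero_sub]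
    exact SupportedIn.zero.sub hys

theorem supportedIn_of_coeff_eq_zero {f : FormalSeries 𝒜} {n : ℕ} (h : ∀ i < n, coeff i f = 0) :
    SupportedIn {p | n ≤ p.1} f := by
  rw [SupportedIn.iff_of_notMem]
  intro i k hik
  rw [coeff₂, h i (by simpa using hik), Polynomial.coeff_zero]

end

/-- The coefficients of the product of exponentials of the Verlet method. -/
theorem coeff_exp_verlet {𝒜 : Type*} [Ring 𝒜] [Algebra ℝ 𝒜] (a b : Polynomial 𝒜) :
    ∃ y : Polynomial 𝒜, ∀ γ : ℝ,
      let F := exp ((γ * (1 / 2)) • (PowerSeries.monomial 1 a : FormalSeries 𝒜)) *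
        (exp ((γ * 1) • (PowerSeries.monomial 1 b : FormalSeries 𝒜)) *
          exp ((γ * (1 / 2)) • (PowerSeries.monomial 1 a : FormalSeries 𝒜)))
      coeff 0 F = 1 ∧ coeff 1 F = γ • (a + b) ∧
        coeff 2 F = (γ ^ 2 / 2) • ((a + b) * (a + b)) ∧
        coeff 3 F = (γ ^ 3 / 6) • ((a + b) * ((a + b) * (a + b))) + γ ^ 3 • y ∧
        coeff 4 F = (γ ^ 4 / 24) • ((a + b) * ((a + b) * ((a + b) * (a + b)))) +
          (γ ^ 4 / 2) • ((a + b) * y + y * (a + b)) := by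
  -- The witness is the cubic term `[b, [b, a]] / 12 - [a, [a, b]] / 24` of the logarithm. By time
  -- symmetry the logarithm has no terms of degree two and four, so degree four involves only `a +
  -- b` and `y`.
  refine ⟨(1 / 12 : ℝ) • (a * (b * a) + a * (b * b) + b * (b * a)) -
    (1 / 24 : ℝ) • (a * (a * b) + b * (a * a)) - (1 / 6 : ℝ) • (b * (a * b)), ?_⟩
  intro γ
  simp only [PowerSeries.coeff_mul, coeff_exp_smul_monomial, Finset.Nat.antidiagonal_succ,
    Finset.Nat.antidiagonal_zero, Finset.sum_cons, Finset.map_cons,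
    Finset.map_singleton, Finset.sum_singleton, Function.Embedding.coe_prodMap,
    Function.Embedding.coeFn_mk, Prod.map, Nat.factorial, Function.Embedding.refl_apply]
  simp only [pow_succ, pow_zero, one_mul, mul_one, mul_add, add_mul, smul_mul_assoc,
    mul_smul_comm, smul_smul, mul_assoc, smul_add, mul_sub, sub_mul, smul_sub]
  refine ⟨?_, ?_, ?_, ?_, ?_⟩
  · match_scalars; norm_num
  · match_scalars <;> ring
  · match_scalars <;> ring
  · match_scalars <;> ring
  · match_scalars <;> ring

/-- The jump of Suzuki and Yoshida raises the order of the Verlet method to four. -/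
theorem coeff_triJump {R : Type*} [Ring R] [Algebra ℝ R] {x y : R} {γ₁ γ₂ : ℝ}
    (h₁ : 2 * γ₁ + γ₂ = 1) (h₃ : 2 * γ₁ ^ 3 + γ₂ ^ 3 = 0) (F : ℝ → PowerSeries R)
    (hF : ∀ γ, coeff 0 (F γ) = 1 ∧ coeff 1 (F γ) = γ • x ∧ coeff 2 (F γ) = (γ ^ 2 / 2) • (x * x) ∧
      coeff 3 (F γ) = (γ ^ 3 / 6) • (x * (x * x)) + γ ^ 3 • y ∧
      coeff 4 (F γ) = (γ ^ 4 / 24) • (x * (x * (x * x))) + (γ ^ 4 / 2) • (x * y + y * x)) {n : ℕ}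
    (hn : n < 5) :
    coeff n (F γ₁ * (F γ₂ * F γ₁)) = ((Nat.factorial n : ℝ)⁻¹) • x ^ n := by
  have hγ : γ₂ = 1 - 2 * γ₁ := by linarith
  -- The cubic condition after eliminating `γ₂`. It cancels `y` in degree three, and half of it
  -- cancels `x * y` and `y * x` in degree four.
  have g : 2 * γ₁ ^ 3 + (1 - 2 * γ₁) ^ 3 = 0 := hγ ▸ h₃
  interval_cases n <;>
  simp only [PowerSeries.coeff_mul, Finset.Nat.antidiagonal_succ,
    Finset.Nat.antidiagonal_zero, Finset.sum_cons, Finset.map_cons,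
    Finset.map_singleton, Finset.sum_singleton, Function.Embedding.coe_prodMap,
    Function.Embedding.coeFn_mk, Prod.map, Nat.factorial, Function.Embedding.refl_apply, hF,
    Nat.succ_eq_add_one, Nat.reduceAdd, zero_add] <;>
  simp only [pow_succ x, pow_zero x, one_mul, mul_one, mul_add, add_mul, smul_mul_assoc,
    mul_smul_comm, smul_smul, mul_assoc, smul_add, hγ]
  · match_scalars; norm_num
  · match_scalars; ring
  · match_scalars; ring
  · match_scalars
    · ring
    · linear_combination g
  · match_scalars
    · ring
    · linear_combination g / 2
    · linear_combination g / 2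

end FormalSeries
end

noncomputable section

namespace FormalSeries

open PowerSeries

section

variable {𝒜 : Type*} [Ring 𝒜] [Algebra ℝ 𝒜]

theorem coeff_exp_add_monomial₂ (x y : 𝒜) (n : ℕ) :
    coeff n (exp (monomial₂ 1 0 x + monomial₂ 1 1 y)) =
      ((Nat.factorial n : ℝ)⁻¹) • (Polynomial.monomial 0 x + Polynomial.monomial 1 y) ^ n := by
  rw [monomial₂, monomial₂, ← map_add, coeff_exp_monomial]

theorem compProd_verlet_scale (γ : ℝ) (f g : FormalSeries 𝒜) :
    compProd (methodVerlet.scale γ) f g =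
      exp ((γ * (1 / 2)) • f) * (exp ((γ * 1) • g) * exp ((γ * (1 / 2)) • f)) := by
  simp [compProd, methodVerlet, CompMethod.scale, exp_zero, mul_assoc]

theorem scale_one (C : CompMethod) : C.scale 1 = C := by
  simp [CompMethod.scale]

theorem coeff_verlet_sub_exp (x y : 𝒜) {n : ℕ} (hn : n < 3) :
    coeff n (compProd methodVerlet (monomial₂ 1 0 x) (monomial₂ 1 1 y) -
      exp (monomial₂ 1 0 x + monomial₂ 1 1 y)) = 0 := by
  obtain ⟨_, h⟩ := coeff_exp_verlet (Polynomial.monomial 0 x) (Polynomial.monomial 1 y)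
  obtain ⟨h₀, h₁, h₂, -, -⟩ := h 1
  rw [map_sub, sub_eq_zero, coeff_exp_add_monomial₂, ← scale_one methodVerlet,
    compProd_verlet_scale]
  interval_cases n
  · refine h₀.trans ?_
    simp
  · refine h₁.trans ?_
    simp
  · refine h₂.trans ?_
    rw [one_pow, one_div, pow_two]
    rfl

end

theorem hasOrder_verlet : methodVerlet.HasOrder [2] := by
  refine ⟨⟨0, by simp, by simp⟩, ?_⟩
  intro A εB
  refine isOfOrder_iff.2 (SupportedIn.mono ?_ (supportedIn_of_coeff_eq_zero (n := 3)
    fun n hn => coeff_verlet_sub_exp _ _ hn))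
  rintro ⟨i, k⟩ h
  exact mem_orderSet_singleton.2 ⟨two_ne_zero, h⟩

/-- The coefficients are those of the Verlet method, but this order records more: the error also
contains `ε`, since without `B` the two half steps compose to the exact flow. -/
theorem hasOrder_ABA22 : methodABA22.HasOrder [0, 2] := by
  refine ⟨⟨1, by simp, by simp⟩, ?_⟩
  intro A εB i k h
  have h₁ := supportedIn_of_coeff_eq_zero (n := 3) (𝒜 := FreeAlgebra ℝ (Fin 2)) (fun n hn => coeff_verlet_sub_exp
    (FreeAlgebra.ι ℝ (0 : Fin 2)) (FreeAlgebra.ι ℝ (1 : Fin 2)) hn) i k h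
  have h₂ := supportedIn_pos_compProd_sub_exp (C := methodABA22)
    (by norm_num [methodABA22]) _ _ i k h
  exact ⟨1, h₂, by simp, h₁⟩

theorem hasOrder_euler : methodEuler.HasOrder [1] := by
  refine ⟨⟨0, by simp, by simp⟩, ?_⟩
  intro A εB
  refine isOfOrder_iff.2 (SupportedIn.mono ?_
    (supportedIn_of_coeff_eq_zero (𝒜 := FreeAlgebra ℝ (Fin 2)) (n := 2) fun n hn => ?_))
  rotate_left
  · rw [map_sub, sub_eq_zero, coeff_exp_add_monomial₂]
    have h : compProd methodEuler A εB = exp ((1 : ℝ) • A) * exp ((1 : ℝ) • εB) := by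
      simp [compProd, methodEuler]
    rw [h, PowerSeries.coeff_mul]
    simp only [A, εB, monomial₂, coeff_exp_smul_monomial]
    interval_cases n <;> simp [Finset.Nat.antidiagonal_succ, add_comm]
  · rintro ⟨i, k⟩ h
    exact mem_orderSet_singleton.2 ⟨one_ne_zero, h⟩

theorem compProd_append {𝒜 : Type*} [Ring 𝒜] [Algebra ℝ 𝒜] (C C' : CompMethod)
    (f g : FormalSeries 𝒜) : compProd (C ++ C') f g = compProd C f g * compProd C' f g := by
  simp [compProd]

theorem hasOrder_triJump : methodTriJump.HasOrder [4] := by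
  refine ⟨⟨0, by simp, by simp⟩, ?_⟩
  intro A εB
  refine isOfOrder_iff.2 (SupportedIn.mono ?_
    (supportedIn_of_coeff_eq_zero (𝒜 := FreeAlgebra ℝ (Fin 2)) (n := 5) fun n hn => ?_))
  rotate_left
  · set w : ℝ := (2 : ℝ) ^ (1 / 3 : ℝ) with hw
    have hw3 : w ^ 3 = 2 := by
      rw [hw, ← Real.rpow_natCast, ← Real.rpow_mul (by norm_num)]
      norm_num
    have hw2 : 2 - w ≠ 0 := by
      intro h
      rw [show w = 2 by linarith] at hw3
      norm_num at hw3
    obtain ⟨y, hy⟩ := coeff_exp_verlet (Polynomial.monomial 0 (FreeAlgebra.ι ℝ (0 : Fin 2)))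
      (Polynomial.monomial 1 (FreeAlgebra.ι ℝ (1 : Fin 2)))
    -- Here `γ₂ = -w / (2 - w)`, so the cubic condition amounts to `w ^ 3 = 2`.
    have h := coeff_triJump (γ₁ := 1 / (2 - w)) (γ₂ := 1 - 2 * (1 / (2 - w))) (by ring)
      (by field_simp; linear_combination -hw3) _ hy hn
    rw [map_sub, sub_eq_zero, coeff_exp_add_monomial₂, ← h]
    simp only [methodTriJump, ← hw, List.flatMap_cons, List.flatMap_nil, List.append_nil,
      compProd_append, compProd_verlet_scale, A, εB, monomial₂]
  · rintro ⟨i, k⟩ h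
    exact mem_orderSet_singleton.2 ⟨four_ne_zero, h⟩

/-- The terms linear in `b` form a quadrature rule on the unit interval with weights `1 / 2` at the
points `(3 - s) / 6` and `(3 + s) / 6`. For `s * s = 3` these are the two Gauss nodes, exact up to
cubic polynomials, so all deviations through degree four contain at least two factors `b`. -/
theorem coeff_exp_ABA42 {𝒜 : Type*} [Ring 𝒜] [Algebra ℝ 𝒜] (a b : Polynomial 𝒜) {s : ℝ}
    (hs : s * s = 3) :
    let F := exp (((3 - s) / 6) • (PowerSeries.monomial 1 a : FormalSeries 𝒜)) *
      (exp ((1 / 2 : ℝ) • (PowerSeries.monomial 1 b : FormalSeries 𝒜)) *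
        (exp ((s / 3) • (PowerSeries.monomial 1 a : FormalSeries 𝒜)) *
          (exp ((1 / 2 : ℝ) • (PowerSeries.monomial 1 b : FormalSeries 𝒜)) *
            exp (((3 - s) / 6) • (PowerSeries.monomial 1 a : FormalSeries 𝒜)))))
    coeff 0 F = 1 ∧ coeff 1 F = a + b ∧ coeff 2 F = (1 / 2 : ℝ) • ((a + b) * (a + b)) ∧
      coeff 3 F = (1 / 6 : ℝ) • ((a + b) * ((a + b) * (a + b))) +
        (1 / 12 - s / 24) • (a * (b * b) - (2 : ℝ) • (b * (a * b)) + b * (b * a)) ∧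
      coeff 4 F = (1 / 24 : ℝ) • ((a + b) * ((a + b) * ((a + b) * (a + b)))) +
        (1 / 24 - s / 48) • (a * (a * (b * b)) + a * (b * (b * b)) + b * (b * (a * a)) +
          b * (b * (b * a)) - b * (a * (b * b)) - b * (b * (a * b))) +
        (1 / 12 - s / 24) • (a * (b * (b * a)) - a * (b * (a * b)) - b * (a * (b * a))) := by
  have h2 : s ^ 2 = 3 := by rw [pow_two, hs]
  have h3 : s ^ 3 = 3 * s := by rw [pow_succ, h2]
  have h4 : s ^ 4 = 9 := by rw [pow_succ, h3, mul_assoc, hs]; norm_num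
  simp only [PowerSeries.coeff_mul, coeff_exp_smul_monomial, Finset.Nat.antidiagonal_succ,
    Finset.Nat.antidiagonal_zero, Finset.sum_cons, Finset.map_cons,
    Finset.map_singleton, Finset.sum_singleton, Function.Embedding.coe_prodMap,
    Function.Embedding.coeFn_mk, Prod.map, Nat.factorial, Function.Embedding.refl_apply]
  simp only [pow_succ a, pow_succ b, pow_zero a, pow_zero b, one_mul, mul_one, mul_add, add_mul,
    smul_mul_assoc, mul_smul_comm, smul_smul, mul_assoc, smul_add, sub_mul, smul_sub,
    Nat.succ_eq_add_one, zero_add]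
  refine ⟨?_, ?_, ?_, ?_, ?_⟩
  · match_scalars; norm_num
  · match_scalars <;> ring
  · match_scalars <;> ring
  · match_scalars <;> ring_nf
    all_goals simp only [h2]; ring
  · match_scalars <;> ring_nf
    all_goals simp only [h2]; ring

theorem hasOrder_ABA42 : methodABA42.HasOrder [0, 4, 2] := by
  refine ⟨⟨1, by simp, by simp⟩, ?_⟩
  intro A εB i k h
  have h₂ : 1 ≤ k := supportedIn_pos_compProd_sub_exp (C := methodABA42)
    (by simp only [methodABA42, List.map_cons, List.map_nil, List.sum_cons, List.sum_nil]
        have h3 : 1 / √3 = √3 / 3 := by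
          rw [div_eq_div_iff (by positivity) (by norm_num), one_mul,
            Real.mul_self_sqrt (by norm_num)]
        rw [h3]
        ring) _ _ i k h
  have hC : compProd methodABA42 A εB =
      exp (((3 - √3) / 6) • A) * (exp ((1 / 2 : ℝ) • εB) * (exp ((√3 / 3) • A) *
        (exp ((1 / 2 : ℝ) • εB) * exp (((3 - √3) / 6) • A)))) := by
    have h3 : 1 / √3 = √3 / 3 := by
      rw [div_eq_div_iff (by positivity) (by norm_num), one_mul, Real.mul_self_sqrt (by norm_num)]
    simp [compProd, methodABA42, exp_zero, mul_assoc, ← h3]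
  obtain ⟨e₀, e₁, e₂, e₃, e₄⟩ := coeff_exp_ABA42
    (Polynomial.monomial 0 (FreeAlgebra.ι ℝ (0 : Fin 2)))
    (Polynomial.monomial 1 (FreeAlgebra.ι ℝ (1 : Fin 2)))
    (Real.mul_self_sqrt (show (0 : ℝ) ≤ 3 by norm_num))
  have key : ¬ (i < 3 ∨ i < 5 ∧ k = 1) := by
    intro hik
    refine h ?_
    rw [coeff₂, map_sub, coeff_exp_add_monomial₂, hC]
    rcases hik with hi | ⟨hi, rfl⟩
    · refine (congr_arg (fun q => Polynomial.coeff q k) (sub_eq_zero.2 ?_)).trans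
        (Polynomial.coeff_zero k)
      interval_cases i
      · exact e₀.trans (by simp)
      · exact e₁.trans (by simp)
      · exact e₂.trans (by rw [pow_two, one_div]; rfl)
    · interval_cases i
      · refine (congr_arg (fun q => Polynomial.coeff (q - _) 1) e₀).trans ?_
        simp
      · refine (congr_arg (fun q => Polynomial.coeff (q - _) 1) e₁).trans ?_
        simp
      · refine (congr_arg (fun q => Polynomial.coeff (q - _) 1) e₂).trans ?_
        rw [pow_two, one_div]
        simp
      · refine (congr_arg (fun q => Polynomial.coeff (q - _) 1) e₃).trans ?_
        have h6 : ((Nat.factorial 3 : ℕ) : ℝ)⁻¹ = 1 / 6 := by norm_num [Nat.factorial]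
        rw [h6, pow_succ', pow_two, add_sub_cancel_left]
        simp [Polynomial.monomial_mul_monomial, Polynomial.coeff_monomial]
      · refine (congr_arg (fun q => Polynomial.coeff (q - _) 1) e₄).trans ?_
        have h24 : ((Nat.factorial 4 : ℕ) : ℝ)⁻¹ = 1 / 24 := by norm_num [Nat.factorial]
        rw [h24, pow_succ', pow_succ', pow_two, add_assoc, add_sub_cancel_left]
        simp only [Polynomial.monomial_mul_monomial, Polynomial.coeff_add,
          Polynomial.coeff_sub, Polynomial.coeff_smul, Polynomial.coeff_monomial]
        norm_num
  -- For `k = 1` the error starts at `h ^ 5`, which is the entry `4`; for `k ≥ 2` it starts at `h ^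
  -- 3`, the entry `2`; `k = 0` is excluded by `h₂`.
  rcases Nat.lt_or_ge k 2 with hk | hk
  · exact ⟨1, h₂, by simp, by simp; omega⟩
  · exact ⟨2, hk, by simp, by simp; omega⟩

end FormalSeries
end

noncomputable section

section Hierarchical

open Set FormalSeries OppositeOperators

/-! ### The error functions -/

theorem orderFn_nonneg (o : List ℕ) {ε h : ℝ} (hε : 0 ≤ ε) (hh : 0 ≤ h) : 0 ≤ orderFn o ε h := by
  refine Finset.sum_nonneg fun l _ => ?_
  split_ifs
  · exact le_rfl
  · positivity

theorem le_orderFn {o : List ℕ} {l : ℕ} (hl : o.getD l 0 ≠ 0) {ε h : ℝ} (hε : 0 ≤ ε)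
    (hh : 0 ≤ h) : ε ^ l * h ^ (o.getD l 0) ≤ orderFn o ε h := by
  have hlen : l < o.length := by
    by_contra hlen
    exact hl (List.getD_eq_default _ _ (not_lt.1 hlen))
  refine le_trans (le_of_eq ?_) (Finset.single_le_sum (fun l _ => ?_) (Finset.mem_range.2 hlen))
  · exact (if_neg hl).symm
  · split_ifs
    · exact le_rfl
    · positivity

theorem orderFn_le (o : List ℕ) (ε₀ : ℝ) :
    ∃ C, ∀ ε ∈ Icc 0 ε₀, ∀ h : ℝ, 0 < h → h ≤ 1 → orderFn o ε h ≤ C * h := by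
  refine ⟨∑ l ∈ Finset.range o.length, |ε₀| ^ l, fun ε hε h hh hh' => ?_⟩
  rw [Finset.sum_mul]
  refine Finset.sum_le_sum fun l _ => ?_
  split_ifs with hl
  · positivity
  · exact mul_le_mul (pow_le_pow_left₀ hε.1 (hε.2.trans (le_abs_self _)) l)
      (pow_le_of_le_one hh.le hh' hl) (by positivity) (by positivity)

/-- Dividing `h ^ i ε ^ k` by the generating monomial `ε ^ l h ^ (o_l + 1)` leaves powers that are
bounded for `h ≤ 1` and `ε ≤ ε₀`. -/
theorem Dominates.orderFn (o : List ℕ) (ε₀ : ℝ) : Dominates (orderSet o) (orderFn o) ε₀ := by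
  rintro i k ⟨l, hl, h₀, h₁⟩
  refine ⟨|ε₀| ^ (k - l), fun ε hε h hh hh' => ?_⟩
  have hε₀ : ε ≤ |ε₀| := hε.2.trans (le_abs_self _)
  calc h ^ i * ε ^ k ≤ h ^ (o.getD l 0 + 1) * (|ε₀| ^ (k - l) * ε ^ l) := by
        refine mul_le_mul (pow_le_pow_of_le_one hh.le hh' h₁) ?_ (pow_nonneg hε.1 k)
          (by positivity)
        rw [← Nat.sub_add_cancel (show l ≤ k from hl), pow_add, Nat.add_sub_cancel]
        exact mul_le_mul_of_nonneg_right (pow_le_pow_left₀ hε.1 hε₀ _) (pow_nonneg hε.1 l)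
    _ = |ε₀| ^ (k - l) * (h * (ε ^ l * h ^ (o.getD l 0))) := by ring
    _ ≤ |ε₀| ^ (k - l) * (h * _root_.orderFn o ε h) :=
        mul_le_mul_of_nonneg_left (mul_le_mul_of_nonneg_left (le_orderFn h₀ hε.1 hh.le) hh.le)
          (by positivity)

theorem Dominates.union_add {M M' : Set (ℕ × ℕ)} {e e' : ℝ → ℝ → ℝ} {ε₀ : ℝ}
    (hM : Dominates M e ε₀) (hM' : Dominates M' e' ε₀) (he : ∀ ε h, 0 ≤ ε → 0 < h → 0 ≤ e ε h)
    (he' : ∀ ε h, 0 ≤ ε → 0 < h → 0 ≤ e' ε h) :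
    Dominates (M ∪ M') (fun ε h => e ε h + e' ε h) ε₀ := by
  rintro i k (hik | hik)
  · obtain ⟨C, hC⟩ := hM i k hik
    refine ⟨|C|, fun ε hε h hh hh' => (hC ε hε h hh hh').trans ?_⟩
    have h₁ := mul_nonneg hh.le (he ε h hε.1 hh)
    exact mul_le_mul (le_abs_self C) (mul_le_mul_of_nonneg_left
      (le_add_of_nonneg_right (he' ε h hε.1 hh)) hh.le) h₁ (abs_nonneg C)
  · obtain ⟨C, hC⟩ := hM' i k hik
    refine ⟨|C|, fun ε hε h hh hh' => (hC ε hε h hh hh').trans ?_⟩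
    have h₁ := mul_nonneg hh.le (he' ε h hε.1 hh)
    exact mul_le_mul (le_abs_self C) (mul_le_mul_of_nonneg_left
      (le_add_of_nonneg_left (he ε h hε.1 hh)) hh.le) h₁ (abs_nonneg C)

/-! ### Vector fields -/

variable {E : Type*} [NormedAddCommGroup E] [NormedSpace ℝ E] {U : TopologicalSpace.Opens E}

theorem IsFlow.congr {X Y : E → E} {Φ : ℝ → E → E} (hΦ : IsFlow U X Φ)
    (h : ∀ x ∈ U, Y x = X x) : IsFlow U Y Φ := fun γ t hγ =>
  hΦ γ t fun s hs => ⟨(hγ s hs).1, h _ (hγ s hs).1 ▸ (hγ s hs).2⟩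

theorem IsLieDerivative.congr {X Y : E → E} {D : Module.End ℝ (smoothFun U)}
    (hD : IsLieDerivative X D) (h : ∀ x ∈ U, Y x = X x) : IsLieDerivative Y D :=
  fun F x hx => by rw [hD F x hx, h x hx]

theorem ContDiffOn.differentiableAt_of_mem_opens {H : E → ℝ} (hH : ContDiffOn ℝ ∞ H U) {x : E}
    (hx : x ∈ U) : DifferentiableAt ℝ H x :=
  (hH.contDiffAt (U.isOpen.mem_nhds hx)).differentiableAt (by simp)

theorem PoissonStructure.vectorField_smul (P : PoissonStructure U) (c : ℝ) {H : E → ℝ}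
    (hH : ContDiffOn ℝ ∞ H U) {x : E} (hx : x ∈ U) :
    P.vectorField (c • H) x = c • P.vectorField H x := by
  rw [vectorField, vectorField, fderiv_const_smul (hH.differentiableAt_of_mem_opens hx), map_smul]

theorem PoissonStructure.vectorField_add (P : PoissonStructure U) {H K : E → ℝ}
    (hH : ContDiffOn ℝ ∞ H U) (hK : ContDiffOn ℝ ∞ K U) {x : E} (hx : x ∈ U) :
    P.vectorField (H + K) x = P.vectorField H x + P.vectorField K x := by
  rw [vectorField, vectorField, vectorField, fderiv_add (hH.differentiableAt_of_mem_opens hx)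
    (hK.differentiableAt_of_mem_opens hx), map_add]

/-! ### Global error -/

/-- `Represents.compose` is used for each inner method and once more for the outer one. The step
multiples of the outer method enter the inner exponents as factors, which gives `hierProd`. -/
theorem represents_hierarchical [FiniteDimensional ℝ E] (N : ℕ) (ε₀ : ℝ) (P : PoissonStructure U)
    {H₁ H₂ K₃ K₄ : E → ℝ} (hH₁ : ContDiffOn ℝ ∞ H₁ U) (hH₂ : ContDiffOn ℝ ∞ H₂ U)
    (hK₃ : ContDiffOn ℝ ∞ K₃ U) (hK₄ : ContDiffOn ℝ ∞ K₄ U)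
    {φ₁ φ₂ : ℝ → E → E} {φ₃ φ₄ : ℝ → ℝ → E → E}
    (hφ₁ : IsFlow U (P.vectorField H₁) φ₁) (hφ₂ : IsFlow U (P.vectorField H₂) φ₂)
    (hφ₃ : ∀ ε, IsFlow U (P.vectorField (ε • K₃)) (φ₃ ε))
    (hφ₄ : ∀ ε, IsFlow U (P.vectorField (ε • K₄)) (φ₄ ε)) (C₁ C₂ C₃ : CompMethod) :
    Represents N ε₀ (fun ε => C₃.compose (C₁.compose φ₁ φ₂) (C₂.compose (φ₃ ε) (φ₄ ε)))
      (hierProd C₁ C₂ C₃ (monomial₂ 1 0 (ofEnd (P.lieOp hH₁ : Module.End ℝ (smoothFun U))))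
        (monomial₂ 1 0 (ofEnd (P.lieOp hH₂ : Module.End ℝ (smoothFun U))))
        (monomial₂ 1 1 (ofEnd (P.lieOp hK₃ : Module.End ℝ (smoothFun U))))
        (monomial₂ 1 1 (ofEnd (P.lieOp hK₄ : Module.End ℝ (smoothFun U))))) := by
  have r₁ := represents_flow N ε₀ (P.contDiffOn_vectorField hH₁) (P.isLieDerivative_lieOp hH₁) 0
    (Φ := fun _ => φ₁) (fun ε => hφ₁.congr fun x hx => by rw [pow_zero, one_smul])
  have r₂ := represents_flow N ε₀ (P.contDiffOn_vectorField hH₂) (P.isLieDerivative_lieOp hH₂) 0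
    (Φ := fun _ => φ₂) (fun ε => hφ₂.congr fun x hx => by rw [pow_zero, one_smul])
  have r₃ := represents_flow N ε₀ (P.contDiffOn_vectorField hK₃) (P.isLieDerivative_lieOp hK₃) 1
    (Φ := φ₃) (fun ε => (hφ₃ ε).congr fun x hx => by rw [pow_one, P.vectorField_smul ε hK₃ hx])
  have r₄ := represents_flow N ε₀ (P.contDiffOn_vectorField hK₄) (P.isLieDerivative_lieOp hK₄) 1
    (Φ := φ₄) (fun ε => (hφ₄ ε).congr fun x hx => by rw [pow_one, P.vectorField_smul ε hK₄ hx])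
  have h := Represents.compose (Represents.compose r₁ r₂ C₁) (Represents.compose r₃ r₄ C₂) C₃ 1
  simpa only [one_mul, mul_one, hierProd, compProd, smul_smul] using h

theorem hasGlobalError_hierarchical [FiniteDimensional ℝ E] (P : PoissonStructure U)
    {H₁ H₂ K₃ K₄ : E → ℝ} (hH₁ : ContDiffOn ℝ ∞ H₁ U) (hH₂ : ContDiffOn ℝ ∞ H₂ U)
    (hK₃ : ContDiffOn ℝ ∞ K₃ U) (hK₄ : ContDiffOn ℝ ∞ K₄ U)
    {φ₁ φ₂ : ℝ → E → E} {φ₃ φ₄ : ℝ → ℝ → E → E}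
    (hφ₁ : IsFlow U (P.vectorField H₁) φ₁) (hφ₂ : IsFlow U (P.vectorField H₂) φ₂)
    (hφ₃ : ∀ ε, IsFlow U (P.vectorField (ε • K₃)) (φ₃ ε))
    (hφ₄ : ∀ ε, IsFlow U (P.vectorField (ε • K₄)) (φ₄ ε)) {C₁ C₂ C₃ : CompMethod} {p₁ p₂ : ℕ}
    {o : List ℕ} (h₁ : C₁.HasOrder [p₁]) (h₂ : C₂.HasOrder [p₂]) (h₃ : C₃.HasOrder o) :
    HasGlobalError U (fun ε => P.vectorField (H₁ + H₂ + ε • K₃ + ε • K₄))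
      (fun ε => C₃.compose (C₁.compose φ₁ φ₂) (C₂.compose (φ₃ ε) (φ₄ ε))) univ
      (fun ε h => orderFn [p₁] ε h + orderFn (slowOrder p₂) ε h + orderFn o ε h) := by
  have hp₁ : p₁ ≠ 0 := by
    obtain ⟨⟨l, -, hl⟩, -⟩ := h₁
    rcases l with _ | l
    · simpa using hl
    · simp at hl
  have hn : ∀ (o : List ℕ) (ε h : ℝ), 0 ≤ ε → 0 < h → 0 ≤ orderFn o ε h :=
    fun o ε h hε hh => orderFn_nonneg o hε hh.le
  -- `N = p₁` suffices, since the remainder `h ^ (p₁ + 1)` is itself an allowed monomial. This uses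
  -- `p₁ ≠ 0`, as an entry `0` stands for no term.
  refine hasGlobalError_of_represents (N := p₁) (M := hierSet p₁ p₂ o)
    (p := Polynomial.monomial 0 (ofEnd (P.lieOp hH₁ : Module.End ℝ (smoothFun U))) +
      Polynomial.monomial 0 (ofEnd (P.lieOp hH₂ : Module.End ℝ (smoothFun U))) +
      Polynomial.monomial 1 (ofEnd (P.lieOp hK₃ : Module.End ℝ (smoothFun U))) +
      Polynomial.monomial 1 (ofEnd (P.lieOp hK₄ : Module.End ℝ (smoothFun U)))) (fun ε => ?_)
    (fun ε₀ => represents_hierarchical p₁ ε₀ P hH₁ hH₂ hK₃ hK₄ hφ₁ hφ₂ hφ₃ hφ₄ C₁ C₂ C₃) ?_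
    (fun ε₀ => ?_) (fun ε h hε hh => ?_) (fun ε₀ => ?_) ?_
  · have hK₃' : ContDiffOn ℝ ∞ (ε • K₃) U := contDiffOn_const.smul hK₃
    have hK₄' : ContDiffOn ℝ ∞ (ε • K₄) U := contDiffOn_const.smul hK₄
    simp only [map_add, evalAt_monomial, pow_zero, one_smul, pow_one, toEnd_add, toEnd_smul,
      toEnd_ofEnd]
    refine ((((P.isLieDerivative_lieOp hH₁).add (P.isLieDerivative_lieOp hH₂)).add
      ((P.isLieDerivative_lieOp hK₃).smul ε)).add ((P.isLieDerivative_lieOp hK₄).smul ε)).congr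
      fun x hx => ?_
    have hs : ContDiffOn ℝ ∞ (H₁ + H₂) U := hH₁.add hH₂
    have hs' : ContDiffOn ℝ ∞ (H₁ + H₂ + ε • K₃) U := hs.add hK₃'
    rw [P.vectorField_add hs' hK₄' hx, P.vectorField_add hs hK₃' hx,
      P.vectorField_add hH₁ hH₂ hx, P.vectorField_smul ε hK₃ hx, P.vectorField_smul ε hK₄ hx]
  · simp only [map_add]
    exact supportedIn_hierProd_sub_exp h₁ h₂ h₃ _ _ _ _
  · exact ((Dominates.orderFn _ ε₀).union_add (Dominates.orderFn _ ε₀) (hn _) (hn _)).union_add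
      (Dominates.orderFn _ ε₀) (fun ε h hε hh => add_nonneg (hn _ ε h hε hh) (hn _ ε h hε hh)) (hn _)
  · exact add_nonneg (add_nonneg (hn _ ε h hε hh) (hn _ ε h hε hh)) (hn _ ε h hε hh)
  · obtain ⟨c₁, hc₁⟩ := orderFn_le [p₁] ε₀
    obtain ⟨c₂, hc₂⟩ := orderFn_le (slowOrder p₂) ε₀
    obtain ⟨c₃, hc₃⟩ := orderFn_le o ε₀
    refine ⟨c₁ + c₂ + c₃, fun ε hε h hh hh' => ?_⟩
    rw [add_mul, add_mul]
    exact add_le_add (add_le_add (hc₁ ε hε h hh hh') (hc₂ ε hε h hh hh')) (hc₃ ε hε h hh hh')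
  · exact Or.inl (Or.inl (mem_orderSet_singleton.2 ⟨hp₁, le_rfl⟩))

theorem HasGlobalError.mono {X : ℝ → E → E} {φ : ℝ → ℝ → E → E} {R R' : Set (ℝ × ℝ)}
    {e e' : ℝ → ℝ → ℝ} (h : HasGlobalError U X φ R e) (hR : R' ⊆ R)
    (he : ∀ ε₀ : ℝ, ∃ C > 0, ∀ ε h : ℝ, (ε, h) ∈ R' → 0 ≤ ε → ε ≤ ε₀ → 0 < h → h ≤ 1 →
      e ε h ≤ C * e' ε h) : HasGlobalError U X φ R' e' := by
  intro K hK hKU T ε₀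
  obtain ⟨c, hc, h₀, hh₀, H⟩ := h K hK hKU T ε₀
  obtain ⟨C, hC, hCe⟩ := he ε₀
  refine ⟨c * C, mul_pos hc hC, min h₀ 1, lt_min hh₀ one_pos, ?_⟩
  intro ε h hR₁ hε hε' hh hh' γ hγ hγK n hn
  refine (H ε h (hR hR₁) hε hε' hh (hh'.trans (min_le_left _ _)) γ hγ hγK n hn).trans ?_
  rw [mul_assoc]
  exact mul_le_mul_of_nonneg_left (hCe ε h hR₁ hε hε' hh (hh'.trans (min_le_right _ _))) hc.le

theorem orderFn_singleton {p : ℕ} (hp : p ≠ 0) (ε h : ℝ) : orderFn [p] ε h = h ^ p := by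
  simp [orderFn, hp]

theorem orderFn_slowOrder {p : ℕ} (hp : p ≠ 0) (ε h : ℝ) :
    orderFn (slowOrder p) ε h = ε ^ (p + 1) * h ^ p := by
  have h : ∀ l, (if (slowOrder p).getD l 0 = 0 then 0 else ε ^ l * h ^ ((slowOrder p).getD l 0)) =
      if l = p + 1 then ε ^ (p + 1) * h ^ p else 0 := by
    intro l
    rw [getD_slowOrder]
    split_ifs <;> simp_all
  rw [orderFn, Finset.sum_congr rfl fun l _ => h l, Finset.sum_ite_eq', if_pos]
  simp [slowOrder]

end Hierarchical
end

/-! ### The general theorem and the two schemes -/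

theorem mainTheorem1
    {E : Type*} [NormedAddCommGroup E] [NormedSpace ℝ E] [FiniteDimensional ℝ E]
    (U : TopologicalSpace.Opens E) (P : PoissonStructure U)
    -- the Hamiltonian `H = H₁ + H₂ + ε K₃ + ε K₄`, i.e. `H₃ = ε K₃` and `H₄ = ε K₄`
    (H₁ H₂ K₃ K₄ : E → ℝ)
    (hH₁ : ContDiffOn ℝ ∞ H₁ U) (hH₂ : ContDiffOn ℝ ∞ H₂ U)
    (hK₃ : ContDiffOn ℝ ∞ K₃ U) (hK₄ : ContDiffOn ℝ ∞ K₄ U)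
    -- the four exact flows
    (φ₁ φ₂ : ℝ → E → E) (φ₃ φ₄ : ℝ → ℝ → E → E)
    (hφ₁ : IsFlow U (P.vectorField H₁) φ₁) (hφ₂ : IsFlow U (P.vectorField H₂) φ₂)
    (hφ₃ : ∀ ε, IsFlow U (P.vectorField (ε • K₃)) (φ₃ ε))
    (hφ₄ : ∀ ε, IsFlow U (P.vectorField (ε • K₄)) (φ₄ ε)) :
    -- the exact system and the hierarchical integrator
    let X : ℝ → E → E := fun ε => P.vectorField (H₁ + H₂ + ε • K₃ + ε • K₄)
    let φ : CompMethod → CompMethod → CompMethod → ℝ → ℝ → E → E := fun C₁ C₂ C₃ ε =>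
      C₃.compose (C₁.compose φ₁ φ₂) (C₂.compose (φ₃ ε) (φ₄ ε))
    -- the Lie operators `h ℒ_{H_i}`
    let ℒ₁ := P.lieSeries hH₁ 0
    let ℒ₂ := P.lieSeries hH₂ 0
    let ℒ₃ := P.lieSeries hK₃ 1
    let ℒ₄ := P.lieSeries hK₄ 1
    -- the general result
    (∀ (C₁ C₂ C₃ : CompMethod) (p₁ p₂ : ℕ) (o : List ℕ),
      C₁.HasOrder [p₁] → C₂.HasOrder [p₂] → C₃.HasOrder o →
      -- the global error is the sum of the errors of the three methods
      HasGlobalError U X (φ C₁ C₂ C₃) Set.univ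
        (fun ε h => orderFn [p₁] ε h + orderFn (slowOrder p₂) ε h + orderFn o ε h) ∧
      -- the exponents of the two inner methods
      (∃ A₁ A₂ E₁ E₂ : FormalSeries (Module.End ℝ (smoothFun U)),
        FormalSeries.compProd C₁ ℒ₁ ℒ₂ = FormalSeries.exp A₁ ∧ A₁ = ℒ₁ + ℒ₂ + E₁ ∧
        FormalSeries.compProd C₂ ℒ₃ ℒ₄ = FormalSeries.exp A₂ ∧ A₂ = ℒ₃ + ℒ₄ + E₂ ∧
        FormalSeries.IsOfOrder [p₁] E₁ ∧ FormalSeries.IsOfOrder (slowOrder p₂) E₂ ∧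
        IsLieOperator A₁ ∧ IsLieOperator A₂ ∧
        -- the outer method applied to the exponentials of `A₁` and `A₂`
        ∃ A₃ E₃ : FormalSeries (Module.End ℝ (smoothFun U)),
          FormalSeries.compProd C₃ A₁ A₂ = FormalSeries.exp A₃ ∧
          A₃ = A₁ + A₂ + E₃ ∧ A₃ = ℒ₁ + ℒ₂ + ℒ₃ + ℒ₄ + E₁ + E₂ + E₃ ∧
          FormalSeries.IsOfOrder o E₃ ∧ IsLieOperator A₃) ∧
      -- the same with the inner methods run at the step sizes that the outer one prescribes
      (∃ A₃ E₁ E₂ E₃ : FormalSeries (Module.End ℝ (smoothFun U)),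
        FormalSeries.hierProd C₁ C₂ C₃ ℒ₁ ℒ₂ ℒ₃ ℒ₄ = FormalSeries.exp A₃ ∧
        A₃ = ℒ₁ + ℒ₂ + ℒ₃ + ℒ₄ + E₁ + E₂ + E₃ ∧
        FormalSeries.IsOfOrder [p₁] E₁ ∧ FormalSeries.IsOfOrder (slowOrder p₂) E₂ ∧
        FormalSeries.IsOfOrder o E₃ ∧ IsLieOperator A₃)) ∧
    -- the scheme `M_642`
    (∀ a₁ a₂ a₃ a₄ : ℝ, (methodS6 a₁ a₂ a₃ a₄).HasOrder [6] →
      HasGlobalError U X (φ (methodS6 a₁ a₂ a₃ a₄) methodVerlet methodABA42) Set.univ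
        (fun ε h => h ^ 6 + ε * h ^ 4 + ε ^ 2 * h ^ 2)) ∧
    -- the scheme `M_42`
    HasGlobalError U X (φ methodTriJump methodEuler methodABA22) Set.univ
      (fun ε h => h ^ 4 + ε * h ^ 2 + ε ^ 2 * h) ∧
    (∀ κ : ℝ, HasGlobalError U X (φ methodTriJump methodEuler methodABA22)
      {εh | εh.1 ≤ κ * εh.2} (fun ε h => h ^ 4 + ε * h ^ 2)) := by 
  intro X φ ℒ₁ ℒ₂ ℒ₃ ℒ₄
  have hglobal : ∀ (C₁ C₂ C₃ : CompMethod) (p₁ p₂ : ℕ) (o : List ℕ),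
      C₁.HasOrder [p₁] → C₂.HasOrder [p₂] → C₃.HasOrder o →
      HasGlobalError U X (φ C₁ C₂ C₃) Set.univ
        (fun ε h => orderFn [p₁] ε h + orderFn (slowOrder p₂) ε h + orderFn o ε h) :=
    fun _ _ _ _ _ _ h₁ h₂ h₃ =>
      hasGlobalError_hierarchical P hH₁ hH₂ hK₃ hK₄ hφ₁ hφ₂ hφ₃ hφ₄ h₁ h₂ h₃
  have h₄₂ : HasGlobalError U X (φ methodTriJump methodEuler methodABA22) Set.univ
      (fun ε h => h ^ 4 + ε * h ^ 2 + ε ^ 2 * h) := by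
    refine (hglobal _ _ _ 4 1 [0, 2] FormalSeries.hasOrder_triJump FormalSeries.hasOrder_euler
      FormalSeries.hasOrder_ABA22).mono subset_rfl fun ε₀ => ⟨1, one_pos, ?_⟩
    intro ε h _ _ _ _ _
    refine le_of_eq ?_
    rw [orderFn_singleton four_ne_zero, orderFn_slowOrder one_ne_zero]
    simp [orderFn, Finset.sum_range_succ]
    ring
  refine ⟨fun C₁ C₂ C₃ p₁ p₂ o h₁ h₂ h₃ => ⟨hglobal _ _ _ _ _ _ h₁ h₂ h₃, ?_, ?_⟩, ?_, h₄₂, ?_⟩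
  · exact FormalSeries.exists_exponents h₁ h₂ h₃ (P.lieOp hH₁) (P.lieOp hH₂) (P.lieOp hK₃) (P.lieOp hK₄)
      rfl rfl rfl rfl
  · exact FormalSeries.exists_hierarchical_exponent h₁ h₂ h₃ (P.lieOp hH₁) (P.lieOp hH₂) (P.lieOp hK₃)
      (P.lieOp hK₄) rfl rfl rfl rfl
  · intro a₁ a₂ a₃ a₄ h₆
    refine (hglobal _ _ _ 6 2 [0, 4, 2] h₆ FormalSeries.hasOrder_verlet
      FormalSeries.hasOrder_ABA42).mono subset_rfl fun ε₀ => ⟨1 + |ε₀|, by positivity, ?_⟩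
    intro ε h _ hε hε' hh _
    rw [orderFn_singleton (by norm_num), orderFn_slowOrder two_ne_zero]
    simp only [orderFn, List.length_cons, List.length_nil, Finset.sum_range_succ,
      Finset.sum_range_zero, List.getD_cons_zero, List.getD_cons_succ, if_true, pow_one]
    norm_num
    -- The slow Verlet method contributes `ε ^ 3 h ^ 2`; the term `ε ^ 2 h ^ 2` of the outer method
    -- absorbs it at the price of the factor `|ε₀|`.
    have h₁ : ε * (ε ^ 2 * h ^ 2) ≤ |ε₀| * (ε ^ 2 * h ^ 2) :=
      mul_le_mul_of_nonneg_right (hε'.trans (le_abs_self ε₀)) (by positivity)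
    have h₂ : 0 ≤ |ε₀| * (h ^ 6 + ε * h ^ 4) := by positivity
    linarith [show ε ^ 3 * h ^ 2 = ε * (ε ^ 2 * h ^ 2) by ring]
  · intro κ
    refine h₄₂.mono (Set.subset_univ _) fun ε₀ => ⟨1 + |κ|, by positivity, ?_⟩
    intro ε h hκ hε _ hh _
    -- In the regime `ε ≤ κ h` the term `ε ^ 2 h` is at most `|κ| ε h ^ 2`, hence the constant `1 +
    -- |κ|`.
    have h₁ : ε * (ε * h) ≤ |κ| * h * (ε * h) := mul_le_mul_of_nonneg_right
      (le_trans hκ (mul_le_mul_of_nonneg_right (le_abs_self κ) hh.le)) (by positivity)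
    have h₂ : 0 ≤ |κ| * h ^ 4 := by positivity
    linarith [show ε ^ 2 * h = ε * (ε * h) by ring,
      show |κ| * h * (ε * h) = |κ| * (ε * h ^ 2) by ring]
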